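/- **Setting.** Let $K$ be a field and let $q\in K$, $q\neq 0$, be not a root of unity (for instance $K=\mathbb C(q)$ with $q$ an indeterminate). Let $M\ge 1$, $N\ge 0$ be integers, $Q=q^M$, $[n]=\sum_{i=0}^{n-1}q^{n-1-2i}$. Let $V_1=Kv_1\oplus Kv_{-1}$ with $Ev_1=0$, $Ev_{-1}=v_1$, $Fv_1=v_{-1}$, $Fv_{-1}=0$, $\mathsf Kv_{\pm1}=q^{\pm1}v_{\pm1}$. The operator $X=F+q^{-1}\mathsf KE+s\mathsf K$, $s=\frac{Q-Q^{-1}}{q-q^{-1}}$, acts on $V_1^{\otimes N}$ through the comultiplication $\Delta(X)=\mathsf K\otimes X+q^{-1}\mathsf KE\otimes 1+F\otimes 1$ (for $N=0$ it acts on $K$ as $s$). **Diagrams and basis.** Let $b\in\{+,-\}^N$; read $+$ as an up arrow and $-$ as a down arrow. Join adjacent down-up pairs (in this order) by an arc, and repeat, ignoring arrows already joined, as long as possible. Among the remaining down arrows, the $(M+1-p)$-th from the right, if it exists, gets the integer $p$ for $1\le p\le M$; the integer $1$ is called the star. The remaining down arrows are joined in adjacent pairs, from right to left, by dashed arcs;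 at most one unpaired down arrow is left. The diagram $D$ obtained denotes the tensor product in $V_1^{\otimes N}$ of the vectors $v_{-1}\otimes v_1-q^{-1}v_1\otimes v_{-1}$ (arc), $v_{-1}\otimes v_{-1}-q^{-1}v_1\otimes v_1$ (dashed arc), $v_{-1}-q^{-p}v_1$ (down arrow with the integer $p$), $v_1$ (up arrow not in an arc), $v_{-1}$ (unpaired down arrow). These $2^N$ vectors are the type BI Kazhdan–Lusztig basis. **The components $\Psi_D$.** Number the arrows $1,\dots,N$ from left to right. Let $N_\uparrow$ be the number of up arrows not in an arc, $N_1\in\{0,1\}$ the number of unpaired down arrows, $S$ the set of arcs, $T$ the set of dashed arcs, $T'$ the set $T$ without its leftmost element, $U$ (resp. $U'$) the set of down arrows with an integer $p$, $2\le p\le M$ (resp. $2\le p\le M-1$), and $V$ (resp. $V'$) the union of $U$ (resp. $U'$) with the star, if it exists. Let $s_p$ be the position of the down arrow with the integer $p$ ($s_1$ that of the star). Let * $S_R$: arcs to the right of the down arrow with the integer $M$ (empty if there is none); * $S_{W'}$: arcs to the right of the star and to the left of the down arrow with the integer $M$ (empty if there is no star); * $S_W$: arcs to the left of the star and to the right of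 the unpaired down arrow if $N_1=1$, or of the leftmost down arrow in a dashed arc if $N_1=0$ (empty if there is no star, or if $N_1=0$ and $T=\emptyset$); * $S_L$: if there is a star, the arcs to the left of the leftmost down arrow that is not in an arc and to the right of every up arrow that is not in an arc (empty if there is no star). An arc is outer if it lies inside no other arc and no dashed arc; $S_R^+,S_W^+,S_L^+$ are the sets of outer arcs in $S_R,S_W,S_L$. An arc $A$ from position $i$ to $j$ has size $m_A=(j-i+1)/2$. Put $$N_2=N_\uparrow+N_1+|S|+|T|,\quad N_3=|S_W|+|T|,\quad N_4=|S_{W'}|+|S_W|+|T|+M,$$ $$N_5=N-|S|+|S_L|+|S_W|+|S_{W'}|+|S_R|+M,$$ and $N_6=[N_5]/[N_4]$ if $|V|=M$ and $N_1=0$, $N_6=1$ otherwise. For an arc $A$ from $i$ to $j$, a down arrow $C$ with the integer $p$, and a dashed arc $E$ starting at position $k$, put $$d_{1,A,C}=\tfrac{i-s_p+M-p+1}2,\quad d_{2,A}=\tfrac{i-s_1+M}2,\quad d_{3,A}=N-j,\quad d_{4,C}=\tfrac{s_M-s_p+M-p}2+1,\quad d_{5,E}=\tfrac{s_M-k+M+1}2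 .$$ For $A'\in S_W$ let $h_{A'}$ be the number of arcs in $S_W$ that are to the right of $A'$, contain $A'$, or equal $A'$, plus the number of dashed arcs to the right of $A'$. Then $$N_7=\prod_{C\in U}\prod_{A\in S_R^+}\frac{[d_{1,A,C}]}{[d_{1,A,C}+m_A]},$$ $$N_8=\prod_{A\in S_R^+}\Bigl(\prod_{i=0}^{N_3}\frac{[d_{2,A}+i]}{[d_{2,A}+m_A+i]}\prod_{A'\in S_W}\frac{[d_{2,A}+m_A+h_{A'}]}{[d_{2,A}+h_{A'}]}\Bigr)\ \text{if }|V|=M,\qquad N_8=1\ \text{otherwise},$$ $$N_9=\prod_{A}\frac{[d_{3,A}+m_A+M]}{[d_{3,A}+2m_A+M]},\quad A\in S_W^+\text{ if }N_1=1,\quad A\in S_W^+\cup S_L^+\text{ if }N_1=0,$$ $$N_{10}=\begin{cases}\prod_{C\in U'}[d_{4,C}]^{-1},&N_1=0,\ T=\emptyset,\\ \prod_{C\in V'}[d_{4,C}]^{-1}\prod_{E\in T'}[d_{5,E}]^{-1},&N_1=0,\ T\ne\emptyset,\\ \prod_{C\in V'}[d_{4,C}]^{-1}\prod_{E\in T}[d_{5,E}]^{-1},&N_1=1.\end{cases}$$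 Order the up arrows not in an arc, the unpaired down arrow, the arcs, the dashed arcs and the elements of $U$ by their left ends, from left to right, and number them $1,2,\dots$; write $N_A$ for the number of $A$ and $N_\downarrow$ for that of the unpaired down arrow. Then $N_{11}=\prod_{A\in S\cup T\cup U}[N_A]$, multiplied by $[N_\downarrow]$ if $N_1=1$. Order the arcs, the dashed arcs and the elements of $V$ by their left ends, from right to left, and number them $1,2,\dots$, writing $N_B$ for the number of $B$; let $$N_{12}=\frac{\prod_{i=1}^{N_2}(q^{i+M-1}+q^{-(i+M-1)})}{\prod_{B\in T\cup(V\setminus U)}(q^{N_B}+q^{-N_B})}.$$ Finally $\Psi_D=\prod_{A\in S}[m_A]^{-1}\cdot N_6N_7N_8N_9N_{10}N_{11}N_{12}$ and $\Psi=\sum_D\Psi_D\,D\in V_1^{\otimes N}$. **Theorem.** The vectors $D$ form a basis of $V_1^{\otimes N}$, and $\Psi$ is a (nonzero) eigenvector of $X$ on $V_1^{\otimes N}$ with eigenvalue $[N+M]$. This eigenvalue has multiplicity one: its eigenspace is one-dimensional, and it is a simple root of the characteristic polynomial of $X$. -/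

import Mathlib

open scoped BigOperators

namespace TypeBI

/-! ### Quantum integers -/

/-- The quantum integer `[n] = ∑_{i=0}^{n-1} q^{n-1-2i}`. -/
def qint {K : Type*} [Field K] (q : K) (n : ℕ) : K :=
  ∑ i ∈ Finset.range n, q ^ ((n : ℤ) - 1 - 2 * (i : ℤ))

/-- The sum `q^n + q^{-n}`. -/
def qang {K : Type*} [Field K] (q : K) (n : ℕ) : K :=
  q ^ n + (q ^ n)⁻¹

/-! ### The operator `X` on the tensor power of `V₁`

The standard basis of `V₁` is `v₁, v₋₁`, indexed by `true, false`; the standard basis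
`v_{ε₁} ⊗ ⋯ ⊗ v_{ε_N}` of `V₁^{⊗N}` is indexed by strings `ε : Fin N → Bool`.  Vectors are
coordinate functions, operators are matrices acting on column vectors. -/

/-- `E v₁ = 0`, `E v₋₁ = v₁`. -/
def opE (K : Type*) [Field K] : Matrix Bool Bool K :=
  fun ε δ => if ε = true ∧ δ = false then 1 else 0

/-- `F v₁ = v₋₁`, `F v₋₁ = 0`. -/
def opF (K : Type*) [Field K] : Matrix Bool Bool K :=
  fun ε δ => if ε = false ∧ δ = true then 1 else 0

/-- `K v₁ = q v₁`, `K v₋₁ = q⁻¹ v₋₁`. -/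
def opK {K : Type*} [Field K] (q : K) : Matrix Bool Bool K :=
  Matrix.diagonal fun ε => if ε = true then q else q⁻¹

/-- The operator `A ⊗ B` on `V₁ ⊗ V₁^{⊗N} = V₁^{⊗(N+1)}`. -/
def tensorOp {K : Type*} [Field K] {N : ℕ} (A : Matrix Bool Bool K)
    (B : Matrix (Fin N → Bool) (Fin N → Bool) K) :
    Matrix (Fin (N + 1) → Bool) (Fin (N + 1) → Bool) K :=
  fun ε δ => A (ε 0) (δ 0) * B (Fin.tail ε) (Fin.tail δ)

/-- The parameter `s = (Q - Q⁻¹) / (q - q⁻¹)`. -/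
def paramS {K : Type*} [Field K] (q Q : K) : K :=
  (Q - Q⁻¹) / (q - q⁻¹)

/-- The action on `V₁^{⊗N}` of the generator `X = F + c K E + s K` of the coideal subalgebra, with
`c = q⁻¹` and `s = (Q - Q⁻¹) / (q - q⁻¹)`.  It is given by the comultiplication
`Δ(X) = K ⊗ X + c K E ⊗ 1 + F ⊗ 1`, starting from the trivial representation (`N = 0`), where
`X` acts through the counit, that is, by `s`. -/
def opX {K : Type*} [Field K] (q Q : K) :
    (N : ℕ) → Matrix (Fin N → Bool) (Fin N → Bool) K
  | 0 => paramS q Q • 1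
  | N + 1 => tensorOp (opK q) (opX q Q N) + tensorOp (q⁻¹ • (opK q * opE K)) 1
      + tensorOp (opF K) 1

/-! ### Diagrams of type BI

A binary string in `{+,-}^N` is a function `b : Fin N → Bool`; `true` is `+`, an up arrow,
and `false` is `-`, a down arrow. -/

section Diagram

variable {N : ℕ} (M : ℕ) (b : Fin N → Bool)

/-- The position of an arrow, counted from left to right starting with `1`. -/
def pos (i : Fin N) : ℕ := (i : ℕ) + 1

/-- The number of arrows of direction `s` at the places `i, …, k`. -/
def countIn (s : Bool) (i k : Fin N) : ℕ :=
  ((Finset.Icc i k).filter fun l => b l = s).card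

/-- The down arrow `i` and the up arrow `j` form an arc: this is the bracket matching that results
from repeatedly joining a down arrow to an up arrow that is next to it on the right, with the
arrows already joined left out (down arrows open, up arrows close). -/
def IsArc (i j : Fin N) : Prop :=
  b i = false ∧ b j = true ∧ i < j ∧ countIn b true i j = countIn b false i j ∧
    ∀ k, i ≤ k → k < j → countIn b true i k < countIn b false i k

instance (i j : Fin N) : Decidable (IsArc b i j) := by
  unfold IsArc; infer_instance

/-- `S`: the set of arcs. -/
def arcs : Finset (Fin N × Fin N) :=
  Finset.univ.filter fun A => IsArc b A.1 A.2

/-- The up arrows that are not part of an arc. -/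
def upArrows : Finset (Fin N) :=
  Finset.univ.filter fun i => b i = true ∧ ∀ j, ¬ IsArc b j i

/-- The down arrows that are not part of an arc. -/
def downArrows : Finset (Fin N) :=
  Finset.univ.filter fun i => b i = false ∧ ∀ j, ¬ IsArc b i j

/-- `i` is the `rank i`-th element of `downArrows` from the right (for `i` in this set). -/
def rank (i : Fin N) : ℕ :=
  ((downArrows b).filter fun j => i ≤ j).card

/-- The down arrow with the integer `p`, `1 ≤ p ≤ M`: the `(M+1-p)`-th one from the right.
The integer `1` stands for the star.  The set has at most one element. -/
def labelled (p : ℕ) : Finset (Fin N) :=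
  (downArrows b).filter fun i => 1 ≤ p ∧ rank b i + p = M + 1

/-- `V`: the down arrows with an integer `p`, `2 ≤ p ≤ M`, or a star. -/
def setV : Finset (Fin N) :=
  (downArrows b).filter fun i => rank b i ≤ M

/-- The integer on a down arrow in `V` (`1` for the star). -/
def label (i : Fin N) : ℕ := M + 1 - rank b i

/-- `U`: the down arrows with an integer `p`, `2 ≤ p ≤ M`. -/
def setU : Finset (Fin N) :=
  (setV M b).filter fun i => 2 ≤ label M b i

/-- `U'`: the down arrows with an integer `p`, `2 ≤ p ≤ M - 1`. -/
def setU' : Finset (Fin N) :=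
  (setU M b).filter fun i => label M b i + 1 ≤ M

/-- `V'`: the union of `U'` and the down arrow with a star. -/
def setV' : Finset (Fin N) := setU' M b ∪ labelled M b 1

/-- `T`: the dashed arcs.  The down arrows beyond the `M`-th one from the right are joined in
adjacent pairs, from right to left. -/
def dashedArcs : Finset (Fin N × Fin N) :=
  (downArrows b ×ˢ downArrows b).filter fun E =>
    M < rank b E.2 ∧ (rank b E.2 - M) % 2 = 1 ∧ rank b E.1 = rank b E.2 + 1

/-- The unpaired down arrow, which carries no label and is in no arc and no dashed arc.
The set has at most one element. -/
def unpairedDown : Finset (Fin N) :=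
  (downArrows b).filter fun i =>
    M < rank b i ∧ ∀ j, (i, j) ∉ dashedArcs M b ∧ (j, i) ∉ dashedArcs M b

/-! ### Kazhdan–Lusztig basis of type BI -/

/-- The coordinates of the basis vector `v_s` of `V₁`. -/
def stdVec (K : Type*) [Field K] (s : Bool) : Bool → K :=
  fun ε => if ε = s then 1 else 0

/-- The vector of `V₁^{⊗N}` given by the diagram of `b`, the tensor product of
* `v₋₁ ⊗ v₁ - q⁻¹ v₁ ⊗ v₋₁` for each arc,
* `v₋₁ ⊗ v₋₁ - q⁻¹ v₁ ⊗ v₁` for each dashed arc,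
* `v₋₁ - q^{-p} v₁` for the down arrow with the integer `p` (`p = 1` for the star),
* `v₁` for each up arrow and `v₋₁` for the unpaired down arrow. -/
def klVec {K : Type*} [Field K] (q : K) : (Fin N → Bool) → K := fun ε =>
  (∏ A ∈ arcs b, (stdVec K false (ε A.1) * stdVec K true (ε A.2)
      - q⁻¹ * (stdVec K true (ε A.1) * stdVec K false (ε A.2)))) *
  (∏ E ∈ dashedArcs M b, (stdVec K false (ε E.1) * stdVec K false (ε E.2)
      - q⁻¹ * (stdVec K true (ε E.1) * stdVec K true (ε E.2)))) *
  (∏ c ∈ setV M b, (stdVec K false (ε c) - (q ^ label M b c)⁻¹ * stdVec K true (ε c))) *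
  (∏ u ∈ upArrows b, stdVec K true (ε u)) *
  (∏ d ∈ unpairedDown M b, stdVec K false (ε d))

/-! ### The vector `Ψ` -/

/-- The position `s_p` of the down arrow with the integer `p` (of the star for `p = 1`);
only used when this arrow exists. -/
def labelPos (p : ℕ) : ℕ := (labelled M b p).sup pos

/-- `m_A = (j - i + 1) / 2`, the size of the arc `A` from `i` to `j`. -/
def size (A : Fin N × Fin N) : ℕ := (pos A.2 - pos A.1 + 1) / 2

/-- `S_R`: arcs to the right of the down arrow with the integer `M`. -/
def setSR : Finset (Fin N × Fin N) :=
  (arcs b).filter fun A => ∃ c ∈ labelled M b M, c < A.1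

/-- `S_{W'}`: arcs between the star and the down arrow with the integer `M`. -/
def setSW' : Finset (Fin N × Fin N) :=
  (arcs b).filter fun A => (∃ c ∈ labelled M b 1, c < A.1) ∧ ∃ c ∈ labelled M b M, A.2 < c

/-- `S_W`: arcs to the left of the star and to the right of the unpaired down arrow or, if there is
none, of the leftmost down arrow forming a dashed arc. -/
def setSW : Finset (Fin N × Fin N) :=
  (arcs b).filter fun A => (∃ c ∈ labelled M b 1, A.2 < c) ∧
    ((∃ d ∈ unpairedDown M b, d < A.1) ∨
      (unpairedDown M b = ∅ ∧ ∃ E ∈ dashedArcs M b, E.1 < A.1))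

/-- `S_L`: if there is a star, the arcs to the left of all down arrows that form no arc and to the
right of all up arrows that form no arc. -/
def setSL : Finset (Fin N × Fin N) :=
  (arcs b).filter fun A => (labelled M b 1).Nonempty ∧
    (∀ d ∈ downArrows b, A.2 < d) ∧ ∀ u ∈ upArrows b, u < A.1

/-- `S⁺`: outer arcs, those inside no other arc and no dashed arc. -/
def outerArcs : Finset (Fin N × Fin N) :=
  (arcs b).filter fun A => ∀ C ∈ arcs b ∪ dashedArcs M b, ¬ (C.1 < A.1 ∧ A.2 < C.2)

/-- `T'`: the dashed arcs except the leftmost one. -/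
def setT' : Finset (Fin N × Fin N) :=
  (dashedArcs M b).filter fun E => ∃ E' ∈ dashedArcs M b, E'.1 < E.1

/-- `h_{A'}`: the number of arcs in `S_W` to the right of `A'` or outside of `A'` (including `A'`)
plus the number of dashed arcs to the right of `A'`. -/
def arcH (A' : Fin N × Fin N) : ℕ :=
  ((setSW M b).filter fun C => A'.2 < C.1 ∨ (C.1 ≤ A'.1 ∧ A'.2 ≤ C.2)).card
    + ((dashedArcs M b).filter fun E => A'.2 < E.1).card

def n1 : ℕ := (unpairedDown M b).card

def n2 : ℕ := (upArrows b).card + n1 M b + (arcs b).card + (dashedArcs M b).card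

def n3 : ℕ := (setSW M b).card + (dashedArcs M b).card

def n4 : ℕ := (setSW' M b).card + (setSW M b).card + (dashedArcs M b).card + M

def n5 : ℕ := N - (arcs b).card + (setSL M b).card + (setSW M b).card + (setSW' M b).card
  + (setSR M b).card + M

/-- `d_{1,A,C}`, for an arc `A` starting at `i` and `C` with the integer `p` at `s_p`:
`(i - s_p + M - p + 1) / 2`. -/
def d1 (A : Fin N × Fin N) (C : Fin N) : ℕ :=
  (pos A.1 - pos C + (M - label M b C) + 1) / 2

/-- `d_{2,A} = (i - s_1 + M) / 2`. -/
def d2 (A : Fin N × Fin N) : ℕ := (pos A.1 - labelPos M b 1 + M) / 2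

/-- `d_{3,A} = N - j`. -/
def d3 (A : Fin N × Fin N) : ℕ := N - pos A.2

/-- `d_{4,C} = (s_M - s_p + M - p) / 2 + 1`. -/
def d4 (C : Fin N) : ℕ := (labelPos M b M - pos C + (M - label M b C)) / 2 + 1

/-- `d_{5,E} = (s_M - k + M + 1) / 2`, for a dashed arc `E` starting at `k`. -/
def d5 (E : Fin N × Fin N) : ℕ := (labelPos M b M - pos E.1 + M + 1) / 2

/-- The left ends of the objects enumerated from left to right, and from outside to inside: up
arrows, unpaired down arrow, arcs, dashed arcs, down arrows with an integer `p`, `2 ≤ p ≤ M`. -/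
def leftEnum : Finset (Fin N) :=
  upArrows b ∪ unpairedDown M b ∪ (arcs b).image Prod.fst ∪ (dashedArcs M b).image Prod.fst
    ∪ setU M b

/-- `N_A` (and `N_↓`): the integer assigned to the object with left end `i`. -/
def leftIndex (i : Fin N) : ℕ := ((leftEnum M b).filter fun j => j ≤ i).card

/-- The left ends of the objects enumerated from right to left, and from inside to outside: arcs,
dashed arcs, down arrows with an integer `p`, `2 ≤ p ≤ M`, or a star. -/
def rightEnum : Finset (Fin N) :=
  (arcs b).image Prod.fst ∪ (dashedArcs M b).image Prod.fst ∪ setV M b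

/-- `N_B`: the integer assigned to the object with left end `i`. -/
def rightIndex (i : Fin N) : ℕ := ((rightEnum M b).filter fun j => i ≤ j).card

section Factors

variable {K : Type*} [Field K] (q : K)

def f6 : K :=
  if (setV M b).card = M ∧ n1 M b = 0 then qint q (n5 M b) / qint q (n4 M b) else 1

def f7 : K :=
  ∏ C ∈ setU M b, ∏ A ∈ setSR M b ∩ outerArcs M b,
    qint q (d1 M b A C) / qint q (d1 M b A C + size A)

def f8 : K :=
  if (setV M b).card = M then
    ∏ A ∈ setSR M b ∩ outerArcs M b,
      ((∏ i ∈ Finset.range (n3 M b + 1), qint q (d2 M b A + i) / qint q (d2 M b A + size A + i)) *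
        ∏ A' ∈ setSW M b,
          qint q (d2 M b A + size A + arcH M b A') / qint q (d2 M b A + arcH M b A'))
  else 1

def f9 : K :=
  ∏ A ∈ (if n1 M b = 1 then setSW M b ∩ outerArcs M b
      else (setSW M b ∩ outerArcs M b) ∪ (setSL M b ∩ outerArcs M b)),
    qint q (d3 A + size A + M) / qint q (d3 A + 2 * size A + M)

def f10 : K :=
  if n1 M b = 1 then
    (∏ C ∈ setV' M b, (qint q (d4 M b C))⁻¹) * ∏ E ∈ dashedArcs M b, (qint q (d5 M b E))⁻¹
  else if dashedArcs M b = ∅ then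
    ∏ C ∈ setU' M b, (qint q (d4 M b C))⁻¹
  else
    (∏ C ∈ setV' M b, (qint q (d4 M b C))⁻¹) * ∏ E ∈ setT' M b, (qint q (d5 M b E))⁻¹

def f11 : K :=
  (∏ d ∈ unpairedDown M b, qint q (leftIndex M b d)) *
    ((∏ A ∈ arcs b, qint q (leftIndex M b A.1)) *
      (∏ E ∈ dashedArcs M b, qint q (leftIndex M b E.1)) *
      ∏ C ∈ setU M b, qint q (leftIndex M b C))

def f12 : K :=
  (∏ i ∈ Finset.Icc 1 (n2 M b), qang q (i + M - 1)) /
    ((∏ E ∈ dashedArcs M b, qang q (rightIndex M b E.1)) *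
      ∏ C ∈ setV M b \ setU M b, qang q (rightIndex M b C))

/-- The component `Ψ_D` for the diagram `D` of `b`. -/
def psi : K :=
  (∏ A ∈ arcs b, (qint q (size A))⁻¹) * f6 M b q * f7 M b q * f8 M b q * f9 M b q
    * f10 M b q * f11 M b q * f12 M b q

end Factors

end Diagram

/-- The vector `Ψ = ∑_D Ψ_D D`, expanded in the Kazhdan–Lusztig basis of type BI. -/
def Psi {K : Type*} [Field K] (q : K) (M N : ℕ) : (Fin N → Bool) → K :=
  ∑ b : Fin N → Bool, psi M b q • klVec M b q

end TypeBI

namespace TypeBI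

/-! ### Identities between quantum integers -/

section QuantumIntegers

variable {K : Type*} [Field K] {q : K}

/-! The vector `Ψ` is a pure tensor in disguise: with `N` factors it equals `(q^{M+N-1} v₁ + v₋₁) ⊗
⋯ ⊗ (q^{M+1} v₁ + v₋₁) ⊗ (q^M v₁ + v₋₁)`, which is the content of `Psi_cons`. Granted this, the
spectral statements are elementary. Splitting off the left factor, `X` on `n + 1` factors is the
block matrix with rows `(q X, 1)` and `(1, q⁻¹ X)`, where the inner `X` acts on `n` factors
(`opX_mulVec`). The rules `[m+1] = q [m] + q^{-m} = q⁻¹ [m] + q^m` make the pure tensor an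
eigenvector. Conversely, the `v₁`-component of an eigenvector for `[a+1]` is killed by `(X - [a]) (X
- [a+2])` (`quadratic_of_eigen`). By induction no `[a]` with `a > n + M` is an eigenvalue
(`eq_zero_of_eigen`), so only the factor `X - [n+M]` matters and the eigenspace is a line
(`exists_smul_Psi`). Finally `X` is symmetric and the dot product of `Ψ` with itself is a product of
factors `q^{2(M+i)} + 1 ≠ 0`, which excludes a Jordan block (`maxGenEigenspace_eq_eigenspace`).

To see the pure tensor, the diagram vectors are compared for words that differ by a letter on the
left: `v₁ ⊗ D_b = D_{+b}`, and `v₋₁ ⊗ D_c = D_{-c} + ∑_b θ(c, b) v₁ ⊗ D_b` with explicit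
coefficients `θ` (`klVec_false`). This gives the basis property by induction. It also reduces the
product formula to two recursions for the components, `Ψ_{-b} = Ψ_b` (`lG_false`) and `Ψ_{+b} =
q^{M+|b|} Ψ_b + ∑_c θ(c, b) Ψ_c` (`lG_true`).

The recursions are proved for a simpler expression `lG`, in which products of hook lengths form the
denominator; `psi_eq` identifies it with the given formula. There the factors over outer arcs
telescope, `N₆ N₇ N₈ N₁₀` collapses to one numerator over a product of right indices, and `[R] (q^R
+ q^{-R}) = [2R]` absorbs the denominator of `N₁₂`. The sum over `θ` is evaluated for words with a
prefix `w` that has no unmatched down arrow, because an arc met on the way is pushed into `w`. The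
generic case is `thetaSum_lG`, the exceptional one `thetaSum_lG_even`; both end in identities
between a few quantum integers. -/

theorem sub_inv_ne_zero (hq0 : q ≠ 0) (hq : ∀ n : ℕ, 0 < n → q ^ n ≠ 1) : q - q⁻¹ ≠ 0 := by
  intro h
  apply hq 2 (by norm_num)
  have h1 : q = q⁻¹ := sub_eq_zero.1 h
  rw [pow_two]
  nth_rw 2 [h1]
  exact mul_inv_cancel₀ hq0

theorem sub_inv_mul_qint (hq0 : q ≠ 0) (n : ℕ) :
    (q - q⁻¹) * qint q n = q ^ n - (q ^ n)⁻¹ := by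
  induction n with
  | zero => simp [qint]
  | succ n ih =>
    have h : qint q (n + 1) = q * qint q n + (q ^ n)⁻¹ := by
      unfold qint
      rw [Finset.sum_range_succ, Finset.mul_sum]
      congr 1
      · refine Finset.sum_congr rfl fun i _ => ?_
        rw [← zpow_one_add₀ hq0]
        congr 1
        push_cast
        ring
      · rw [← zpow_natCast, ← zpow_neg]
        congr 1
        push_cast
        ring
    rw [h, mul_add, mul_left_comm, ih]
    field_simp
    ring

theorem qint_eq (hq0 : q ≠ 0) (hq : ∀ n : ℕ, 0 < n → q ^ n ≠ 1) (n : ℕ) :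
    qint q n = (q ^ n - (q ^ n)⁻¹) / (q - q⁻¹) := by
  rw [← sub_inv_mul_qint hq0, mul_div_cancel_left₀ _ (sub_inv_ne_zero hq0 hq)]

theorem qint_ne_zero (hq0 : q ≠ 0) (hq : ∀ n : ℕ, 0 < n → q ^ n ≠ 1) {n : ℕ} (hn : 0 < n) :
    qint q n ≠ 0 := by
  rw [qint_eq hq0 hq]
  refine div_ne_zero (fun h => hq (2 * n) (by omega) ?_) (sub_inv_ne_zero hq0 hq)
  have h1 : q ^ n = (q ^ n)⁻¹ := sub_eq_zero.1 h
  rw [two_mul, pow_add]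
  nth_rw 2 [h1]
  exact mul_inv_cancel₀ (pow_ne_zero _ hq0)

/-- If the sum vanishes then `q^{2n} = -1`, hence `q^{4n} = 1`. The argument does not depend on the
characteristic. -/
theorem qang_ne_zero (hq0 : q ≠ 0) (hq : ∀ n : ℕ, 0 < n → q ^ n ≠ 1) {n : ℕ} (hn : 0 < n) :
    qang q n ≠ 0 := by
  intro h
  apply hq (4 * n) (by omega)
  have h0 := pow_ne_zero n hq0
  have h1 : q ^ n * q ^ n = -1 := by
    unfold qang at h
    field_simp at h
    linear_combination h
  calc q ^ (4 * n) = (q ^ n * q ^ n) ^ 2 := by ring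
    _ = 1 := by rw [h1]; ring

theorem qint_one (q : K) : qint q 1 = 1 := by simp [qint]

/-- Merges a right index `[R]` with the factor `q^R + q^{-R}` of `N₁₂` into the hook length `[2R]`
of a star or a dashed arc. -/
theorem qint_mul_qang (hq0 : q ≠ 0) (hq : ∀ n : ℕ, 0 < n → q ^ n ≠ 1) (n : ℕ) :
    qint q n * qang q n = qint q (2 * n) := by
  have h0 := pow_ne_zero n hq0
  rw [qint_eq hq0 hq, qint_eq hq0 hq, qang, two_mul, pow_add]
  field_simp
  ring

theorem qint_add (hq0 : q ≠ 0) (hq : ∀ n : ℕ, 0 < n → q ^ n ≠ 1) (m n : ℕ) :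
    qint q (m + n) = q ^ n * qint q m + (q ^ m)⁻¹ * qint q n := by
  have h0 := pow_ne_zero n hq0
  have h1 := pow_ne_zero m hq0
  have h2 := sub_inv_ne_zero hq0 hq
  rw [qint_eq hq0 hq, qint_eq hq0 hq, qint_eq hq0 hq, pow_add]
  field_simp
  ring

/-- The quantum factorial `[n]!`. -/
def qfact (q : K) (n : ℕ) : K := ∏ i ∈ Finset.range n, qint q (i + 1)

/-- The product of `q^{i+M} + q^{-(i+M)}` over `0 ≤ i < n`. -/
def qangProd (M : ℕ) (q : K) (n : ℕ) : K := ∏ i ∈ Finset.range n, qang q (i + M)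

theorem qfact_succ (q : K) (n : ℕ) : qfact q (n + 1) = qfact q n * qint q (n + 1) :=
  Finset.prod_range_succ _ _

theorem qangProd_succ (M : ℕ) (q : K) (n : ℕ) :
    qangProd M q (n + 1) = qangProd M q n * qang q (n + M) :=
  Finset.prod_range_succ _ _

end QuantumIntegers

/-! ### Statistics of binary words -/

/-- The left indices of the up arrows of a word that are in no arc, from left to right: the index
of such an arrow is the number of these arrows and of arcs that start weakly to its left. -/
def lups : List Bool → List ℕ
  | [] => []
  | true :: b => 1 :: (lups b).map (· + 1)
  | false :: b => (lups b).tail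

/-- The number of down arrows of a word that are in no arc. -/
def ldn : List Bool → ℕ
  | [] => 0
  | true :: b => ldn b
  | false :: b => if lups b = [] then ldn b + 1 else ldn b

/-- The number of arcs of a word. -/
def lna : List Bool → ℕ
  | [] => 0
  | true :: b => lna b
  | false :: b => if lups b = [] then lna b else lna b + 1

/-- All the `M` labels are used and the other unmatched down arrows are all in dashed arcs. -/
def EvenFull (M k : ℕ) : Prop := M ≤ k ∧ (k - M) % 2 = 0

instance (M k : ℕ) : Decidable (EvenFull M k) := by unfold EvenFull; infer_instance

section Words

variable {K : Type*} [Field K] (M : ℕ) (q : K)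

/-- The product of the hook lengths of the arcs, dashed arcs and labelled down arrows. -/
def lacc : List Bool → K
  | [] => 1
  | true :: b => lacc b
  | false :: b =>
    match lups b with
    | m :: _ => qint q m * lacc b
    | [] =>
      if ldn b + 1 < M then qint q (ldn b + 1 + lna b) * lacc b
      else if EvenFull M (ldn b + 1) then qint q (ldn b + 1 + M + 2 * lna b) * lacc b
      else lacc b

/-- The factor of the outer arcs without an unmatched up arrow to their right and with an even
number of unmatched down arrows without label to their right. -/
def lf9 : List Bool → K
  | [] => 1
  | true :: b => lf9 b
  | false :: b =>
    match lups b with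
    | [m] =>
      if EvenFull M (ldn b) then
        lf9 b * (qint q (b.length + 1 + M - m) / qint q (b.length + 1 + M))
      else lf9 b
    | _ => lf9 b

/-- The number of up arrows, unpaired down arrows, arcs and dashed arcs, for a word with `σ` arcs
and unmatched up arrows and `k` unmatched down arrows. -/
def pairCount (σ k : ℕ) : ℕ := σ + (k - M + 1) / 2

/-- The number of objects that have a left index. -/
def enumCount (σ k : ℕ) : ℕ := pairCount M σ k + min k (M - 1)

/-- The part of the component of `w ++ c` that depends on the word `w` without unmatched down arrows
only through the number `p` of its arcs and unmatched up arrows. -/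
def hval (p : ℕ) (c : List Bool) : K :=
  qfact q (enumCount M (p + (lups c).length + lna c) (ldn c)) *
    qangProd M q (pairCount M (p + (lups c).length + lna c) (ldn c)) *
    (if EvenFull M (ldn c) then
      qint q (2 * (p + (lups c).length + lna c) + ldn c + M - ((lups c).getLastD 0 + p))
      else 1) * lf9 M q c /
    (((lups c).map fun u => qint q (u + p)).prod * lacc M q c)

/-- The component of the eigenvector for the diagram of a word. -/
def lG (b : List Bool) : K := hval M q 0 b

/-- The coefficients in `v₋₁ ⊗ D_c = D_{-c} + ∑_b θ₀(c, b) v₁ ⊗ D_b`.  The first argument is the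
number of down arrows to the left that are not yet joined to an up arrow. -/
def theta : ℕ → List Bool → List Bool → K
  | h, [], [] => if h < M then (q ^ (M - h))⁻¹ else 0
  | h, false :: c, false :: b => theta (h + 1) c b
  | h + 1, true :: c, true :: b => theta h c b
  | 0, true :: c, true :: b => q⁻¹ * theta 0 c b
  | 0, true :: c, false :: b => if c = b then q⁻¹ else 0
  | 0, false :: c, true :: b => if c = b ∧ lups c = [] ∧ EvenFull M (ldn c) then q⁻¹ else 0
  | _, _, _ => 0

/-- `∑_c θ_h(c, b) F(c)`. -/
def thetaSum : ℕ → List Bool → (List Bool → K) → K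
  | h, [], F => (if h < M then (q ^ (M - h))⁻¹ else 0) * F []
  | h + 1, false :: b, F => thetaSum (h + 2) b fun c => F (false :: c)
  | 0, false :: b, F => thetaSum 1 b (fun c => F (false :: c)) + q⁻¹ * F (true :: b)
  | h + 1, true :: b, F => thetaSum h b fun c => F (true :: c)
  | 0, true :: b, F => q⁻¹ * thetaSum 0 b (fun c => F (true :: c)) +
      if lups b = [] ∧ EvenFull M (ldn b) then q⁻¹ * F (false :: b) else 0

end Words

theorem length_eq (b : List Bool) : b.length = (lups b).length + ldn b + 2 * lna b := by
  induction b with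
  | nil => rfl
  | cons x b ih =>
    cases x
    · by_cases h : lups b = []
      · simp [lups, ldn, lna, h] at ih ⊢
        omega
      · have := List.length_pos_iff.2 h
        simp [lups, ldn, lna, h] at ih ⊢
        omega
    · simp [lups, ldn, lna] at ih ⊢
      omega

theorem pos_of_mem_lups {b : List Bool} {u : ℕ} (hu : u ∈ lups b) : 0 < u := by
  induction b generalizing u with
  | nil => simp [lups] at hu
  | cons x b ih =>
    cases x
    · exact ih (List.mem_of_mem_tail hu)
    · simp only [lups, List.mem_cons, List.mem_map] at hu
      obtain rfl | ⟨v, -, rfl⟩ := hu <;> omega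

/-- The number of unmatched up arrows and arcs. -/
def lup (b : List Bool) : ℕ := (lups b).length + lna b

theorem ldn_cons_eq_zero {x : Bool} {w : List Bool} (h : ldn (x :: w) = 0) :
    ldn w = 0 ∧ (x = false → lups w ≠ []) := by
  cases x
  · by_cases hu : lups w = []
    · simp [ldn, hu] at h
    · simp [ldn, hu] at h ⊢
      exact h
  · exact ⟨h, by simp⟩

/-- Without unmatched down arrows in `w`, no arc joins `w` to `c`. All `lup w` indexed objects of
`w` then lie to the left of `c` and shift its indices. -/
theorem lups_append {w : List Bool} (hw : ldn w = 0) (c : List Bool) :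
    lups (w ++ c) = lups w ++ (lups c).map (· + lup w) := by
  induction w with
  | nil => simp [lups, lup, lna]
  | cons x w ih =>
    obtain ⟨h, hx⟩ := ldn_cons_eq_zero hw
    cases x
    · have hu := hx rfl
      have : lup (false :: w) = lup w := by
        have := List.length_pos_iff.2 hu
        simp [lup, lups, lna, hu]
        omega
      rw [this, List.cons_append, lups, ih h, List.tail_append_of_ne_nil hu, lups]
    · have : lup (true :: w) = lup w + 1 := by
        simp [lup, lups, lna]
        omega
      rw [this, List.cons_append, lups, ih h, lups]
      simp [Function.comp_def, add_assoc]

theorem ldn_append {w : List Bool} (hw : ldn w = 0) (c : List Bool) :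
    ldn (w ++ c) = ldn c := by
  induction w with
  | nil => rfl
  | cons x w ih =>
    obtain ⟨h, hx⟩ := ldn_cons_eq_zero hw
    cases x
    · simp [ldn, lups_append h, hx rfl, ih h]
    · simp [ldn, ih h]

theorem lna_append {w : List Bool} (hw : ldn w = 0) (c : List Bool) :
    lna (w ++ c) = lna w + lna c := by
  induction w with
  | nil => simp [lna]
  | cons x w ih =>
    obtain ⟨h, hx⟩ := ldn_cons_eq_zero hw
    cases x
    · simp [lna, lups_append h, hx rfl, ih h]
      omega
    · simp [lna, ih h]

theorem lup_append {w : List Bool} (hw : ldn w = 0) (c : List Bool) :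
    lup (w ++ c) = lup w + lup c := by
  simp [lup, lups_append hw, lna_append hw]
  omega

theorem lacc_append {K : Type*} [Field K] (M : ℕ) (q : K) {w : List Bool} (hw : ldn w = 0)
    (c : List Bool) : lacc M q (w ++ c) = lacc M q w * lacc M q c := by
  induction w with
  | nil => simp [lacc]
  | cons x w ih =>
    obtain ⟨h, hx⟩ := ldn_cons_eq_zero hw
    cases x
    · obtain ⟨m, l, hl⟩ := List.exists_cons_of_ne_nil (hx rfl)
      simp [lacc, lups_append h, hl, ih h, mul_assoc]
    · simp [lacc, ih h]

/-- An arc of `w` contributes only if no unmatched up arrow follows it and the count of unmatched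
down arrows after it is even-full. Either alternative of `hc` rules this out. -/
theorem lf9_append {K : Type*} [Field K] (M : ℕ) (q : K) {w : List Bool} (hw : ldn w = 0)
    (c : List Bool) (hc : lups c ≠ [] ∨ ¬ EvenFull M (ldn c)) :
    lf9 M q (w ++ c) = lf9 M q c := by
  induction w with
  | nil => rfl
  | cons x w ih =>
    obtain ⟨h, hx⟩ := ldn_cons_eq_zero hw
    cases x
    · obtain ⟨m, l, hl⟩ := List.exists_cons_of_ne_nil (hx rfl)
      rcases hc with hc | hc
      · obtain ⟨m', l', hl'⟩ := List.exists_cons_of_ne_nil hc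
        cases l <;> simp [lf9, lups_append h, hl, hl'] <;> exact ih h
      · rw [← ih h, List.cons_append, lf9]
        split
        · simp [ldn_append h, hc]
        · rfl
    · exact ih h

/-- A word with an unmatched up arrow starts with a balanced word followed by an up arrow. -/
theorem exists_balanced_prefix (b : List Bool) (hb : lups b ≠ []) :
    ∃ x y, b = x ++ true :: y ∧ ldn x = 0 ∧ lups x = [] := by
  induction hn : b.length using Nat.strong_induction_on generalizing b with
  | _ n ih =>
    match b with
    | [] => exact absurd rfl hb
    | true :: b => exact ⟨[], b, rfl, rfl, rfl⟩
    | false :: b =>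
      have hb' : (lups b).tail ≠ [] := hb
      obtain ⟨x, y, rfl, hx, hx'⟩ := ih b.length (by simp [← hn]) b
        (by rintro h; simp [h] at hb') rfl
      have hy : lups y ≠ [] := by
        rintro h
        simp [lups_append hx, hx', lups, h] at hb'
      -- The leading down arrow uses up the up arrow after `x`, so the up arrow wanted is the first
      -- unmatched one of `y`; the balanced prefix becomes `- x + x'`.
      obtain ⟨x', y', rfl, h, h'⟩ := ih y.length (by simp [← hn]; omega) y hy rfl
      refine ⟨false :: (x ++ true :: x'), y', by simp, ?_, ?_⟩
      · have : ldn (x ++ true :: x') = 0 := by rw [ldn_append hx]; exact h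
        simp [ldn, lups_append hx, lups, this]
      · simp [lups, lups_append hx, hx', h']

/-! ### Transfer sums, and words with a prefix without unmatched down arrows. -/

section Transfer

variable {K : Type*} [Field K] (M : ℕ) (q : K)

/-- The counter is large enough to absorb every unmatched up arrow of `x` and still stay positive,
and with a positive counter the letters are merely copied. -/
theorem thetaSum_append (x b : List Bool) (hx : ldn x = 0) (h : ℕ) (F : List Bool → K) :
    thetaSum M q (h + 1 + (lups x).length) (x ++ b) F =
      thetaSum M q (h + 1) b fun c => F (x ++ c) := by
  induction x generalizing h F with
  | nil => rfl
  | cons y x ih =>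
    obtain ⟨h', hy⟩ := ldn_cons_eq_zero hx
    cases y
    · have : h + 1 + (lups (false :: x)).length + 1 = h + 1 + (lups x).length := by
        have := List.length_pos_iff.2 (hy rfl)
        simp [lups]
        omega
      rw [List.cons_append, show h + 1 + (lups (false :: x)).length =
        h + (lups (false :: x)).length + 1 by omega, thetaSum]
      rw [show h + (lups (false :: x)).length + 2 = h + 1 + (lups x).length by omega, ih h']
      rfl
    · rw [show h + 1 + (lups (true :: x)).length = h + 1 + (lups x).length + 1 by
        simp [lups]; omega, List.cons_append, thetaSum, ih h']
      rfl

/-- The pending down arrows are never exhausted, so the scan runs to the end of the word. What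
remains is the label of a new leftmost down arrow that has `h + 1 + ldn b` unmatched down arrows to
its right. -/
theorem thetaSum_of_le (b : List Bool) (h : ℕ) (F : List Bool → K) :
    thetaSum M q (h + 1 + (lups b).length) b F =
      (if h + 1 + ldn b < M then (q ^ (M - (h + 1 + ldn b)))⁻¹ else 0) * F b := by
  induction b generalizing h F with
  | nil => rfl
  | cons y b ih =>
    cases y
    · by_cases hu : lups b = []
      · have := ih (h + 1) fun c => F (false :: c)
        simp only [lups, ldn, hu, List.tail_nil, List.length_nil, if_true, add_zero] at this ⊢
        rw [thetaSum, this]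
        simp only [add_assoc, add_comm 1 (ldn b)]
      · have : h + 1 + (lups (false :: b)).length + 1 = h + 1 + (lups b).length := by
          have := List.length_pos_iff.2 hu
          simp [lups]
          omega
        rw [show h + 1 + (lups (false :: b)).length =
          h + (lups (false :: b)).length + 1 by omega, thetaSum]
        rw [show h + (lups (false :: b)).length + 2 = h + 1 + (lups b).length by omega, ih]
        simp [ldn, hu]
    · rw [show h + 1 + (lups (true :: b)).length = h + 1 + (lups b).length + 1 by
        simp [lups]; omega, thetaSum, ih]
      rfl

/-- The counter returns to zero exactly at the right end of the leading arc. One term leaves this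
arc alone and continues in `y`; the other comes from the word in which the left end of the arc is an
up arrow. -/
theorem thetaSum_balanced (x y : List Bool) (hx : ldn x = 0) (hx' : lups x = [])
    (F : List Bool → K) :
    thetaSum M q 0 (false :: (x ++ true :: y)) F =
      thetaSum M q 0 y (fun c => F (false :: (x ++ true :: c))) +
        q⁻¹ * F (true :: (x ++ true :: y)) := by
  have := thetaSum_append M q x (true :: y) hx 0 fun c => F (false :: c)
  rw [hx'] at this
  simp only [List.length_nil, add_zero, zero_add] at this
  rw [thetaSum, this, thetaSum]

theorem thetaSum_down (y : List Bool) (hy : lups y = []) (F : List Bool → K) :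
    thetaSum M q 0 (false :: y) F =
      (if ldn y + 1 < M then (q ^ (M - (ldn y + 1)))⁻¹ else 0) * F (false :: y) +
        q⁻¹ * F (true :: y) := by
  have := thetaSum_of_le M q y 0 fun c => F (false :: c)
  rw [hy] at this
  simp only [List.length_nil, add_zero, zero_add] at this
  rw [thetaSum, this, add_comm 1]

/-- The prefix enters through the number `lup w`, which shifts all indices, and through its own hook
lengths. The one obstruction is a word `c` without unmatched up arrows that is even-full: then arcs
at the end of `w` and the last up arrow of `w` enter the remaining numerators. A prefix that ends in
an up arrow is still harmless, as no arc of `w` follows that arrow and its left index is `lup w`,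
matching the default `0` of `getLastD` shifted by `p`. -/
theorem lG_append {w : List Bool} (hw : ldn w = 0) (c : List Bool)
    (hc : lups c ≠ [] ∨ ¬ EvenFull M (ldn c) ∨ ∃ w', ldn w' = 0 ∧ w = w' ++ [true]) :
    lG M q (w ++ c) =
      hval M q (lup w) c / (((lups w).map (qint q)).prod * lacc M q w) := by
  have h9 : lf9 M q (w ++ c) = lf9 M q c := by
    rcases hc with hc | hc | ⟨w', hw', rfl⟩
    · exact lf9_append M q hw c (.inl hc)
    · exact lf9_append M q hw c (.inr hc)
    · rw [List.append_assoc, lf9_append M q hw' _ (.inl (by simp [lups]))]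
      rfl
  have hσ : 0 + (lups (w ++ c)).length + lna (w ++ c) = lup w + (lups c).length + lna c := by
    simp [lups_append hw, lna_append hw, lup]
    omega
  have hE : (if EvenFull M (ldn c) then qint q (2 * (lup w + (lups c).length + lna c) + ldn c + M -
        ((lups (w ++ c)).getLastD 0 + 0)) else 1) =
      (if EvenFull M (ldn c) then
      qint q (2 * (lup w + (lups c).length + lna c) + ldn c + M - ((lups c).getLastD 0 + lup w))
      else 1) := by
    split_ifs with he
    · have hl : (lups (w ++ c)).getLastD 0 = (lups c).getLastD 0 + lup w := by
        rw [lups_append hw]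
        rcases List.eq_nil_or_concat (lups c) with h | ⟨l, m, h⟩
        · rcases hc with hc | hc | ⟨w', hw', rfl⟩
          · exact absurd h hc
          · exact absurd he hc
          · rw [h, lup_append hw', lups_append hw']
            simp [lups, lup, lna]
            omega
        · rw [h]
          simp
      rw [hl, add_zero]
    · rfl
  unfold lG hval
  rw [hσ, h9, ldn_append hw, hE, lacc_append M q hw, lups_append hw]
  simp only [List.map_append, List.prod_append, List.map_map, Function.comp_def, add_zero]
  rw [div_div]
  congr 1
  ring

end Transfer

end TypeBI

namespace TypeBI

/-! ### Moving arcs and up arrows, and the evaluation of the transfer sums. -/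

section Transfer

variable {K : Type*} [Field K] (M : ℕ) (q : K)

/-- The part of the component of `w ++ c` that depends on `w` only. -/
def prefixFactor (w : List Bool) : K := (((lups w).map (qint q)).prod * lacc M q w)⁻¹

theorem lG_append' {w : List Bool} (hw : ldn w = 0) (c : List Bool)
    (hc : ¬ (lups c = [] ∧ EvenFull M (ldn c))) :
    lG M q (w ++ c) = hval M q (lup w) c * prefixFactor M q w := by
  rw [lG_append M q hw c (by tauto), div_eq_mul_inv]
  rfl

/-- The up arrow after `w` is unmatched, so it can be taken as the end of the prefix, and then no
condition on `c` is needed. -/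
theorem lG_append_true {w : List Bool} (hw : ldn w = 0) (c : List Bool) :
    lG M q (w ++ true :: c) =
      hval M q (lup w + 1) c / qint q (lup w + 1) * prefixFactor M q w := by
  have h := lG_append M q (w := w ++ [true]) (by rw [ldn_append hw]; rfl) c
    (.inr (.inr ⟨w, hw, rfl⟩))
  rw [List.append_assoc] at h
  rw [show w ++ true :: c = w ++ ([true] ++ c) from rfl, h, lup_append hw, lups_append hw,
    lacc_append M q hw]
  simp only [prefixFactor, lups, lup, lna, lacc, List.map_append, List.map_cons, List.map_nil,
    List.prod_append, List.prod_cons, List.prod_nil, mul_one, List.length_singleton,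
    add_comm 1, div_eq_mul_inv, mul_inv]
  ring

/-- An unmatched up arrow in front of `c` may equally be counted in the prefix, at the cost of its
own left index `p + 1`. -/
theorem hval_true (p : ℕ) (c : List Bool) :
    hval M q p (true :: c) = hval M q (p + 1) c / qint q (p + 1) := by
  have h1 : (lups (true :: c)).length = (lups c).length + 1 := by simp [lups]
  have h2 : p + (lups (true :: c)).length + lna (true :: c) =
    p + 1 + (lups c).length + lna c := by rw [h1]; simp [lna]; omega
  have h3 : (lups (true :: c)).getLastD 0 + p = (lups c).getLastD 0 + (p + 1) := by
    rcases List.eq_nil_or_concat (lups c) with h | ⟨l, m, h⟩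
    · simp [lups, h]; omega
    · rw [lups, h, List.concat_eq_append, List.map_append, ← List.cons_append,
        List.map_singleton, List.getLastD_concat, List.getLastD_concat]
      omega
  unfold hval
  rw [h2, h3]
  simp only [ldn, lf9, lacc, lups, List.map_cons, List.prod_cons, List.map_map,
    Function.comp_def, add_assoc, add_comm 1 p, div_eq_mul_inv, mul_inv]
  ring

theorem prefixFactor_true {w : List Bool} (hw : ldn w = 0) :
    prefixFactor M q (w ++ [true]) = prefixFactor M q w / qint q (lup w + 1) := by
  unfold prefixFactor
  rw [lups_append hw, lacc_append M q hw]
  simp only [lups, lacc, List.map_append, List.map_cons, List.map_nil,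
    List.prod_append, List.prod_cons, List.prod_nil, mul_one,
    add_comm 1, div_eq_mul_inv, mul_inv]
  ring

theorem prefixFactor_append {w x : List Bool} (hw : ldn w = 0) (hx' : lups x = []) :
    prefixFactor M q (w ++ x) = prefixFactor M q w * (lacc M q x)⁻¹ := by
  unfold prefixFactor
  rw [lups_append hw, lacc_append M q hw]
  simp [hx']
  ring

theorem prefixFactor_append_arc {w x : List Bool} (hw : ldn w = 0) (hx : ldn x = 0)
    (hx' : lups x = []) :
    prefixFactor M q (w ++ false :: (x ++ [true])) =
      prefixFactor M q w * (qint q (lup x + 1) * lacc M q x)⁻¹ := by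
  have h : lups (x ++ [true]) = [lup x + 1] := by
    rw [lups_append hx, hx']
    simp [lups, add_comm]
  rw [prefixFactor_append M q hw (by simp [lups, h])]
  simp [lacc, h, lacc_append M q hx]

theorem ldn_arc {x : List Bool} (hx : ldn x = 0) (y : List Bool) :
    ldn (false :: (x ++ true :: y)) = ldn y := by
  simp [ldn, lups_append hx, lups, ldn_append hx]

theorem lups_arc {x : List Bool} (hx : ldn x = 0) (hx' : lups x = []) (y : List Bool) :
    lups (false :: (x ++ true :: y)) = (lups y).map (· + (lup x + 1)) := by
  simp [lups, lups_append hx, hx', Function.comp_def, add_assoc, add_comm]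

theorem lna_arc {x : List Bool} (hx : ldn x = 0) (hx' : lups x = []) (y : List Bool) :
    lna (false :: (x ++ true :: y)) = lna y + (lup x + 1) := by
  simp [lna, lups_append hx, lups, lna_append hx, lup, hx']
  omega

theorem lup_arc {x : List Bool} (hx : ldn x = 0) (hx' : lups x = []) :
    lup (false :: (x ++ [true])) = lup x + 1 := by
  rw [lup, lups_arc hx hx', lna_arc hx hx']
  simp [lups, lna]

/-- Three words that differ in the positions of an arc and of an up arrow. -/
theorem lG_up_balanced_up {w x : List Bool} (hw : ldn w = 0) (hx : ldn x = 0)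
    (hx' : lups x = []) (y : List Bool) :
    lG M q (w ++ true :: (x ++ true :: y)) = hval M q (lup w + lup x + 2) y *
      (prefixFactor M q w * (lacc M q x)⁻¹) /
        (qint q (lup w + 1) * qint q (lup w + lup x + 2)) := by
  have h1 : ldn (w ++ [true]) = 0 := by rw [ldn_append hw]; rfl
  have h : ldn (w ++ [true] ++ x) = 0 := by rw [ldn_append h1]; exact hx
  have := lG_append_true M q h y
  rw [prefixFactor_append M q h1 hx', prefixFactor_true M q hw, lup_append h1, lup_append hw,
    show lup [true] = 1 from rfl] at this
  rw [show w ++ true :: (x ++ true :: y) = w ++ [true] ++ x ++ true :: y by simp, this,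
    show lup w + 1 + lup x + 1 = lup w + lup x + 2 by omega]
  ring

theorem lG_arc_up {w x : List Bool} (hw : ldn w = 0) (hx : ldn x = 0)
    (hx' : lups x = []) (y : List Bool) :
    lG M q (w ++ false :: (x ++ true :: true :: y)) = hval M q (lup w + lup x + 2) y *
      (prefixFactor M q w * (lacc M q x)⁻¹) /
        (qint q (lup x + 1) * qint q (lup w + lup x + 2)) := by
  have h : ldn (w ++ false :: (x ++ [true])) = 0 := by
    rw [ldn_append hw, ldn_arc hx]; rfl
  have := lG_append_true M q h y
  rw [prefixFactor_append_arc M q hw hx hx', lup_append hw, lup_arc hx hx'] at this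
  rw [show w ++ false :: (x ++ true :: true :: y) =
    w ++ false :: (x ++ [true]) ++ true :: y by simp, this,
    show lup w + (lup x + 1) + 1 = lup w + lup x + 2 by omega, mul_inv]
  ring

theorem lG_up_arc {w x : List Bool} (hw : ldn w = 0) (hx : ldn x = 0)
    (hx' : lups x = []) (y : List Bool) (hy : ¬ (lups y = [] ∧ EvenFull M (ldn y))) :
    lG M q (w ++ true :: false :: (x ++ true :: y)) = hval M q (lup w + lup x + 2) y *
      (prefixFactor M q w * (lacc M q x)⁻¹) /
        (qint q (lup w + 1) * qint q (lup x + 1)) := by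
  have h1 : ldn (w ++ [true]) = 0 := by rw [ldn_append hw]; rfl
  have h : ldn (w ++ [true] ++ false :: (x ++ [true])) = 0 := by
    rw [ldn_append h1, ldn_arc hx]; rfl
  have := lG_append' M q h y hy
  rw [prefixFactor_append_arc M q h1 hx hx', prefixFactor_true M q hw, lup_append h1,
    lup_append hw, lup_arc hx hx', show lup [true] = 1 from rfl] at this
  rw [show w ++ true :: false :: (x ++ true :: y) =
    w ++ [true] ++ false :: (x ++ [true]) ++ y by simp, this,
    show lup w + 1 + (lup x + 1) = lup w + lup x + 2 by omega, mul_inv]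
  ring

variable {q}

/-- The three components share all factors but two in the denominator. With `m = lup w + 1` and `n =
lup x + 1` the claim is `1/([m][n]) = q^n/([n][m+n]) + q^{-m}/([m][m+n])`, that is, the addition
rule for `[m+n]`. -/
theorem lG_arc_relation {w x : List Bool} (hq0 : q ≠ 0) (hq : ∀ n : ℕ, 0 < n → q ^ n ≠ 1)
    (hw : ldn w = 0) (hx : ldn x = 0)
    (hx' : lups x = []) (y : List Bool) (hy : ¬ (lups y = [] ∧ EvenFull M (ldn y))) :
    lG M q (w ++ true :: false :: (x ++ true :: y)) =
      q ^ (lup x + 1) * lG M q (w ++ false :: (x ++ true :: true :: y)) +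
        (q ^ (lup w + 1))⁻¹ * lG M q (w ++ true :: (x ++ true :: y)) := by
  rw [lG_up_arc M q hw hx hx' y hy, lG_arc_up M q hw hx hx', lG_up_balanced_up M q hw hx hx']
  have h := qint_add hq0 hq (lup w + 1) (lup x + 1)
  rw [show lup w + 1 + (lup x + 1) = lup w + lup x + 2 by omega] at h
  have h1 := qint_ne_zero hq0 hq (Nat.succ_pos (lup w))
  have h2 := qint_ne_zero hq0 hq (Nat.succ_pos (lup x))
  have h3 := qint_ne_zero hq0 hq (Nat.succ_pos (lup w + lup x + 1))
  simp only [Nat.succ_eq_add_one, add_assoc, Nat.reduceAdd] at h1 h2 h3 h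
  have h4 := pow_ne_zero (lup w + 1) hq0
  simp only [add_assoc]
  field_simp
  rw [← add_assoc] at *
  rw [h]
  field_simp

theorem hval_nil_ups (p : ℕ) (c : List Bool) (hc : lups c = []) :
    hval M q p c = qfact q (enumCount M (p + lna c) (ldn c)) *
      qangProd M q (pairCount M (p + lna c) (ldn c)) *
      (if EvenFull M (ldn c) then qint q (p + 2 * lna c + ldn c + M) else 1) * lf9 M q c /
        lacc M q c := by
  unfold hval
  rw [hc]
  simp only [List.length_nil, add_zero, List.getLastD_nil, zero_add, List.map_nil, List.prod_nil,
    one_mul]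
  rw [show 2 * (p + lna c) + ldn c + M - p = p + 2 * lna c + ldn c + M by omega]

/-- Here the arc around `x` cannot simply be counted in the prefix: it is followed by no unmatched
up arrow and has even level. It therefore carries its own factor from `N₉` and enters the numerator
of `N₆` twice rather than once. The fraction on the right is this correction. -/
theorem hval_arc_even (hq0 : q ≠ 0) (hq : ∀ n : ℕ, 0 < n → q ^ n ≠ 1) (hM : 1 ≤ M) (p : ℕ)
    {x y : List Bool} (hx : ldn x = 0)
    (hx' : lups x = []) (hy : lups y = []) (he : EvenFull M (ldn y)) :
    hval M q p (false :: (x ++ true :: y)) = hval M q (p + (lup x + 1)) y *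
      (qint q (p + y.length + 2 * (lup x + 1) + M) * qint q (y.length + (lup x + 1) + M)) /
      (qint q (p + y.length + (lup x + 1) + M) * qint q (y.length + 2 * (lup x + 1) + M) *
        (qint q (lup x + 1) * lacc M q x)) := by
  have hl := length_eq y
  have hlx := length_eq x
  have h9 : lf9 M q (false :: (x ++ true :: y)) = lf9 M q y *
      (qint q (y.length + (lup x + 1) + M) / qint q (y.length + 2 * (lup x + 1) + M)) := by
    have h1 : lups (x ++ true :: y) = [lup x + 1] := by
      simp [lups_append hx, hx', lups, hy, add_comm]
    have h2 : lf9 M q (x ++ true :: y) = lf9 M q y := by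
      rw [lf9_append M q hx _ (.inl (by simp [lups]))]
      rfl
    have h3 : (x ++ true :: y).length = y.length + 2 * lup x + 1 := by
      simp [hlx, hx, hx', lup]
      omega
    simp only [lf9, h1, ldn_append hx, ldn, he, if_true, h2, h3]
    congr 3
    all_goals omega
  have hacc : lacc M q (false :: (x ++ true :: y)) =
      qint q (lup x + 1) * (lacc M q x * lacc M q y) := by
    have h1 : lups (x ++ true :: y) = [lup x + 1] := by
      simp [lups_append hx, hx', lups, hy, add_comm]
    simp [lacc, h1, lacc_append M q hx]
  rw [hval_nil_ups M _ _ (by rw [lups_arc hx hx', hy]; rfl), hval_nil_ups M _ _ hy, h9, hacc,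
    ldn_arc hx, lna_arc hx hx', if_pos he, if_pos he]
  rw [hy] at hl
  simp only [List.length_nil, zero_add] at hl
  rw [show p + (lna y + (lup x + 1)) = p + (lup x + 1) + lna y by omega,
    show p + 2 * (lna y + (lup x + 1)) + ldn y + M = p + y.length + 2 * (lup x + 1) + M by omega,
    show p + (lup x + 1) + 2 * lna y + ldn y + M = p + y.length + (lup x + 1) + M by omega]
  have h1 := qint_ne_zero hq0 hq (show 0 < p + y.length + (lup x + 1) + M by omega)
  field_simp

theorem pairCount_even {M k : ℕ} (h : EvenFull M k) (σ : ℕ) :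
    2 * pairCount M σ k + M = 2 * σ + k := by
  obtain ⟨h1, h2⟩ := h
  unfold pairCount
  omega

/-- The transfer sum when the rest of the word has no unmatched up arrow and all labels are used. -/
theorem thetaSum_lG_even (hq0 : q ≠ 0) (hq : ∀ n : ℕ, 0 < n → q ^ n ≠ 1) (hM : 1 ≤ M)
    (y w : List Bool) (hw : ldn w = 0) (hy : lups y = []) (he : EvenFull M (ldn y)) :
    thetaSum M q 0 y (fun c => lG M q (w ++ c)) =
      q⁻¹ * (qint q (y.length + M) / qint q (y.length + M + lup w + 1)) *
        lG M q (w ++ true :: y) := by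
  induction hn : y.length using Nat.strong_induction_on generalizing w y with
  | _ n ih =>
    have hlen := length_eq y
    match y with
    | [] =>
      exact absurd he.1 (by simp [ldn]; omega)
    | true :: y => simp [lups] at hy
    | false :: c =>
      by_cases hc : lups c = []
      · have hd : ldn (false :: c) = ldn c + 1 := by simp [ldn, hc]
        have ha : lna (false :: c) = lna c := by simp [lna, hc]
        rw [hd] at he
        have hne : ¬ EvenFull M (ldn c) := by
          rintro ⟨h1, h2⟩
          obtain ⟨h3, h4⟩ := he
          omega
        -- Counting the leading arrow, all `M` labels are in use, so a further down arrow brings no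
        -- label term.
        rw [thetaSum_down M q c hc, if_neg (not_lt.2 he.1), zero_mul, zero_add,
          mul_assoc]
        congr 1
        rw [lG_append_true M q hw, lG_append_true M q hw, hval_nil_ups M _ _ hc,
          hval_nil_ups M _ _ hy, hd, ha, if_neg hne, if_pos he]
        have h1 : pairCount M (lup w + 1 + lna c) (ldn c + 1) =
            pairCount M (lup w + 1 + lna c) (ldn c) := by
          obtain ⟨h1, h2⟩ := he
          unfold pairCount
          omega
        have h2 : enumCount M (lup w + 1 + lna c) (ldn c + 1) =
            enumCount M (lup w + 1 + lna c) (ldn c) := by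
          obtain ⟨h3, h2⟩ := he
          unfold enumCount
          rw [h1]
          omega
        have h9 : lf9 M q (false :: c) = lf9 M q c := by simp [lf9, hc]
        have hacc : lacc M q (false :: c) = qint q (n + M) * lacc M q c := by
          simp only [lacc, hc]
          rw [if_neg (not_lt.2 he.1), if_pos he, ← hn, hlen, hd, ha, hy]
          congr 2
          simp
          omega
        rw [h1, h2, h9, hacc]
        have h3 := qint_ne_zero hq0 hq (show 0 < n + M by omega)
        have h4 := qint_ne_zero hq0 hq (show 0 < n + M + lup w + 1 by omega)
        rw [show lup w + 1 + 2 * lna c + (ldn c + 1) + M = n + M + lup w + 1 by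
          rw [← hn, hlen, hd, ha, hy]; simp; omega]
        field_simp
      -- The leading down arrow spans an arc around `x`; this arc is moved into the prefix and the
      -- induction hypothesis is applied to what follows.
      · obtain ⟨x, y, rfl, hx, hx'⟩ := exists_balanced_prefix c hc
        have hy' : lups y = [] := by
          rw [lups_arc hx hx'] at hy
          simpa using hy
        rw [ldn_arc hx] at he
        have hw' : ldn (w ++ false :: (x ++ [true])) = 0 := by
          rw [ldn_append hw, ldn_arc hx]; rfl
        have hny : n = y.length + 2 * (lup x + 1) := by
          rw [← hn, hlen, length_eq y, ldn_arc hx, lna_arc hx hx', lups_arc hx hx']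
          simp
          omega
        have := ih y.length (by omega) y (w ++ false :: (x ++ [true])) hw' hy' he rfl
        simp only [List.append_assoc, List.cons_append, List.nil_append] at this
        rw [thetaSum_balanced M q x y hx hx', this, lG_arc_up M q hw hx hx',
          lG_up_balanced_up M q hw hx hx', lG_append_true M q hw,
          hval_arc_even M hq0 hq hM _ hx hx' hy' he, lup_append hw, lup_arc hx hx', hny]
        rw [show lup w + 1 + (lup x + 1) = lup w + lup x + 2 by omega,
          show y.length + 2 * (lup x + 1) + M + lup w + 1 =
            lup w + 1 + y.length + 2 * (lup x + 1) + M by omega,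
          show lup w + 1 + y.length + (lup x + 1) + M =
            y.length + M + (lup w + (lup x + 1)) + 1 by omega]
        -- With `A = |y| + M`, `m = lup x + 1`, `p = lup w + 1` this is `[A+m] [p+m] = [m] [A+m+p] +
        -- [A] [p]`.
        have hkey : qint q (y.length + (lup x + 1) + M) * qint q (lup w + lup x + 2) =
            qint q (lup x + 1) * qint q (y.length + M + (lup w + (lup x + 1)) + 1) +
              qint q (y.length + M) * qint q (lup w + 1) := by
          simp only [qint_eq hq0 hq]
          have := sub_inv_ne_zero hq0 hq
          simp only [pow_add, pow_one, pow_two]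
          field_simp
          ring
        have h1 := qint_ne_zero hq0 hq (show 0 < y.length + M + (lup w + (lup x + 1)) + 1 by omega)
        have h2 := qint_ne_zero hq0 hq (show 0 < lup w + lup x + 2 by omega)
        have h3 := qint_ne_zero hq0 hq (show 0 < lup w + 1 by omega)
        have h4 := qint_ne_zero hq0 hq (show 0 < lup x + 1 by omega)
        have h5 := qint_ne_zero hq0 hq (show 0 < y.length + 2 * (lup x + 1) + M by omega)
        have h6 := qint_ne_zero hq0 hq
          (show 0 < lup w + 1 + y.length + 2 * (lup x + 1) + M by omega)
        generalize hval M q (lup w + lup x + 2) y = H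
        generalize prefixFactor M q w = Z
        simp only [div_eq_mul_inv, mul_inv]
        generalize (lacc M q x)⁻¹ = A
        generalize qint q (y.length + (lup x + 1) + M) = a at *
        generalize qint q (lup w + lup x + 2) = b at *
        generalize qint q (y.length + M + (lup w + (lup x + 1)) + 1) = c at *
        generalize qint q (lup w + 1) = d at *
        generalize qint q (lup x + 1) = e at *
        generalize qint q (y.length + M) = f at *
        field_simp
        linear_combination (-H * Z * A) * hkey

theorem enumCount_even {M k : ℕ} (hM : 1 ≤ M) (h : EvenFull M k) (σ : ℕ) :
    enumCount M σ k + 1 = pairCount M σ k + M := by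
  have := h.1
  unfold enumCount
  omega

theorem pairCount_succ (σ k : ℕ) : pairCount M (σ + 1) k = pairCount M σ k + 1 := by
  unfold pairCount
  omega

theorem enumCount_succ (σ k : ℕ) : enumCount M (σ + 1) k = enumCount M σ k + 1 := by
  rw [enumCount, pairCount_succ, enumCount]
  omega

/-- While labels `p ≥ 2` are available, a new leftmost down arrow leaves the pair count unchanged.
It adds one left index to the factorial and one hook length to the denominator. -/
theorem hval_down_label {c : List Bool} (p : ℕ) (hc : lups c = []) (hk : ldn c + 1 < M) :
    hval M q p (false :: c) =
      hval M q p c * qint q (p + lna c + ldn c + 1) / qint q (ldn c + 1 + lna c) := by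
  have hd : ldn (false :: c) = ldn c + 1 := by simp [ldn, hc]
  have ha : lna (false :: c) = lna c := by simp [lna, hc]
  have hu : lups (false :: c) = [] := by simp [lups, hc]
  rw [hval_nil_ups M _ _ hu, hval_nil_ups M _ _ hc, hd, ha,
    if_neg fun h => by have := h.1; omega, if_neg fun h => by have := h.1; omega]
  have h1 : pairCount M (p + lna c) (ldn c + 1) = pairCount M (p + lna c) (ldn c) := by
    unfold pairCount; omega
  have h2 : enumCount M (p + lna c) (ldn c + 1) = enumCount M (p + lna c) (ldn c) + 1 := by
    unfold enumCount; omega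
  have h3 : enumCount M (p + lna c) (ldn c) = p + lna c + ldn c := by
    unfold enumCount pairCount; omega
  have h9 : lf9 M q (false :: c) = lf9 M q c := by simp [lf9, hc]
  have hacc : lacc M q (false :: c) = qint q (ldn c + 1 + lna c) * lacc M q c := by
    simp [lacc, hc, hk]
  rw [h1, h2, h9, hacc, qfact_succ, h3]
  simp only [div_eq_mul_inv, mul_inv]
  ring

theorem hval_succ_label {c : List Bool} (p : ℕ) (hc : lups c = []) (hk : ldn c < M) :
    hval M q (p + 1) c =
      hval M q p c * (qint q (p + lna c + ldn c + 1) * qang q (p + lna c + M)) := by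
  rw [hval_nil_ups M _ _ hc, hval_nil_ups M _ _ hc, if_neg fun h => by have := h.1; omega,
    if_neg fun h => by have := h.1; omega, show p + 1 + lna c = p + lna c + 1 by omega,
    pairCount_succ, enumCount_succ, qfact_succ, qangProd_succ,
    show pairCount M (p + lna c) (ldn c) = p + lna c by unfold pairCount; omega,
    show enumCount M (p + lna c) (ldn c) = p + lna c + ldn c by
      unfold enumCount pairCount; omega]
  ring

variable (q) in
/-- The value `hval` without the factor from `f6` when all labels are used. -/
def hvalEven (p : ℕ) (c : List Bool) : K :=
  qfact q (enumCount M (p + lna c) (ldn c)) * qangProd M q (pairCount M (p + lna c) (ldn c)) *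
    lf9 M q c / lacc M q c

theorem hval_eq_hvalEven {c : List Bool} (p : ℕ) (hc : lups c = []) (he : EvenFull M (ldn c)) :
    hval M q p c = hvalEven M q p c * qint q (p + (c.length + M)) := by
  rw [hval_nil_ups M _ _ hc, if_pos he, hvalEven, length_eq c, hc,
    show p + 2 * lna c + ldn c + M = p + (([] : List ℕ).length + ldn c + 2 * lna c + M) by
      simp; omega]
  ring

/-- Once all labels are used, the next factor of the factorial and the next factor of `qangProd`
have the same argument, namely the pair count plus `M`, so they merge into one quantum integer of
twice that size. -/
theorem hvalEven_succ (hq0 : q ≠ 0) (hq : ∀ n : ℕ, 0 < n → q ^ n ≠ 1) (hM : 1 ≤ M)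
    {c : List Bool} (p : ℕ) (hc : lups c = []) (he : EvenFull M (ldn c)) :
    hvalEven M q (p + 1) c = hvalEven M q p c * qint q (2 * p + (c.length + M)) := by
  have h1 := enumCount_even hM he (p + lna c)
  have h2 := pairCount_even he (p + lna c)
  rw [hvalEven, hvalEven, show p + 1 + lna c = p + lna c + 1 by omega, pairCount_succ,
    enumCount_succ, qfact_succ, qangProd_succ, h1, length_eq c, hc,
    show 2 * p + (([] : List ℕ).length + ldn c + 2 * lna c + M) =
      2 * (pairCount M (p + lna c) (ldn c) + M) by simp; omega, ← qint_mul_qang hq0 hq]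
  ring

/-- An unpaired down arrow raises both counts exactly as one more arrow in the prefix would. It has
no hook length, and it destroys the parity that produces the numerator of `N₆`. -/
theorem hval_down_unpaired (hM : 1 ≤ M) {c : List Bool} (p : ℕ) (hc : lups c = [])
    (he : EvenFull M (ldn c)) :
    hval M q p (false :: c) = hvalEven M q (p + 1) c := by
  have hd : ldn (false :: c) = ldn c + 1 := by simp [ldn, hc]
  have ha : lna (false :: c) = lna c := by simp [lna, hc]
  have hu : lups (false :: c) = [] := by simp [lups, hc]
  have hne : ¬ EvenFull M (ldn c + 1) := by
    rintro ⟨h1, h2⟩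
    obtain ⟨h3, h4⟩ := he
    omega
  have h1 : pairCount M (p + lna c) (ldn c + 1) = pairCount M (p + 1 + lna c) (ldn c) := by
    obtain ⟨h3, h4⟩ := he
    unfold pairCount
    omega
  have h2 : enumCount M (p + lna c) (ldn c + 1) = enumCount M (p + 1 + lna c) (ldn c) := by
    obtain ⟨h3, h4⟩ := he
    unfold enumCount
    rw [h1]
    omega
  have h9 : lf9 M q (false :: c) = lf9 M q c := by simp [lf9, hc]
  have hacc : lacc M q (false :: c) = lacc M q c := by
    have := he.1
    simp only [lacc, hc]
    rw [if_neg (by omega), if_neg hne]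
  rw [hval_nil_ups M _ _ hu, hd, ha, if_neg hne, h1, h2, h9, hacc, hvalEven]
  ring

/-- The recursion of the components for an additional up arrow on the left of the part of the word
that follows a prefix without unmatched down arrows. -/
theorem thetaSum_lG (hq0 : q ≠ 0) (hq : ∀ n : ℕ, 0 < n → q ^ n ≠ 1) (hM : 1 ≤ M)
    (y w : List Bool) (hw : ldn w = 0) (hy : ¬ (lups y = [] ∧ EvenFull M (ldn y))) :
    thetaSum M q 0 y (fun c => lG M q (w ++ c)) +
        q ^ (M + y.length + 2 * lup w) * lG M q (w ++ y) =
      q ^ lup w * lG M q (w ++ true :: y) := by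
  induction hn : y.length using Nat.strong_induction_on generalizing w y with
  | _ n ih =>
    have hlen := length_eq y
    match y with
    | [] =>
      subst hn
      rw [thetaSum, if_pos (by omega), lG_append' M q hw _ hy, lG_append_true M q hw,
        hval_nil_ups M _ _ rfl, hval_nil_ups M _ _ rfl]
      have h1 : ¬ EvenFull M 0 := fun h => by have := h.1; omega
      have h2 : ∀ σ, pairCount M σ 0 = σ := fun σ => by unfold pairCount; omega
      simp only [lna, ldn, h1, if_false, enumCount, h2, Nat.zero_min, add_zero, qfact_succ,
        qangProd_succ, lf9, lacc]
      have h3 := qint_ne_zero hq0 hq (show 0 < lup w + 1 by omega)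
      rw [qang]
      have h4 := pow_ne_zero (lup w) hq0
      have h5 := pow_ne_zero M hq0
      simp only [List.length_nil, pow_add, two_mul, pow_zero, tsub_zero]
      field_simp
      ring
    | true :: y =>
      have hw' : ldn (w ++ [true]) = 0 := by rw [ldn_append hw]; rfl
      have hl : lup (w ++ [true]) = lup w + 1 := by rw [lup_append hw]; rfl
      rw [thetaSum]
      -- If the rest is even-full without up arrows, the coefficient of a dashed arc appears at this
      -- up arrow, and the induction hypothesis is replaced by `thetaSum_lG_even`.
      by_cases hy' : lups y = [] ∧ EvenFull M (ldn y)
      · have := thetaSum_lG_even M hq0 hq hM y (w ++ [true]) hw' hy'.1 hy'.2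
        simp only [List.append_assoc, List.cons_append, List.nil_append] at this
        have hT := lG_append_true M q hw (true :: y)
        rw [hval_true] at hT
        rw [if_pos hy', this, hT, lG_append' M q hw (false :: y), lG_append_true M q hw,
          hval_down_unpaired M hM _ hy'.1 hy'.2, hval_eq_hvalEven M _ hy'.1 hy'.2,
          hval_eq_hvalEven M _ hy'.1 hy'.2, hvalEven_succ M hq0 hq hM (lup w + 1) hy'.1 hy'.2, hl,
          ← hn, List.length_cons]
        · generalize hvalEven M q (lup w + 1) y = B
          have h1 := qint_ne_zero hq0 hq (show 0 < lup w + 1 by omega)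
          have h2 := qint_ne_zero hq0 hq (show 0 < lup w + 1 + 1 by omega)
          have h3 := qint_ne_zero hq0 hq (show 0 < y.length + M + (lup w + 1) + 1 by omega)
          rw [show lup w + 1 + 1 + (y.length + M) = y.length + M + (lup w + 1) + 1 by omega]
          -- What is left after removing the common factor `hvalEven`, the prefix factor and the
          -- denominators. The three terms on the left come from the transfer sum, from the
          -- dashed-arc coefficient and from the word itself.
          have key : qint q (y.length + M) * qint q (2 * (lup w + 1) + (y.length + M)) +
              q * qint q (lup w + 1) * qint q (lup w + 1 + 1) +
              q ^ (y.length + M + 2 * lup w + 3) * qint q (lup w + 1 + (y.length + M)) *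
                qint q (lup w + 1 + 1) =
              q ^ (lup w + 2) * qint q (2 * (lup w + 1) + (y.length + M)) *
                qint q (y.length + M + (lup w + 1) + 1) := by
            have h4 := sub_inv_ne_zero hq0 hq
            simp only [qint_eq hq0 hq]
            simp only [pow_add, two_mul, mul_add, pow_succ, pow_zero]
            field_simp
            ring
          field_simp
          linear_combination (B * prefixFactor M q w) * key
        · have := hy'.2
          simp only [lups, ldn, hy'.1, EvenFull] at this ⊢
          rintro ⟨-, h⟩
          simp at h
          omega
      · have := ih y.length (by simp [← hn]) y (w ++ [true]) hw' hy' rfl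
        simp only [List.append_assoc, List.cons_append, List.nil_append, hl] at this
        rw [if_neg hy', add_zero, eq_sub_of_add_eq this, ← hn, List.length_cons]
        field_simp
        ring
    | false :: c =>
      by_cases hc : lups c = []
      · have hd : ldn (false :: c) = ldn c + 1 := by simp [ldn, hc]
        have ha : lna (false :: c) = lna c := by simp [lna, hc]
        have hm : M + (c.length + 1) + 2 * lup w = lup w + (lup w + 1 + (c.length + M)) := by
          omega
        rw [thetaSum_down M q c hc, lG_append_true M q hw, lG_append' M q hw _ hy,
          lG_append_true M q hw, ← hn, List.length_cons]
        have h1 := qint_ne_zero hq0 hq (show 0 < lup w + 1 by omega)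
        have hp := pow_ne_zero (lup w) hq0
        by_cases hk : ldn c + 1 < M
        · rw [if_pos hk, hval_down_label M _ hc hk, hval_down_label M _ hc hk,
            hval_succ_label M _ hc (by omega)]
          have h2 := qint_ne_zero hq0 hq (show 0 < ldn c + 1 + lna c by omega)
          have key := qint_add hq0 hq (lup w + 1) (ldn c + 1 + lna c)
          -- Here `t` is the label of the next down arrow; writing `M` as a sum removes the
          -- truncated subtraction from the exponents.
          obtain ⟨t, ht⟩ : ∃ t, M = ldn c + 1 + t := ⟨M - (ldn c + 1), by omega⟩
          have key2 : q ^ (M - (ldn c + 1)) * q ^ (M + (c.length + 1) + 2 * lup w) + 1 =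
              q ^ (M - (ldn c + 1)) * (q ^ (ldn c + 1 + lup w + lna c) *
                qang q (lup w + lna c + M)) := by
            have h3 := pow_ne_zero (lup w + lna c + M) hq0
            rw [length_eq c, hc, qang]
            field_simp
            rw [ht]
            simp
            ring
          have h3 := pow_ne_zero (M - (ldn c + 1)) hq0
          rw [show lup w + 1 + lna c + ldn c + 1 = lup w + 1 + (ldn c + 1 + lna c) by omega, key,
            show q ^ (M + (c.length + 1) + 2 * lup w) = q ^ (ldn c + 1 + lup w + lna c) *
                qang q (lup w + lna c + M) - (q ^ (M - (ldn c + 1)))⁻¹ by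
              field_simp
              linear_combination key2]
          simp only [pow_add, pow_one]
          field_simp
          ring
        -- The labels `p ≥ 2` are exhausted and the word is not even-full, so without its leading
        -- arrow it is: that arrow is the unpaired one.
        · have hk' : EvenFull M (ldn c) := by
            simp only [lups, ldn, hc, List.tail_nil, EvenFull, if_true, true_and] at hy ⊢
            omega
          rw [if_neg hk, hval_down_unpaired M hM _ hc hk', hval_down_unpaired M hM _ hc hk',
            hval_eq_hvalEven M _ hc hk', hvalEven_succ M hq0 hq hM (lup w + 1) hc hk',
            show 2 * (lup w + 1) + (c.length + M) = lup w + 1 + (lup w + 1 + (c.length + M)) by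
              omega, qint_add hq0 hq (lup w + 1) (lup w + 1 + (c.length + M)), hm]
          simp only [pow_add (n := lup w + 1 + (c.length + M)), pow_succ q (lup w)]
          field_simp
          ring
      · obtain ⟨x, y, rfl, hx, hx'⟩ := exists_balanced_prefix c hc
        have hy' : ¬ (lups y = [] ∧ EvenFull M (ldn y)) := by
          rw [lups_arc hx hx', ldn_arc hx] at hy
          simpa using hy
        have hw' : ldn (w ++ false :: (x ++ [true])) = 0 := by
          rw [ldn_append hw, ldn_arc hx]; rfl
        have hny : n = y.length + 2 * (lup x + 1) := by
          rw [← hn, hlen, length_eq y, ldn_arc hx, lna_arc hx hx', lups_arc hx hx']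
          simp
          omega
        -- The arc around `x` again joins the prefix. The difference between the two sides is then
        -- exactly `lG_arc_relation`.
        have := ih y.length (by omega) y (w ++ false :: (x ++ [true])) hw' hy' rfl
        simp only [List.append_assoc, List.cons_append, List.nil_append] at this
        rw [lup_append hw, lup_arc hx hx'] at this
        rw [thetaSum_balanced M q x y hx hx', eq_sub_of_add_eq this,
          lG_arc_relation M hq0 hq hw hx hx' y hy', hny]
        field_simp
        ring

end Transfer

end TypeBI

namespace TypeBI

/-! ### The two recursions for the components. -/

section Recursion

variable {K : Type*} [Field K] (M : ℕ) {q : K}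

/-- The new arrow always brings equal factors to numerator and denominator. For a label `p ≥ 2`, its
left index in the factorial equals its hook length. For a star or a dashed arc, the hook length
equals the new numerator of `N₆`. For an unpaired arrow, the lost numerator of `N₆` returns through
the larger counts. For an arc, its size equals the left index of the up arrow it captures; if that
was the only unmatched up arrow and the word is even-full, the change in `N₆` is the factor gained
in `N₉`. -/
theorem lG_false (hq0 : q ≠ 0) (hq : ∀ n : ℕ, 0 < n → q ^ n ≠ 1) (hM : 1 ≤ M) (b : List Bool) :
    lG M q (false :: b) = lG M q b := by
  have hlen := length_eq b
  unfold lG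
  match hb : lups b with
  | [] =>
    by_cases hk : ldn b + 1 < M
    · rw [hval_down_label M _ hb hk, show 0 + lna b + ldn b + 1 = ldn b + 1 + lna b by omega,
        mul_div_cancel_right₀ _ (qint_ne_zero hq0 hq (by omega))]
    · by_cases he : EvenFull M (ldn b)
      · rw [hval_down_unpaired M hM _ hb he, hvalEven_succ M hq0 hq hM _ hb he,
          hval_eq_hvalEven M _ hb he, mul_zero]
      · have he' : EvenFull M (ldn b + 1) := by
          unfold EvenFull at he ⊢
          omega
        have hd : ldn (false :: b) = ldn b + 1 := by simp [ldn, hb]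
        have ha : lna (false :: b) = lna b := by simp [lna, hb]
        have hu : lups (false :: b) = [] := by simp [lups, hb]
        have h1 : pairCount M (0 + lna b) (ldn b + 1) = pairCount M (0 + lna b) (ldn b) := by
          obtain ⟨h1, h2⟩ := he'
          unfold EvenFull at he
          unfold pairCount
          omega
        have h2 : enumCount M (0 + lna b) (ldn b + 1) = enumCount M (0 + lna b) (ldn b) := by
          unfold enumCount
          rw [h1]
          omega
        have h9 : lf9 M q (false :: b) = lf9 M q b := by simp [lf9, hb]
        have hacc : lacc M q (false :: b) =
            qint q (ldn b + 1 + M + 2 * lna b) * lacc M q b := by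
          simp only [lacc, hb]
          rw [if_neg hk, if_pos he']
        have h3 := qint_ne_zero hq0 hq (show 0 < ldn b + 1 + M + 2 * lna b by omega)
        rw [hval_nil_ups M _ _ hu, hval_nil_ups M _ _ hb, hd, ha, h1, h2, h9, hacc, if_pos he',
          if_neg he, show 0 + 2 * lna b + (ldn b + 1) + M = ldn b + 1 + M + 2 * lna b by omega]
        field_simp
  | m :: us =>
    have hm := qint_ne_zero hq0 hq (pos_of_mem_lups (b := b) (u := m) (by simp [hb]))
    have hu : lups (false :: b) = us := by simp [lups, hb]
    have hd : ldn (false :: b) = ldn b := by simp [ldn, hb]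
    have ha : lna (false :: b) = lna b + 1 := by simp [lna, hb]
    have hacc : lacc M q (false :: b) = qint q m * lacc M q b := by simp [lacc, hb]
    rw [hb] at hlen
    unfold hval
    rw [hu, hb, hd, ha, hacc]
    simp only [List.length_cons, add_zero, List.map_cons, List.prod_cons, zero_add]
    rw [show us.length + (lna b + 1) = us.length + 1 + lna b by omega]
    match hus : us with
    | [] =>
      simp only [List.length_nil, zero_add, List.getLastD_nil, tsub_zero,
        List.map_nil, List.prod_nil, List.getLastD_cons, one_mul, mul_one, lf9, hb]
      split_ifs
      · rw [show b.length + 1 + M - m = 2 * (1 + lna b) + ldn b + M - m by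
            rw [hlen]; simp; congr 1; omega,
          show b.length + 1 + M = 2 * (1 + lna b) + ldn b + M by rw [hlen]; simp; omega]
        have := qint_ne_zero hq0 hq (show 0 < 2 * (1 + lna b) + ldn b + M by omega)
        field_simp
      · rfl
    | m' :: us' =>
      have h9 : lf9 M q (false :: b) = lf9 M q b := by simp [lf9, hb]
      rw [h9]
      simp only [List.getLastD_cons, div_eq_mul_inv, mul_inv]
      ring

/-- The transfer sum with empty prefix. In the exceptional case the formula of `thetaSum_lG_even`
fits as well, by `[A+1] = q^A + q⁻¹ [A]` with `A = |b| + M`. -/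
theorem lG_true (hq0 : q ≠ 0) (hq : ∀ n : ℕ, 0 < n → q ^ n ≠ 1) (hM : 1 ≤ M) (b : List Bool) :
    lG M q (true :: b) = q ^ (M + b.length) * lG M q b + thetaSum M q 0 b (lG M q) := by
  by_cases hb : lups b = [] ∧ EvenFull M (ldn b)
  · have h := thetaSum_lG_even M hq0 hq hM b [] rfl hb.1 hb.2
    simp only [List.nil_append] at h
    have h0 : lup [] = 0 := rfl
    have h1 := qint_ne_zero hq0 hq (show 0 < b.length + M + 0 + 1 by omega)
    change thetaSum M q 0 b (lG M q) = _ at h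
    rw [h, lG, hval_true, hval_eq_hvalEven M _ hb.1 hb.2, hvalEven_succ M hq0 hq hM _ hb.1 hb.2,
      lG, hval_eq_hvalEven M _ hb.1 hb.2, h0, mul_zero]
    have := qint_add hq0 hq 1 (b.length + M)
    rw [qint_one] at this
    simp only [add_zero, zero_add, qint_one, div_one] at h1 ⊢
    rw [add_comm 1 (b.length + M)] at this ⊢
    field_simp
    rw [this]
    field_simp
    ring
  · have h := thetaSum_lG M hq0 hq hM b [] rfl hb
    simp only [List.nil_append, show lup [] = 0 from rfl, mul_zero, add_zero, pow_zero,
      one_mul] at h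
    rw [← h, add_comm]

theorem sum_cons {A : Type*} [AddCommMonoid A] {n : ℕ} (f : (Fin (n + 1) → Bool) → A) :
    ∑ b, f b = ∑ b : Fin n → Bool, f (Fin.cons true b) +
      ∑ b : Fin n → Bool, f (Fin.cons false b) := by
  rw [← (Fin.consEquiv fun _ : Fin (n + 1) => Bool).sum_comp, Fintype.sum_prod_type]
  simp [Fin.consEquiv]

theorem ofFn_cons {n : ℕ} (x : Bool) (b : Fin n → Bool) :
    List.ofFn (Fin.cons x b : Fin (n + 1) → Bool) = x :: List.ofFn b := by
  simp [List.ofFn_succ]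

theorem sum_ite_ofFn_eq {n : ℕ} (b : Fin n → Bool) (x : K) (p : List Bool → Prop)
    [DecidablePred p] (F : List Bool → K) :
    (∑ c : Fin n → Bool, (if List.ofFn c = List.ofFn b ∧ p (List.ofFn c) then x else 0) *
      F (List.ofFn c)) = (if p (List.ofFn b) then x else 0) * F (List.ofFn b) := by
  rw [Finset.sum_eq_single b]
  · simp
  · intro c _ hc
    rw [if_neg fun h => hc (List.ofFn_injective h.1), zero_mul]
  · simp

/-- For a given first letter of `b` and a given counter, each first letter of `c` either is
impossible, forces the rest of `c` to be that of `b`, or passes to a shorter sum. -/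
theorem sum_theta (q : K) {n : ℕ} (h : ℕ) (b : Fin n → Bool) (F : List Bool → K) :
    ∑ c : Fin n → Bool, theta M q h (List.ofFn c) (List.ofFn b) * F (List.ofFn c) =
      thetaSum M q h (List.ofFn b) F := by
  induction n generalizing h F with
  | zero => simp [theta, thetaSum]
  | succ n ih =>
    obtain ⟨x, b, rfl⟩ : ∃ x b', b = Fin.cons x b' := ⟨b 0, Fin.tail b, (Fin.cons_self_tail b).symm⟩
    rw [sum_cons]
    simp only [ofFn_cons]
    cases h with
    | zero =>
      cases x
      · have := sum_ite_ofFn_eq b q⁻¹ (fun _ => True) fun c => F (true :: c)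
        simp only [and_true, if_true] at this
        simp only [theta, thetaSum]
        rw [this, ih 1 b fun c => F (false :: c), add_comm]
      · have := sum_ite_ofFn_eq b q⁻¹ (fun c => lups c = [] ∧ EvenFull M (ldn c))
          fun c => F (false :: c)
        simp only [theta, thetaSum]
        rw [this, ← ih 0 b fun c => F (true :: c), Finset.mul_sum]
        simp only [mul_assoc, ite_mul, zero_mul]
    | succ h =>
      cases x
      · simp only [theta, thetaSum, zero_mul, Finset.sum_const_zero, zero_add]
        exact ih (h + 2) b fun c => F (false :: c)
      · simp only [theta, thetaSum, zero_mul, Finset.sum_const_zero, add_zero]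
        exact ih h b fun c => F (true :: c)

end Recursion

end TypeBI

namespace TypeBI

/-! ### Vectors of words, read from left to right with a stack of open down arrows. -/

section Vectors

variable {K : Type*} [Field K] (M : ℕ) (q : K)

/-- The coordinates of `v₋₁ ⊗ v₁ - q⁻¹ v₁ ⊗ v₋₁`. -/
def arcVec (x y : Bool) : K :=
  stdVec K false x * stdVec K true y - q⁻¹ * (stdVec K true x * stdVec K false y)

/-- The coordinates of `v₋₁ ⊗ v₋₁ - q⁻¹ v₁ ⊗ v₁`. -/
def dashVec (x y : Bool) : K :=
  stdVec K false x * stdVec K false y - q⁻¹ * (stdVec K true x * stdVec K true y)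

/-- The coordinates of the tensor product of the vectors of the down arrows in no arc. -/
def downVec : List Bool → K
  | [] => 1
  | x :: l =>
    if l.length < M then
      (stdVec K false x - (q ^ (M - l.length))⁻¹ * stdVec K true x) * downVec l
    else if EvenFull M l.length then stdVec K false x * downVec l
    else match l with
      | [] => 0
      | y :: l' => dashVec q x y * downVec l'

/-- The coordinates of the vector of a word.  The first argument lists the coordinates at
down arrows to the left that are not yet joined to an up arrow, starting from the right. -/
def wordVec : List Bool → List Bool → List Bool → K
  | s, [], [] => downVec M q s.reverse
  | s, false :: c, e :: ε => wordVec (e :: s) c ε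
  | x :: s, true :: c, e :: ε => arcVec q x e * wordVec s c ε
  | [], true :: c, e :: ε => stdVec K true e * wordVec [] c ε
  | _, _, _ => 0

/-- The correction that arises when the leftmost of the pending down arrows is unpaired. -/
def unpairedTerm (s c ε : List Bool) : K :=
  if (lups c).length < s.length ∧ EvenFull M (s.length - 1 - (lups c).length + ldn c) then
    stdVec K true (s.getLastD false) * wordVec M q s.dropLast c ε
  else 0

theorem sum_ite_eq_ofFn {n : ℕ} (b : Fin n → Bool) (x : K) (p : Prop) [Decidable p]
    (F : List Bool → K) :
    (∑ c : Fin n → Bool, (if List.ofFn b = List.ofFn c ∧ p then x else 0) * F (List.ofFn c)) =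
      (if p then x else 0) * F (List.ofFn b) := by
  rw [Finset.sum_eq_single b]
  · simp
  · intro c _ hc
    rw [if_neg fun h => hc (List.ofFn_injective h.1.symm), zero_mul]
  · simp

/-- The new leftmost down arrow is either labelled, so `v₋₁` exceeds its vector by a multiple of
`v₁`, or unpaired, with no correction, or the left end of a dashed arc. In the last case the head of
`l` was the unpaired arrow, and the correction is `q⁻¹ v₁ ⊗ v₁`. -/
theorem downVec_cons (hM : 1 ≤ M) (e : Bool) (l : List Bool) :
    stdVec K false e * downVec M q l = downVec M q (e :: l) + stdVec K true e *
      ((if l.length < M then (q ^ (M - l.length))⁻¹ else 0) * downVec M q l + q⁻¹ *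
        (if EvenFull M (l.length - 1) ∧ l ≠ [] then
          stdVec K true (l.headD false) * downVec M q l.tail else 0)) := by
  rw [downVec.eq_def M q (e :: l)]
  dsimp only
  split_ifs with h1 h2 h3 h4 h5
  · exact absurd h2.1.1 (by omega)
  · ring
  · obtain ⟨h4, h5⟩ := h4
    obtain ⟨h6, h7⟩ := h3
    have := List.length_pos_iff.2 h5
    have := h4.1
    have := h4.2
    omega
  · ring
  · match l with
    | [] => exact absurd rfl h5.2
    | y :: l' =>
      have h6 := h5.1
      simp only [List.length_cons, Nat.add_sub_cancel] at h6
      have h7 : downVec M q (y :: l') = stdVec K false y * downVec M q l' := by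
        rw [downVec.eq_def]
        dsimp only
        rw [if_neg (not_lt.2 h6.1), if_pos h6]
      rw [h7]
      simp only [List.headD_cons, List.tail_cons, dashVec]
      ring
  · exfalso
    match l with
    | [] => simp at h1; omega
    | y :: l' =>
      unfold EvenFull at h3 h5
      simp at h1 h3 h5
      omega

/-- The form of the expansion that survives induction: the new arrow sits below a stack of open down
arrows. If the bottom of the stack is unpaired, the new arrow forms a dashed arc with it. That
correction removes an entry of the stack, so no combination of words with the same stack expresses
it, and `unpairedTerm` carries it separately. -/
theorem wordVec_append_singleton (hM : 1 ≤ M) {n : ℕ} (s : List Bool) (e : Bool)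
    (c ε : Fin n → Bool) :
    stdVec K false e * wordVec M q s (List.ofFn c) (List.ofFn ε) =
      wordVec M q (s ++ [e]) (List.ofFn c) (List.ofFn ε) + stdVec K true e *
        (∑ b : Fin n → Bool, theta M q s.length (List.ofFn c) (List.ofFn b) *
            wordVec M q s (List.ofFn b) (List.ofFn ε) +
          q⁻¹ * unpairedTerm M q s (List.ofFn c) (List.ofFn ε)) := by
  induction n generalizing s e with
  | zero =>
    have := downVec_cons M q hM e s.reverse
    simp only [List.ofFn_zero, wordVec, theta, Finset.univ_unique, Finset.sum_singleton,
      List.reverse_append, List.reverse_singleton, List.singleton_append, unpairedTerm]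
    rw [this]
    congr 4
    · simp
    · rcases List.eq_nil_or_concat s with rfl | ⟨l, m, rfl⟩
      · simp [lups]
      · simp [lups, ldn]
  | succ n ih =>
    obtain ⟨x, c, rfl⟩ : ∃ x b', c = Fin.cons x b' :=
      ⟨c 0, Fin.tail c, (Fin.cons_self_tail c).symm⟩
    obtain ⟨a, ε, rfl⟩ : ∃ x b', ε = Fin.cons x b' :=
      ⟨ε 0, Fin.tail ε, (Fin.cons_self_tail ε).symm⟩
    rw [sum_cons]
    simp only [ofFn_cons]
    cases x with
    | false =>
      have := ih (a :: s) e c ε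
      rw [List.cons_append] at this
      simp only [wordVec]
      rw [this]
      cases s with
      | nil =>
        -- The bottom of the stack is now the first letter of the word itself, and the separate
        -- correction turns into the coefficient at the pair `- c`, `+ c`.
        have h1 := sum_ite_eq_ofFn c q⁻¹ (lups (List.ofFn c) = [] ∧ EvenFull M (ldn (List.ofFn c)))
          fun c => wordVec M q [] (true :: c) (a :: List.ofFn ε)
        simp only [theta, List.length_nil, List.length_singleton, zero_add, unpairedTerm,
          Nat.not_lt_zero, false_and, if_false, mul_zero, add_zero]
        rw [h1]
        simp only [Nat.lt_one_iff, List.length_eq_zero_iff, wordVec, Nat.sub_self]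
        by_cases h : lups (List.ofFn c) = []
        · simp only [h, true_and, List.length_nil, List.dropLast_singleton, Nat.sub_zero,
            zero_add, List.getLastD_cons, List.getLastD_nil]
          split_ifs <;> ring
        · simp [h]
      | cons y s =>
        simp only [theta, List.length_cons, zero_mul, Finset.sum_const_zero, zero_add]
        congr 4
        unfold unpairedTerm
        simp only [List.length_cons, List.getLastD_cons, List.dropLast_cons_cons, wordVec, lups, ldn,
          List.length_tail, Nat.add_sub_cancel]
        by_cases h : lups (List.ofFn c) = []
        · simp [h, add_assoc, add_comm 1]
        · have := List.length_pos_iff.2 h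
          simp only [h, if_false]
          simp only [show ((lups (List.ofFn c)).length < s.length + 1 + 1) ↔
              ((lups (List.ofFn c)).length - 1 < s.length + 1) by omega,
            show s.length + 1 - (lups (List.ofFn c)).length =
              s.length - ((lups (List.ofFn c)).length - 1) by omega]
    | true =>
      cases s with
      | nil =>
        -- Here `v₋₁ ⊗ v₁` is an arc plus `q⁻¹ v₁ ⊗ v₋₁`; in the second term `v₋₁` has moved past
        -- the up arrow and the induction hypothesis expands it.
        have h1 := sum_ite_eq_ofFn c q⁻¹ True
          fun c => wordVec M q [] (false :: c) (a :: List.ofFn ε)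
        have := ih [] a c ε
        simp only [and_true, if_true] at h1
        simp only [List.length_nil, unpairedTerm, Nat.not_lt_zero, false_and, if_false, mul_zero,
          add_zero, List.nil_append] at this ⊢
        simp only [theta]
        rw [h1]
        simp only [wordVec, arcVec]
        have h2 : ∑ x : Fin n → Bool, q⁻¹ * theta M q 0 (List.ofFn c) (List.ofFn x) *
            (stdVec K true a * wordVec M q [] (List.ofFn x) (List.ofFn ε)) =
            q⁻¹ * (stdVec K true a * ∑ b : Fin n → Bool, theta M q 0 (List.ofFn c) (List.ofFn b) *
              wordVec M q [] (List.ofFn b) (List.ofFn ε)) := by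
          rw [Finset.mul_sum, Finset.mul_sum]
          exact Finset.sum_congr rfl fun _ _ => by ring
        rw [h2]
        linear_combination (stdVec K true e * q⁻¹) * this
      | cons y s =>
        have := ih s e c ε
        simp only [theta, List.length_cons, zero_mul, Finset.sum_const_zero, add_zero,
          List.cons_append, wordVec]
        rw [mul_left_comm, this]
        have h1 : unpairedTerm M q (y :: s) (true :: List.ofFn c) (a :: List.ofFn ε) =
            arcVec q y a * unpairedTerm M q s (List.ofFn c) (List.ofFn ε) := by
          unfold unpairedTerm
          cases s with
          | nil => simp [lups]
          | cons z s =>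
            simp only [lups, List.length_cons, List.length_map, ldn, List.getLastD_cons,
              List.dropLast_cons_cons, wordVec, Nat.add_lt_add_iff_right, mul_ite, mul_zero]
            rw [show s.length + 1 + 1 - 1 - ((lups (List.ofFn c)).length + 1) =
              s.length + 1 - 1 - (lups (List.ofFn c)).length by omega]
            congr 1
            ring
        rw [h1]
        have h2 : ∑ x : Fin n → Bool, theta M q s.length (List.ofFn c) (List.ofFn x) *
            (arcVec q y a * wordVec M q s (List.ofFn x) (List.ofFn ε)) =
            arcVec q y a * ∑ b : Fin n → Bool, theta M q s.length (List.ofFn c) (List.ofFn b) *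
              wordVec M q s (List.ofFn b) (List.ofFn ε) := by
          rw [Finset.mul_sum]
          exact Finset.sum_congr rfl fun _ _ => by ring
        rw [h2]
        ring

/-- The expansion of `v₋₁ ⊗ D_c`. -/
theorem wordVec_false (hM : 1 ≤ M) {n : ℕ} (e : Bool) (c ε : Fin n → Bool) :
    wordVec M q [] (false :: List.ofFn c) (e :: List.ofFn ε) =
      stdVec K false e * wordVec M q [] (List.ofFn c) (List.ofFn ε) - stdVec K true e *
        ∑ b : Fin n → Bool, theta M q 0 (List.ofFn c) (List.ofFn b) *
            wordVec M q [] (List.ofFn b) (List.ofFn ε) := by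
  have h := wordVec_append_singleton M q hM [] e c ε
  simp only [unpairedTerm, List.length_nil, Nat.not_lt_zero, false_and, if_false, mul_zero,
    add_zero, List.nil_append] at h
  rw [wordVec, h]
  ring

end Vectors

end TypeBI

namespace TypeBI

/-! ### Diagrams of words with an additional letter on the left -/

section Cons

variable {N : ℕ}

/-- The word `b` with an additional letter `a` on the left. -/
abbrev bcons (a : Bool) (b : Fin N → Bool) : Fin (N + 1) → Bool := Fin.cons a b

@[simp]
theorem bcons_zero (a : Bool) (b : Fin N → Bool) : bcons a b 0 = a := rfl

@[simp]
theorem bcons_succ (a : Bool) (b : Fin N → Bool) (i : Fin N) : bcons a b i.succ = b i := rfl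

theorem exists_bcons (b : Fin (N + 1) → Bool) : ∃ a b', b = bcons a b' :=
  ⟨b 0, Fin.tail b, (Fin.cons_self_tail b).symm⟩

/-- The number of letters `s` at the places up to `k`. -/
def countTo (b : Fin N → Bool) (s : Bool) (k : Fin N) : ℕ :=
  ∑ l, if l ≤ k ∧ b l = s then 1 else 0

theorem countIn_eq (b : Fin N → Bool) (s : Bool) (i k : Fin N) :
    countIn b s i k = ∑ l, if i ≤ l ∧ l ≤ k ∧ b l = s then 1 else 0 := by
  rw [countIn, Finset.card_filter, ← Finset.sum_filter_add_sum_filter_not Finset.univ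
    (fun l => i ≤ l ∧ l ≤ k)]
  have h : ∑ l ∈ Finset.univ.filter (fun l => ¬ (i ≤ l ∧ l ≤ k)),
      (if i ≤ l ∧ l ≤ k ∧ b l = s then 1 else 0) = 0 :=
    Finset.sum_eq_zero fun l hl => by
      rw [if_neg]
      rintro ⟨h1, h2, -⟩
      exact (Finset.mem_filter.1 hl).2 ⟨h1, h2⟩
  rw [h, add_zero]
  refine Finset.sum_congr (by ext; simp) fun l hl => ?_
  have := Finset.mem_Icc.1 (by simpa using hl : l ∈ Finset.Icc i k)
  simp [this.1, this.2]

theorem countIn_succ (a s : Bool) (b : Fin N → Bool) (i k : Fin N) :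
    countIn (bcons a b) s i.succ k.succ = countIn b s i k := by
  rw [countIn_eq, countIn_eq, Fin.sum_univ_succ]
  simp

theorem countTo_succ (a s : Bool) (b : Fin N → Bool) (k : Fin N) :
    countTo (bcons a b) s k.succ = (if a = s then 1 else 0) + countTo b s k := by
  rw [countTo, countTo, Fin.sum_univ_succ]
  simp

theorem countTo_zero (a s : Bool) (b : Fin N → Bool) :
    countTo (bcons a b) s 0 = if a = s then 1 else 0 := by
  rw [countTo, Fin.sum_univ_succ]
  simp

theorem countIn_zero (b : Fin (N + 1) → Bool) (s : Bool) (k : Fin (N + 1)) :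
    countIn b s 0 k = countTo b s k := by
  rw [countIn_eq, countTo]
  simp

theorem isArc_succ (a : Bool) (b : Fin N → Bool) (i j : Fin N) :
    IsArc (bcons a b) i.succ j.succ ↔ IsArc b i j := by
  unfold IsArc
  refine and_congr (by simp) (and_congr (by simp) (and_congr (by simp) (and_congr ?_ ?_)))
  · rw [countIn_succ, countIn_succ]
  · refine ⟨fun h k h1 h2 => ?_, fun h k h1 h2 => ?_⟩
    · have := h k.succ (by simpa using h1) (by simpa using h2)
      rwa [countIn_succ, countIn_succ] at this
    · obtain rfl | ⟨k, rfl⟩ := k.eq_zero_or_eq_succ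
      · simp at h1
      · rw [countIn_succ, countIn_succ]
        exact h k (by simpa using h1) (by simpa using h2)

theorem not_isArc_zero (b : Fin (N + 1) → Bool) (i : Fin (N + 1)) : ¬ IsArc b i 0 :=
  fun h => absurd h.2.2.1 (Fin.not_lt_zero i)

/-- The up arrows in no arc, from left to right. -/
def upsList : {N : ℕ} → (Fin N → Bool) → List (Fin N)
  | 0, _ => []
  | _ + 1, b =>
    if b 0 = true then 0 :: (upsList (Fin.tail b)).map Fin.succ
    else ((upsList (Fin.tail b)).map Fin.succ).tail

theorem upsList_true (b : Fin N → Bool) :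
    upsList (bcons true b) = 0 :: (upsList b).map Fin.succ := by
  simp [upsList]

theorem upsList_false (b : Fin N → Bool) :
    upsList (bcons false b) = ((upsList b).map Fin.succ).tail := by
  simp [upsList]

/-- The up arrow at the place `j` is the `m`-th one in no arc if and only if the number of up arrows
exceeds that of down arrows by `m + 1` for the first time at `j`. -/
theorem getElem?_upsList (b : Fin N → Bool) (m : ℕ) (j : Fin N) :
    (upsList b)[m]? = some j ↔ b j = true ∧ countTo b true j = countTo b false j + m + 1 ∧
      ∀ k < j, countTo b true k ≤ countTo b false k + m := by
  induction N generalizing m with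
  | zero => exact j.elim0
  | succ N ih =>
    obtain ⟨a, b, rfl⟩ := exists_bcons b
    have hsplit : ∀ (p : Fin (N + 1) → Prop) (j : Fin N),
        (∀ k < j.succ, p k) ↔ p 0 ∧ ∀ k < j, p k.succ := fun p j => by
      refine ⟨fun h => ⟨h 0 (Fin.succ_pos j), fun k hk => h _ (by simpa using hk)⟩, ?_⟩
      rintro ⟨h1, h2⟩ k hk
      obtain rfl | ⟨k, rfl⟩ := k.eq_zero_or_eq_succ
      · exact h1
      · exact h2 k (by simpa using hk)
    cases a with
    | true =>
      rw [upsList_true]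
      obtain rfl | ⟨j, rfl⟩ := j.eq_zero_or_eq_succ
      · cases m <;> simp [countTo_zero, Fin.succ_ne_zero]
      · rw [hsplit]
        cases m with
        | zero => simp [countTo_zero, (Fin.succ_ne_zero j).symm]
        | succ m =>
          have := ih b m j
          simp only [List.getElem?_cons_succ, List.getElem?_map, Option.map_eq_some_iff,
            Fin.succ_inj, exists_eq_right, this, countTo_succ, countTo_zero, Fin.cons_succ,
            Bool.true_eq_false, if_true, if_false]
          refine and_congr Iff.rfl (and_congr (by omega) ?_)
          refine ⟨fun h => ⟨by omega, fun k hk => by have := h k hk; omega⟩,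
            fun h k hk => by have := h.2 k hk; omega⟩
    | false =>
      rw [upsList_false]
      obtain rfl | ⟨j, rfl⟩ := j.eq_zero_or_eq_succ
      · simp [Fin.succ_ne_zero]
      · rw [hsplit]
        have := ih b (m + 1) j
        simp only [List.getElem?_tail, List.getElem?_map, Option.map_eq_some_iff,
          Fin.succ_inj, exists_eq_right, this, countTo_succ, countTo_zero, Fin.cons_succ,
          Bool.false_eq_true, if_true, if_false]
        refine and_congr Iff.rfl (and_congr (by omega) ?_)
        refine ⟨fun h => ⟨by omega, fun k hk => by have := h k hk; omega⟩,
            fun h k hk => by have := h.2 k hk; omega⟩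

/-- The arc of a leading down arrow ends where the up arrows of the rest first outnumber its down
arrows, which is the case `m = 0` of `getElem?_upsList`. -/
theorem isArc_false_zero (b : Fin N → Bool) (j : Fin N) :
    IsArc (bcons false b) 0 j.succ ↔ (upsList b).head? = some j := by
  rw [List.head?_eq_getElem?, getElem?_upsList]
  unfold IsArc
  rw [countIn_zero, countIn_zero, countTo_succ, countTo_succ]
  simp only [Fin.cons_zero, Fin.cons_succ, true_and, Fin.succ_pos, Bool.false_eq_true, if_false,
    if_true]
  refine and_congr Iff.rfl (and_congr (by omega) ?_)
  refine ⟨fun h k hk => ?_, fun h k _ hk => ?_⟩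
  · have := h k.succ (Fin.zero_le _) (by simpa using hk)
    rw [countIn_zero, countIn_zero, countTo_succ, countTo_succ] at this
    simp at this
    omega
  · rw [countIn_zero, countIn_zero]
    obtain rfl | ⟨k, rfl⟩ := k.eq_zero_or_eq_succ
    · simp [countTo_zero]
    · have := h k (by simpa using hk)
      rw [countTo_succ, countTo_succ]
      simp
      omega

theorem not_isArc_true_zero (b : Fin N → Bool) (j : Fin (N + 1)) :
    ¬ IsArc (bcons true b) 0 j :=
  fun h => by simpa using h.1

theorem upsList_pairwise (b : Fin N → Bool) : (upsList b).Pairwise (· < ·) := by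
  induction N with
  | zero => exact List.Pairwise.nil
  | succ N ih =>
    obtain ⟨a, b, rfl⟩ := exists_bcons b
    have h : ((upsList b).map Fin.succ).Pairwise (· < ·) :=
      List.pairwise_map.2 ((ih b).imp fun h => by simpa using h)
    cases a with
    | true =>
      rw [upsList_true, List.pairwise_cons]
      refine ⟨fun x hx => ?_, h⟩
      obtain ⟨y, -, rfl⟩ := List.mem_map.1 hx
      exact Fin.succ_pos y
    | false =>
      rw [upsList_false]
      exact h.tail

/-- Prepending an up arrow adds it to the unmatched ones; prepending a down arrow matches exactly
the first of them. -/
theorem mem_upsList (b : Fin N → Bool) (i : Fin N) : i ∈ upsList b ↔ i ∈ upArrows b := by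
  induction N with
  | zero => exact i.elim0
  | succ N ih =>
    obtain ⟨a, b, rfl⟩ := exists_bcons b
    have hup : ∀ i : Fin N, i.succ ∈ upArrows (bcons a b) ↔
        i ∈ upArrows b ∧ ¬ IsArc (bcons a b) 0 i.succ := fun i => by
      simp only [upArrows, Finset.mem_filter, Finset.mem_univ, true_and, Fin.cons_succ]
      refine ⟨fun h => ⟨⟨h.1, fun j => by rw [← isArc_succ a]; exact h.2 _⟩, h.2 0⟩,
        fun h => ⟨h.1.1, fun j => ?_⟩⟩
      obtain rfl | ⟨j, rfl⟩ := j.eq_zero_or_eq_succ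
      · exact h.2
      · rw [isArc_succ]
        exact h.1.2 j
    cases a with
    | true =>
      rw [upsList_true]
      obtain rfl | ⟨i, rfl⟩ := i.eq_zero_or_eq_succ
      · simp [upArrows, not_isArc_zero]
      · rw [hup, ← ih b]
        simp [not_isArc_true_zero, Fin.succ_ne_zero]
    | false =>
      rw [upsList_false]
      have hnd : (upsList b).Nodup := (upsList_pairwise b).imp fun h => ne_of_lt h
      obtain rfl | ⟨i, rfl⟩ := i.eq_zero_or_eq_succ
      · simp only [upArrows, Finset.mem_filter, Finset.mem_univ, true_and, Fin.cons_zero,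
          Bool.false_eq_true, false_and, iff_false]
        intro h
        obtain ⟨y, -, h⟩ := List.mem_map.1 (List.mem_of_mem_tail h)
        exact Fin.succ_ne_zero y h
      · rw [hup, ← ih b, isArc_false_zero]
        cases h : upsList b with
        | nil => simp
        | cons u l =>
          rw [h] at hnd
          have := (List.nodup_cons.1 hnd).1
          simp only [List.map_cons, List.tail_cons, List.mem_map, Fin.succ_inj, exists_eq_right,
            List.mem_cons, List.head?_cons, Option.some.injEq]
          constructor
          · intro h
            exact ⟨.inr h, by rintro rfl; exact this h⟩
          · rintro ⟨rfl | h, h'⟩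
            · exact absurd rfl h'
            · exact h

theorem toFinset_upsList (b : Fin N → Bool) : (upsList b).toFinset = upArrows b := by
  ext i
  rw [List.mem_toFinset, mem_upsList]

theorem upArrows_true (b : Fin N → Bool) :
    upArrows (bcons true b) = insert 0 ((upArrows b).map (Fin.succEmb N)) := by
  ext i
  rw [← mem_upsList, upsList_true]
  simp [← mem_upsList]

theorem upArrows_false (b : Fin N → Bool) {u : Fin N} {l : List (Fin N)} (h : upsList b = u :: l) :
    upArrows (bcons false b) = ((upArrows b).erase u).map (Fin.succEmb N) := by
  ext i
  have hnd : (upsList b).Nodup := (upsList_pairwise b).imp fun h => ne_of_lt h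
  rw [h] at hnd
  have := (List.nodup_cons.1 hnd).1
  rw [← mem_upsList, upsList_false, h]
  simp only [List.map_cons, List.tail_cons, List.mem_map, Finset.mem_map, Finset.mem_erase,
    ← mem_upsList, h, List.mem_cons, Fin.coe_succEmb]
  constructor
  · rintro ⟨j, hj, rfl⟩
    exact ⟨j, ⟨by rintro rfl; exact this hj, .inr hj⟩, rfl⟩
  · rintro ⟨j, ⟨hj, rfl | hj'⟩, rfl⟩
    · exact absurd rfl hj
    · exact ⟨j, hj', rfl⟩

theorem upsList_eq_nil (b : Fin N → Bool) : upsList b = [] ↔ upArrows b = ∅ := by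
  rw [← toFinset_upsList, List.toFinset_eq_empty_iff]

theorem upArrows_false_nil (b : Fin N → Bool) (h : upsList b = []) :
    upArrows (bcons false b) = ∅ := by
  rw [← upsList_eq_nil, upsList_false, h]
  rfl

/-- The shift of places by one on pairs. -/
abbrev succPair (N : ℕ) : Fin N × Fin N ↪ Fin (N + 1) × Fin (N + 1) :=
  (Fin.succEmb N).prodMap (Fin.succEmb N)

theorem mem_arcs {b : Fin N → Bool} {A : Fin N × Fin N} : A ∈ arcs b ↔ IsArc b A.1 A.2 := by
  simp [arcs]

theorem arcs_true (b : Fin N → Bool) : arcs (bcons true b) = (arcs b).map (succPair N) := by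
  ext ⟨i, j⟩
  rw [mem_arcs, Finset.mem_map]
  obtain rfl | ⟨i, rfl⟩ := i.eq_zero_or_eq_succ
  · simp [not_isArc_true_zero, Fin.succ_ne_zero]
  · obtain rfl | ⟨j, rfl⟩ := j.eq_zero_or_eq_succ
    · simp [not_isArc_zero, Fin.succ_ne_zero]
    · simp [isArc_succ, mem_arcs]

theorem arcs_false (b : Fin N → Bool) {u : Fin N} {l : List (Fin N)} (h : upsList b = u :: l) :
    arcs (bcons false b) = insert (0, u.succ) ((arcs b).map (succPair N)) := by
  ext ⟨i, j⟩
  rw [mem_arcs, Finset.mem_insert, Finset.mem_map]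
  obtain rfl | ⟨i, rfl⟩ := i.eq_zero_or_eq_succ
  · obtain rfl | ⟨j, rfl⟩ := j.eq_zero_or_eq_succ
    · simp [not_isArc_zero, Fin.succ_ne_zero, (Fin.succ_ne_zero _).symm]
    · simp [isArc_false_zero, h, Fin.succ_ne_zero, eq_comm]
  · obtain rfl | ⟨j, rfl⟩ := j.eq_zero_or_eq_succ
    · simp [not_isArc_zero, Fin.succ_ne_zero]
    · simp [isArc_succ, mem_arcs, Fin.succ_ne_zero]

theorem arcs_false_nil (b : Fin N → Bool) (h : upsList b = []) :
    arcs (bcons false b) = (arcs b).map (succPair N) := by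
  ext ⟨i, j⟩
  rw [mem_arcs, Finset.mem_map]
  obtain rfl | ⟨i, rfl⟩ := i.eq_zero_or_eq_succ
  · obtain rfl | ⟨j, rfl⟩ := j.eq_zero_or_eq_succ
    · simp [not_isArc_zero, Fin.succ_ne_zero]
    · simp [isArc_false_zero, h, Fin.succ_ne_zero]
  · obtain rfl | ⟨j, rfl⟩ := j.eq_zero_or_eq_succ
    · simp [not_isArc_zero, Fin.succ_ne_zero]
    · simp [isArc_succ, mem_arcs]

theorem succ_mem_downArrows (a : Bool) (b : Fin N → Bool) (i : Fin N) :
    i.succ ∈ downArrows (bcons a b) ↔ i ∈ downArrows b := by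
  simp only [downArrows, Finset.mem_filter, Finset.mem_univ, true_and, Fin.cons_succ]
  refine and_congr Iff.rfl ⟨fun h j => by rw [← isArc_succ a]; exact h _, fun h j => ?_⟩
  obtain rfl | ⟨j, rfl⟩ := j.eq_zero_or_eq_succ
  · exact not_isArc_zero _ _
  · rw [isArc_succ]
    exact h j

theorem zero_mem_downArrows (a : Bool) (b : Fin N → Bool) :
    0 ∈ downArrows (bcons a b) ↔ a = false ∧ upsList b = [] := by
  simp only [downArrows, Finset.mem_filter, Finset.mem_univ, true_and, Fin.cons_zero]
  refine and_congr_right fun h => ?_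
  subst h
  constructor
  · intro h
    cases hu : upsList b with
    | nil => rfl
    | cons u l => exact absurd ((isArc_false_zero b u).2 (by simp [hu])) (h _)
  · intro h j
    obtain rfl | ⟨j, rfl⟩ := j.eq_zero_or_eq_succ
    · exact not_isArc_zero _ _
    · simp [isArc_false_zero, h]

theorem downArrows_cons (a : Bool) (b : Fin N → Bool) (h : ¬ (a = false ∧ upsList b = [])) :
    downArrows (bcons a b) = (downArrows b).map (Fin.succEmb N) := by
  ext i
  obtain rfl | ⟨i, rfl⟩ := i.eq_zero_or_eq_succ
  · simp [zero_mem_downArrows, h, Fin.succ_ne_zero]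
  · simp [succ_mem_downArrows]

theorem downArrows_false_nil (b : Fin N → Bool) (h : upsList b = []) :
    downArrows (bcons false b) = insert 0 ((downArrows b).map (Fin.succEmb N)) := by
  ext i
  obtain rfl | ⟨i, rfl⟩ := i.eq_zero_or_eq_succ
  · simp [zero_mem_downArrows, h]
  · simp [succ_mem_downArrows, Fin.succ_ne_zero]

theorem rank_succ (a : Bool) (b : Fin N → Bool) (i : Fin N) :
    rank (bcons a b) i.succ = rank b i := by
  rw [rank, rank, ← Finset.card_map (Fin.succEmb N)]
  congr 1
  ext j
  obtain rfl | ⟨j, rfl⟩ := j.eq_zero_or_eq_succ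
  · simp [Fin.succ_ne_zero]
  · simp [succ_mem_downArrows]

theorem card_downArrows_cons (a : Bool) (b : Fin N → Bool) :
    (downArrows (bcons a b)).card =
      (downArrows b).card + if a = false ∧ upsList b = [] then 1 else 0 := by
  split_ifs with h
  · obtain ⟨rfl, h⟩ := h
    rw [downArrows_false_nil b h, Finset.card_insert_of_notMem (by simp [Fin.succ_ne_zero]),
      Finset.card_map]
  · rw [downArrows_cons a b h, Finset.card_map, add_zero]

theorem rank_zero (b : Fin (N + 1) → Bool) : rank b 0 = (downArrows b).card := by
  simp [rank]

/-! ### Comparison with the statistics of lists -/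

theorem length_lups (b : Fin N → Bool) : (lups (List.ofFn b)).length = (upsList b).length := by
  induction N with
  | zero => simp [lups, upsList]
  | succ N ih =>
    obtain ⟨a, b, rfl⟩ := exists_bcons b
    rw [ofFn_cons]
    cases a <;> simp [lups, upsList_true, upsList_false, ih b]

theorem lups_eq_nil (b : Fin N → Bool) : lups (List.ofFn b) = [] ↔ upsList b = [] := by
  rw [← List.length_eq_zero_iff, length_lups, List.length_eq_zero_iff]

theorem length_upsList (b : Fin N → Bool) : (upsList b).length = (upArrows b).card := by
  rw [← toFinset_upsList, List.toFinset_card_of_nodup]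
  exact (upsList_pairwise b).imp fun h => ne_of_lt h

theorem ldn_ofFn (b : Fin N → Bool) : ldn (List.ofFn b) = (downArrows b).card := by
  induction N with
  | zero => simp [ldn, downArrows]
  | succ N ih =>
    obtain ⟨a, b, rfl⟩ := exists_bcons b
    rw [ofFn_cons, card_downArrows_cons]
    cases a
    · simp only [ldn, lups_eq_nil, ih b, true_and]
      split_ifs <;> rfl
    · simp [ldn, ih b]

theorem lna_ofFn (b : Fin N → Bool) : lna (List.ofFn b) = (arcs b).card := by
  induction N with
  | zero => simp [lna, arcs]
  | succ N ih =>
    obtain ⟨a, b, rfl⟩ := exists_bcons b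
    rw [ofFn_cons]
    cases a
    · simp only [lna, lups_eq_nil, ih b]
      cases h : upsList b with
      | nil => rw [arcs_false_nil b h, Finset.card_map, if_pos rfl]
      | cons u l =>
        rw [arcs_false b h, Finset.card_insert_of_notMem
          (by simp [Fin.succ_ne_zero]), Finset.card_map, if_neg (by simp)]
    · rw [lna, arcs_true, Finset.card_map, ih b]

end Cons

end TypeBI

namespace TypeBI

/-! ### Products over ranks in a finite linear order. -/

section Ranks

variable {α : Type*} [LinearOrder α]

/-- The ranks counted from the top run through `1, …, |D|` once each. -/
theorem prod_rank_ge {A : Type*} [CommMonoid A] (D : Finset α) (f : ℕ → A) :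
    ∏ x ∈ D, f (D.filter fun y => x ≤ y).card = ∏ i ∈ Finset.range D.card, f (i + 1) := by
  induction D using Finset.induction_on_min with
  | empty => simp
  | insert a D ha ih =>
    have hn : a ∉ D := fun h => lt_irrefl a (ha a h)
    rw [Finset.prod_insert hn, Finset.card_insert_of_notMem hn, Finset.prod_range_succ, ← ih,
      mul_comm]
    congr 1
    · refine Finset.prod_congr rfl fun x hx => ?_
      rw [Finset.filter_insert, if_neg (not_le.2 (ha x hx))]
    · rw [Finset.filter_true_of_mem, Finset.card_insert_of_notMem hn]
      intro y hy
      obtain rfl | hy := Finset.mem_insert.1 hy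
      · exact le_rfl
      · exact (ha y hy).le

theorem prod_rank_le {A : Type*} [CommMonoid A] (D : Finset α) (f : ℕ → A) :
    ∏ x ∈ D, f (D.filter fun y => y ≤ x).card = ∏ i ∈ Finset.range D.card, f (i + 1) :=
  prod_rank_ge (α := αᵒᵈ) D f

theorem exists_rank_eq (D : Finset α) {j : ℕ} (h1 : 0 < j) (h2 : j ≤ D.card) :
    ∃ x ∈ D, (D.filter fun y => x ≤ y).card = j := by
  induction D using Finset.induction_on_min with
  | empty => simp at h2; omega
  | insert a D ha ih =>
    have hn : a ∉ D := fun h => lt_irrefl a (ha a h)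
    rw [Finset.card_insert_of_notMem hn] at h2
    by_cases h : j = D.card + 1
    · refine ⟨a, Finset.mem_insert_self _ _, ?_⟩
      rw [Finset.filter_true_of_mem, Finset.card_insert_of_notMem hn, h]
      intro y hy
      obtain rfl | hy := Finset.mem_insert.1 hy
      · exact le_rfl
      · exact (ha y hy).le
    · obtain ⟨x, hx, rfl⟩ := ih (by omega)
      refine ⟨x, Finset.mem_insert_of_mem hx, ?_⟩
      rw [Finset.filter_insert, if_neg (not_le.2 (ha x hx))]

end Ranks

/-! ### Labelled, dashed and unpaired down arrows; diagram vectors as word vectors. -/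

section Down

variable {N : ℕ} (M : ℕ)

theorem rank_lt_rank {b : Fin N → Bool} {i j : Fin N} (hi : i ∈ downArrows b) (h : i < j) :
    rank b j < rank b i := by
  refine Finset.card_lt_card ⟨fun x hx => ?_, fun hs => ?_⟩
  · rw [Finset.mem_filter] at hx ⊢
    exact ⟨hx.1, h.le.trans hx.2⟩
  · have := hs (Finset.mem_filter.2 ⟨hi, le_rfl⟩)
    exact absurd (Finset.mem_filter.1 this).2 (not_le.2 h)

theorem lt_iff_rank_lt {b : Fin N → Bool} {i j : Fin N} (hi : i ∈ downArrows b)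
    (hj : j ∈ downArrows b) : i < j ↔ rank b j < rank b i := by
  refine ⟨rank_lt_rank hi, fun h => ?_⟩
  by_contra hn
  obtain h' | rfl := lt_or_eq_of_le (not_lt.1 hn)
  · exact absurd (rank_lt_rank hj h') (by omega)
  · omega

theorem rank_inj {b : Fin N → Bool} {i j : Fin N} (hi : i ∈ downArrows b)
    (hj : j ∈ downArrows b) (h : rank b i = rank b j) : i = j := by
  rcases lt_trichotomy i j with h' | h' | h'
  · have := rank_lt_rank hi h'; omega
  · exact h'
  · have := rank_lt_rank hj h'; omega

theorem rank_pos {b : Fin N → Bool} {i : Fin N} (hi : i ∈ downArrows b) : 0 < rank b i :=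
  Finset.card_pos.2 ⟨i, Finset.mem_filter.2 ⟨hi, le_rfl⟩⟩

theorem rank_le_card (b : Fin N → Bool) (i : Fin N) : rank b i ≤ (downArrows b).card :=
  Finset.card_filter_le _ _

theorem exists_rank (b : Fin N → Bool) {j : ℕ} (h1 : 0 < j) (h2 : j ≤ (downArrows b).card) :
    ∃ i ∈ downArrows b, rank b i = j :=
  exists_rank_eq _ h1 h2

theorem mem_dashedArcs {b : Fin N → Bool} {E : Fin N × Fin N} :
    E ∈ dashedArcs M b ↔ E.1 ∈ downArrows b ∧ E.2 ∈ downArrows b ∧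
      M < rank b E.2 ∧ (rank b E.2 - M) % 2 = 1 ∧ rank b E.1 = rank b E.2 + 1 := by
  simp [dashedArcs, and_assoc]

theorem mem_setV {b : Fin N → Bool} {i : Fin N} :
    i ∈ setV M b ↔ i ∈ downArrows b ∧ rank b i ≤ M := by
  simp [setV]

/-- Dashed arcs join the ranks `M+1, M+2`, then `M+3, M+4`, and so on. An arrow of odd excess over
`M` is thus single only if nothing lies to its left, and one of even excess always has its partner
on the right. -/
theorem mem_unpairedDown {b : Fin N → Bool} {i : Fin N} :
    i ∈ unpairedDown M b ↔ i ∈ downArrows b ∧ rank b i = (downArrows b).card ∧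
      M < rank b i ∧ (rank b i - M) % 2 = 1 := by
  simp only [unpairedDown, Finset.mem_filter, mem_dashedArcs]
  refine and_congr_right fun hi => ⟨fun ⟨h1, h2⟩ => ?_, fun ⟨h1, h2, h3⟩ => ⟨h2, fun j => ?_⟩⟩
  · have h3 : (rank b i - M) % 2 = 1 := by
      by_contra h3
      obtain ⟨j, hj, hj'⟩ := exists_rank b (j := rank b i - 1) (by omega)
        (by have := rank_le_card b i; omega)
      exact (h2 j).1 ⟨hi, hj, by omega, by omega, by omega⟩
    refine ⟨?_, h1, h3⟩
    by_contra h4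
    obtain ⟨j, hj, hj'⟩ := exists_rank b (j := rank b i + 1) (by omega)
      (by have := rank_le_card b i; omega)
    exact (h2 j).2 ⟨hj, hi, h1, h3, hj'⟩
  · constructor
    · rintro ⟨-, -, h4, h5, h6⟩
      omega
    · rintro ⟨-, -, h4, h5, h6⟩
      have := rank_le_card b j
      omega

theorem succ_mem_setV (a : Bool) (b : Fin N → Bool) (i : Fin N) :
    i.succ ∈ setV M (bcons a b) ↔ i ∈ setV M b := by
  rw [mem_setV, mem_setV, succ_mem_downArrows, rank_succ]

theorem zero_mem_setV (a : Bool) (b : Fin N → Bool) :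
    0 ∈ setV M (bcons a b) ↔ (a = false ∧ upsList b = []) ∧ (downArrows b).card + 1 ≤ M := by
  rw [mem_setV, zero_mem_downArrows, rank_zero, card_downArrows_cons]
  refine and_congr_right fun h => ?_
  rw [if_pos h]

theorem succ_mem_dashedArcs (a : Bool) (b : Fin N → Bool) (i j : Fin N) :
    (i.succ, j.succ) ∈ dashedArcs M (bcons a b) ↔ (i, j) ∈ dashedArcs M b := by
  simp only [mem_dashedArcs, succ_mem_downArrows, rank_succ]

theorem zero_snd_notMem_dashedArcs (b : Fin (N + 1) → Bool) (i : Fin (N + 1)) :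
    (i, 0) ∉ dashedArcs M b := by
  rw [mem_dashedArcs, rank_zero]
  rintro ⟨-, -, -, -, h⟩
  have := rank_le_card b i
  simp only at h
  omega

/-- A dashed arc that starts at the new letter must end at the arrow that was unpaired before. -/
theorem zero_fst_mem_dashedArcs (a : Bool) (b : Fin N → Bool) (j : Fin N) :
    (0, j.succ) ∈ dashedArcs M (bcons a b) ↔
      (a = false ∧ upsList b = []) ∧ j ∈ unpairedDown M b := by
  simp only [mem_dashedArcs, mem_unpairedDown, zero_mem_downArrows, succ_mem_downArrows,
    rank_succ, rank_zero, card_downArrows_cons]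
  refine and_congr_right fun h => ?_
  rw [if_pos h]
  constructor
  · rintro ⟨h1, h2, h3, h4⟩
    exact ⟨h1, by omega, h2, h3⟩
  · rintro ⟨h1, h2, h3, h4⟩
    exact ⟨h1, h3, h4, by omega⟩

theorem setV_cons (a : Bool) (b : Fin N → Bool)
    (h : ¬ ((a = false ∧ upsList b = []) ∧ (downArrows b).card + 1 ≤ M)) :
    setV M (bcons a b) = (setV M b).map (Fin.succEmb N) := by
  ext i
  obtain rfl | ⟨i, rfl⟩ := i.eq_zero_or_eq_succ
  · simp only [zero_mem_setV, h, false_iff]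
    simp [Fin.succ_ne_zero]
  · simp [succ_mem_setV]

theorem setV_false (b : Fin N → Bool) (h : upsList b = []) (hk : (downArrows b).card + 1 ≤ M) :
    setV M (bcons false b) = insert 0 ((setV M b).map (Fin.succEmb N)) := by
  ext i
  obtain rfl | ⟨i, rfl⟩ := i.eq_zero_or_eq_succ
  · simp [zero_mem_setV, h, hk]
  · simp [succ_mem_setV, Fin.succ_ne_zero]

theorem dashedArcs_cons (a : Bool) (b : Fin N → Bool)
    (h : ¬ ((a = false ∧ upsList b = []) ∧ (unpairedDown M b).Nonempty)) :
    dashedArcs M (bcons a b) = (dashedArcs M b).map (succPair N) := by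
  ext ⟨i, j⟩
  obtain rfl | ⟨j, rfl⟩ := j.eq_zero_or_eq_succ
  · simp [zero_snd_notMem_dashedArcs, Fin.succ_ne_zero]
  · obtain rfl | ⟨i, rfl⟩ := i.eq_zero_or_eq_succ
    · simp only [zero_fst_mem_dashedArcs, Finset.mem_map]
      constructor
      · rintro ⟨h1, h2⟩
        exact absurd ⟨h1, ⟨j, h2⟩⟩ h
      · rintro ⟨A, -, hA⟩
        exact absurd (congrArg Prod.fst hA) (Fin.succ_ne_zero _)
    · simp [succ_mem_dashedArcs]

theorem dashedArcs_false (b : Fin N → Bool) (h : upsList b = []) {j : Fin N}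
    (hj : j ∈ unpairedDown M b) :
    dashedArcs M (bcons false b) = insert (0, j.succ) ((dashedArcs M b).map (succPair N)) := by
  have huniq : ∀ i, i ∈ unpairedDown M b ↔ i = j := fun i => by
    refine ⟨fun hi => ?_, fun hi => hi ▸ hj⟩
    rw [mem_unpairedDown] at hi hj
    exact rank_inj hi.1 hj.1 (by omega)
  ext ⟨i, j⟩
  obtain rfl | ⟨j, rfl⟩ := j.eq_zero_or_eq_succ
  · simp [zero_snd_notMem_dashedArcs, Fin.succ_ne_zero, (Fin.succ_ne_zero _).symm]
  · obtain rfl | ⟨i, rfl⟩ := i.eq_zero_or_eq_succ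
    · simp [zero_fst_mem_dashedArcs, h, huniq, Fin.succ_ne_zero]
    · simp [succ_mem_dashedArcs, Fin.succ_ne_zero]

theorem unpairedDown_eq_empty {b : Fin N → Bool}
    (h : ¬ (M < (downArrows b).card ∧ ((downArrows b).card - M) % 2 = 1)) :
    unpairedDown M b = ∅ := by
  refine Finset.eq_empty_of_forall_notMem fun i hi => h ?_
  rw [mem_unpairedDown] at hi
  rw [← hi.2.1]
  exact hi.2.2

theorem unpairedDown_nonempty {b : Fin N → Bool} (h1 : M < (downArrows b).card)
    (h2 : ((downArrows b).card - M) % 2 = 1) : (unpairedDown M b).Nonempty := by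
  obtain ⟨i, hi, hr⟩ := exists_rank b (j := (downArrows b).card) (by omega) le_rfl
  exact ⟨i, (mem_unpairedDown M).2 ⟨hi, hr, by omega, by omega⟩⟩

theorem unpairedDown_nonempty_iff {b : Fin N → Bool} : (unpairedDown M b).Nonempty ↔
    M < (downArrows b).card ∧ ((downArrows b).card - M) % 2 = 1 := by
  refine ⟨fun h => ?_, fun h => unpairedDown_nonempty M h.1 h.2⟩
  by_contra hn
  rw [unpairedDown_eq_empty M hn] at h
  exact Finset.not_nonempty_empty h

theorem unpairedDown_eq_singleton {b : Fin N → Bool} {j : Fin N} (hj : j ∈ unpairedDown M b) :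
    unpairedDown M b = {j} := by
  ext i
  rw [Finset.mem_singleton]
  refine ⟨fun hi => ?_, fun hi => hi ▸ hj⟩
  rw [mem_unpairedDown] at hi hj
  exact rank_inj hi.1 hj.1 (by omega)

/-- The down arrows in no arc, from left to right. -/
def downsList : {N : ℕ} → (Fin N → Bool) → List (Fin N)
  | 0, _ => []
  | _ + 1, b =>
    if b 0 = false ∧ upsList (Fin.tail b) = [] then 0 :: (downsList (Fin.tail b)).map Fin.succ
    else (downsList (Fin.tail b)).map Fin.succ

theorem downsList_false (b : Fin N → Bool) (h : upsList b = []) :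
    downsList (bcons false b) = 0 :: (downsList b).map Fin.succ := by
  simp [downsList, h]

theorem downsList_cons (a : Bool) (b : Fin N → Bool) (h : ¬ (a = false ∧ upsList b = [])) :
    downsList (bcons a b) = (downsList b).map Fin.succ := by
  simp only [downsList, bcons_zero, Fin.tail_cons, h, if_false]

theorem length_downsList (b : Fin N → Bool) : (downsList b).length = (downArrows b).card := by
  induction N with
  | zero => simp [downsList, downArrows]
  | succ N ih =>
    obtain ⟨a, b, rfl⟩ := exists_bcons b
    rw [card_downArrows_cons]
    by_cases h : a = false ∧ upsList b = []
    · obtain ⟨rfl, h⟩ := h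
      simp [downsList_false b h, ih b, h]
    · simp [downsList_cons a b h, ih b, h]

theorem head_downsList (b : Fin N → Bool) {j : Fin N} {l : List (Fin N)}
    (h : downsList b = j :: l) : j ∈ downArrows b ∧ rank b j = (downArrows b).card := by
  induction N with
  | zero => exact j.elim0
  | succ N ih =>
    obtain ⟨a, b, rfl⟩ := exists_bcons b
    by_cases hn : a = false ∧ upsList b = []
    · obtain ⟨rfl, hn⟩ := hn
      rw [downsList_false b hn] at h
      obtain ⟨rfl, -⟩ := List.cons.inj h
      exact ⟨(zero_mem_downArrows _ _).2 ⟨rfl, hn⟩, rank_zero _⟩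
    · rw [downsList_cons a b hn] at h
      obtain ⟨i, l', hl, rfl, -⟩ := List.map_eq_cons_iff.1 h
      rw [succ_mem_downArrows, rank_succ, card_downArrows_cons, if_neg hn]
      exact ih b hl

variable {K : Type*} [Field K] (q : K)

/-- The product `downVec` without the factor of the unpaired down arrow. -/
def pairedVec (l : List Bool) : K :=
  if M < l.length ∧ (l.length - M) % 2 = 1 then downVec M q l.tail else downVec M q l

/-- The factor of the unpaired arrow is left out because the next unmatched down arrow on the left
turns it into the right end of a dashed arc; this keeps the induction on the first letter uniform.
-/
theorem pairedVec_downsList (b : Fin N → Bool) (ε : Fin N → Bool) :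
    pairedVec M q ((downsList b).map ε) =
      (∏ E ∈ dashedArcs M b, dashVec q (ε E.1) (ε E.2)) *
      ∏ c ∈ setV M b, (stdVec K false (ε c) - (q ^ label M b c)⁻¹ * stdVec K true (ε c)) := by
  induction N with
  | zero => simp [downsList, pairedVec, downVec, dashedArcs, setV, downArrows]
  | succ N ih =>
    obtain ⟨a, b, rfl⟩ := exists_bcons b
    obtain ⟨e, ε, rfl⟩ := exists_bcons ε
    have hl : ∀ c, label M (bcons a b) c.succ = label M b c := fun c => by
      rw [label, label, rank_succ]
    by_cases hn : a = false ∧ upsList b = []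
    · obtain ⟨rfl, hn⟩ := hn
      rw [downsList_false b hn]
      have hlen : ((downsList b).map ε).length = (downArrows b).card := by
        rw [List.length_map, length_downsList]
      have ih := ih b ε
      have hmap : ((downsList b).map Fin.succ).map (bcons e ε) = (downsList b).map ε := by
        simp [Function.comp_def]
      rw [List.map_cons, hmap, bcons_zero]
      by_cases hk : (downArrows b).card < M
      · rw [setV_false M b hn hk, dashedArcs_cons, Finset.prod_insert (by simp [Fin.succ_ne_zero]),
          Finset.prod_map, Finset.prod_map]
        · simp only [Function.Embedding.prodMap, Function.Embedding.coeFn_mk, Prod.map,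
            Fin.coe_succEmb, bcons_succ, bcons_zero, hl]
          rw [mul_left_comm, ← ih, pairedVec, pairedVec, if_neg (by simp [length_downsList]; omega),
            if_neg (by simp [length_downsList]; omega), downVec.eq_def]
          simp only [hlen, if_pos hk]
          rw [label, rank_zero, card_downArrows_cons, if_pos ⟨rfl, hn⟩, Nat.add_sub_add_right]
        · rw [unpairedDown_eq_empty M (by omega)]
          simp
      · rw [setV_cons M false b (by omega), Finset.prod_map]
        by_cases ho : ((downArrows b).card - M) % 2 = 1
        · obtain ⟨j, hj⟩ := unpairedDown_nonempty M (b := b) (by omega) ho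
          rw [dashedArcs_false M b hn hj, Finset.prod_insert (by simp [Fin.succ_ne_zero]),
            Finset.prod_map]
          simp only [Function.Embedding.prodMap, Function.Embedding.coeFn_mk, Prod.map,
            Fin.coe_succEmb, bcons_succ, bcons_zero, hl]
          rw [mul_assoc, ← ih]
          obtain ⟨i, l, hd⟩ := List.exists_cons_of_length_pos
            (show 0 < (downsList b).length by rw [length_downsList]; omega)
          have hij : i = j := by
            have h1 := head_downsList b hd
            have h2 := (mem_unpairedDown M).1 hj
            exact rank_inj h1.1 h2.1 (by omega)
          subst hij
          have hodd : ¬ EvenFull M (downArrows b).card := by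
            rintro ⟨h1, h2⟩
            omega
          rw [pairedVec, pairedVec, if_neg (by simp [length_downsList]; omega), if_pos (by rw [hlen]; omega),
            downVec.eq_def]
          simp only [hlen, if_neg hk, if_neg hodd]
          rw [hd]
          rfl
        · have he : EvenFull M (downArrows b).card := ⟨by omega, by omega⟩
          rw [dashedArcs_cons, Finset.prod_map]
          · simp only [Function.Embedding.prodMap, Function.Embedding.coeFn_mk, Prod.map,
              Fin.coe_succEmb, bcons_succ, hl]
            rw [← ih, pairedVec, pairedVec, if_pos (by simp [length_downsList]; omega),
              if_neg (by rw [hlen]; omega)]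
            rfl
          · rw [unpairedDown_eq_empty M (by omega)]
            simp
    · rw [downsList_cons a b hn, setV_cons M a b (by tauto), dashedArcs_cons M a b (by tauto),
        Finset.prod_map, Finset.prod_map]
      simp only [Function.Embedding.prodMap, Function.Embedding.coeFn_mk, Prod.map,
        Fin.coe_succEmb, bcons_succ, hl]
      rw [← ih b ε, List.map_map]
      rfl

theorem downVec_downsList (b : Fin N → Bool) (ε : Fin N → Bool) :
    downVec M q ((downsList b).map ε) =
      pairedVec M q ((downsList b).map ε) * ∏ d ∈ unpairedDown M b, stdVec K false (ε d) := by
  have hlen : ((downsList b).map ε).length = (downArrows b).card := by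
    rw [List.length_map, length_downsList]
  by_cases h : M < (downArrows b).card ∧ ((downArrows b).card - M) % 2 = 1
  · obtain ⟨j, hj⟩ := unpairedDown_nonempty M h.1 h.2
    obtain ⟨i, l, hd⟩ := List.exists_cons_of_length_pos
      (show 0 < (downsList b).length by rw [length_downsList]; omega)
    have hij : i = j := by
      have h1 := head_downsList b hd
      have h2 := (mem_unpairedDown M).1 hj
      exact rank_inj h1.1 h2.1 (by omega)
    subst hij
    rw [unpairedDown_eq_singleton M hj, Finset.prod_singleton, pairedVec, if_pos (by rwa [hlen]),
      hd]
    rw [← length_downsList, hd, List.length_cons] at h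
    rw [List.map_cons, downVec.eq_def]
    simp only [List.length_map, List.tail_cons]
    rw [if_neg (by omega), if_pos ⟨by omega, by omega⟩, mul_comm]
  · rw [unpairedDown_eq_empty M h, Finset.prod_empty, mul_one, pairedVec, if_neg (by rwa [hlen])]

/-- The factors of the pending down arrows, of the up arrows and of the down arrows in no arc. -/
def pendingVec : List Bool → List Bool → List Bool → K
  | x :: s, y :: u, d => arcVec q x y * pendingVec s u d
  | [], u, d => (u.map (stdVec K true)).prod * downVec M q d
  | s, [], d => downVec M q (s.reverse ++ d)

theorem pendingVec_nil_right (s d : List Bool) :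
    pendingVec M q s [] d = downVec M q (s.reverse ++ d) := by
  cases s <;> simp [pendingVec]

/-- Unmatched up arrows of `b` close the stack from the top, in order. Entries that survive become
unmatched down arrows to the left of those of `b`, in reversed order since the stack is read from
the right. -/
theorem wordVec_eq (s : List Bool) (b ε : Fin N → Bool) :
    wordVec M q s (List.ofFn b) (List.ofFn ε) =
      (∏ A ∈ arcs b, arcVec q (ε A.1) (ε A.2)) *
        pendingVec M q s ((upsList b).map ε) ((downsList b).map ε) := by
  induction N generalizing s with
  | zero => simp [wordVec, arcs, upsList, downsList, pendingVec_nil_right]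
  | succ N ih =>
    obtain ⟨a, b, rfl⟩ := exists_bcons b
    obtain ⟨e, ε, rfl⟩ := exists_bcons ε
    have hmap : ∀ l : List (Fin N), (l.map Fin.succ).map (bcons e ε) = l.map ε := fun l => by
      simp [Function.comp_def]
    rw [ofFn_cons, ofFn_cons]
    cases a with
    | true =>
      rw [upsList_true, downsList_cons true b (by simp), arcs_true, Finset.prod_map, List.map_cons,
        hmap, hmap]
      simp only [Function.Embedding.prodMap, Function.Embedding.coeFn_mk, Prod.map,
        Fin.coe_succEmb, bcons_succ, bcons_zero]
      cases s with
      | nil =>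
        rw [wordVec, ih]
        cases hu : upsList b <;> simp [pendingVec]
        all_goals ring
      | cons x s =>
        rw [wordVec, ih, pendingVec]
        ring
    | false =>
      rw [wordVec, ih]
      cases hu : upsList b with
      | nil =>
        rw [arcs_false_nil b hu, upsList_false, hu, downsList_false b hu, Finset.prod_map]
        simp only [Function.Embedding.prodMap, Function.Embedding.coeFn_mk, Prod.map,
          Fin.coe_succEmb, bcons_succ, List.map_nil, List.tail_nil, pendingVec_nil_right,
          List.map_cons, hmap, bcons_zero]
        simp
      | cons u l =>
        rw [arcs_false b hu, upsList_false, hu, downsList_cons false b (by simp [hu]),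
          Finset.prod_insert (by simp [Fin.succ_ne_zero]), Finset.prod_map]
        simp only [Function.Embedding.prodMap, Function.Embedding.coeFn_mk, Prod.map,
          Fin.coe_succEmb, bcons_succ, List.map_cons, List.tail_cons, hmap, bcons_zero,
          pendingVec]
        ring

theorem klVec_eq (b ε : Fin N → Bool) :
    klVec M b q ε = wordVec M q [] (List.ofFn b) (List.ofFn ε) := by
  have h : (upsList b).Nodup := (upsList_pairwise b).imp fun h => ne_of_lt h
  have h1 : pendingVec M q [] ((upsList b).map ε) ((downsList b).map ε) =
      (∏ u ∈ upArrows b, stdVec K true (ε u)) * downVec M q ((downsList b).map ε) := by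
    rw [← toFinset_upsList, List.prod_toFinset _ h]
    cases upsList b <;> simp [pendingVec, Function.comp_def]
  rw [wordVec_eq, h1, downVec_downsList, pairedVec_downsList, klVec]
  simp only [arcVec, dashVec]
  ring

end Down

end TypeBI

namespace TypeBI

/-! ### Relative positions of arcs and arrows -/

section Geometry

variable {N : ℕ}

theorem mem_arcs_cons {a : Bool} {b : Fin N → Bool} {A : Fin (N + 1) × Fin (N + 1)} :
    A ∈ arcs (bcons a b) ↔ (∃ A' ∈ arcs b, A = (A'.1.succ, A'.2.succ)) ∨
      (a = false ∧ ∃ u l, upsList b = u :: l ∧ A = (0, u.succ)) := by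
  cases a with
  | true =>
    rw [arcs_true, Finset.mem_map]
    simp [eq_comm]
  | false =>
    cases h : upsList b with
    | nil =>
      rw [arcs_false_nil b h, Finset.mem_map]
      simp [eq_comm]
    | cons u l =>
      rw [arcs_false b h, Finset.mem_insert, Finset.mem_map]
      simp [eq_comm, or_comm]

theorem mem_downArrows_cons {a : Bool} {b : Fin N → Bool} {d : Fin (N + 1)} :
    d ∈ downArrows (bcons a b) ↔ (∃ d' ∈ downArrows b, d = d'.succ) ∨
      (a = false ∧ upsList b = [] ∧ d = 0) := by
  obtain rfl | ⟨d, rfl⟩ := d.eq_zero_or_eq_succ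
  · simp [zero_mem_downArrows, (Fin.succ_ne_zero _).symm]
  · simp [succ_mem_downArrows, Fin.succ_ne_zero]

theorem head_lt_of_mem_tail {b : Fin N → Bool} {u : Fin N} {l : List (Fin N)}
    (h : upsList b = u :: l) {v : Fin N} (hv : v ∈ l) : u < v := by
  have := upsList_pairwise b
  rw [h, List.pairwise_cons] at this
  exact this.1 v hv

theorem mem_upArrows_cons {a : Bool} {b : Fin N → Bool} {u : Fin (N + 1)} :
    u ∈ upArrows (bcons a b) ↔ (a = true ∧ (u = 0 ∨ ∃ u' ∈ upArrows b, u = u'.succ)) ∨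
      (a = false ∧ ∃ v l, upsList b = v :: l ∧ ∃ u' ∈ l, u = u'.succ) := by
  cases a with
  | true =>
    rw [upArrows_true]
    simp [eq_comm]
  | false =>
    rw [← mem_upsList, upsList_false]
    cases upsList b with
    | nil => simp
    | cons v l => simp [eq_comm]

/-- An unmatched down arrow can only be prepended to a word without unmatched up arrows. -/
theorem ups_lt_downs {b : Fin N → Bool} {u d : Fin N} (hu : u ∈ upArrows b)
    (hd : d ∈ downArrows b) : u < d := by
  induction N with
  | zero => exact u.elim0
  | succ N ih =>
    obtain ⟨a, b, rfl⟩ := exists_bcons b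
    rw [mem_upArrows_cons] at hu
    rw [mem_downArrows_cons] at hd
    obtain ⟨d, hd, rfl⟩ | ⟨rfl, hn, rfl⟩ := hd
    · obtain ⟨-, rfl | ⟨u, hu, rfl⟩⟩ | ⟨-, v, l, hl, u, hu, rfl⟩ := hu
      · exact Fin.succ_pos d
      · exact Fin.succ_lt_succ_iff.2 (ih hu hd)
      · exact Fin.succ_lt_succ_iff.2 (ih ((mem_upsList _ _).1 (by rw [hl]; simp [hu])) hd)
    · simp [hn] at hu

theorem arc_fst_lt_snd {b : Fin N → Bool} {A : Fin N × Fin N} (hA : A ∈ arcs b) : A.1 < A.2 :=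
  (mem_arcs.1 hA).2.2.1

theorem arcs_ups {b : Fin N → Bool} {A : Fin N × Fin N} {u : Fin N} (hA : A ∈ arcs b)
    (hu : u ∈ upArrows b) : u < A.1 ∨ A.2 < u := by
  induction N with
  | zero => exact u.elim0
  | succ N ih =>
    obtain ⟨a, b, rfl⟩ := exists_bcons b
    rw [mem_upArrows_cons] at hu
    rw [mem_arcs_cons] at hA
    obtain ⟨A, hA, rfl⟩ | ⟨rfl, v, l, hl, rfl⟩ := hA
    · obtain ⟨-, rfl | ⟨u, hu, rfl⟩⟩ | ⟨-, v, l, hl, u, hu, rfl⟩ := hu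
      · exact .inl (Fin.succ_pos _)
      · simpa using ih hA hu
      · simpa using ih hA ((mem_upsList _ _).1 (by rw [hl]; simp [hu]))
    · obtain ⟨h, -⟩ | ⟨-, v', l', hl', u, hu, rfl⟩ := hu
      · simp at h
      · rw [hl] at hl'
        obtain ⟨rfl, rfl⟩ := List.cons.inj hl'
        exact .inr (Fin.succ_lt_succ_iff.2 (head_lt_of_mem_tail hl hu))

theorem arcs_downs {b : Fin N → Bool} {A : Fin N × Fin N} {d : Fin N} (hA : A ∈ arcs b)
    (hd : d ∈ downArrows b) : d < A.1 ∨ A.2 < d := by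
  induction N with
  | zero => exact d.elim0
  | succ N ih =>
    obtain ⟨a, b, rfl⟩ := exists_bcons b
    rw [mem_downArrows_cons] at hd
    rw [mem_arcs_cons] at hA
    obtain ⟨A, hA, rfl⟩ | ⟨rfl, v, l, hl, rfl⟩ := hA
    · obtain ⟨d, hd, rfl⟩ | ⟨-, -, rfl⟩ := hd
      · simpa using ih hA hd
      · exact .inl (Fin.succ_pos _)
    · obtain ⟨d, hd, rfl⟩ | ⟨-, h, -⟩ := hd
      · exact .inr (Fin.succ_lt_succ_iff.2
          (ups_lt_downs ((mem_upsList _ _).1 (by rw [hl]; simp)) hd))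
      · simp [h] at hl

/-- An arc prepended on the left ends at an unmatched up arrow, and no arc of the rest passes over
such an arrow. -/
theorem arcs_noncrossing {b : Fin N → Bool} {A C : Fin N × Fin N} (hA : A ∈ arcs b)
    (hC : C ∈ arcs b) (h : A.1 < C.1) : A.2 < C.1 ∨ C.2 < A.2 := by
  induction N with
  | zero => exact A.1.elim0
  | succ N ih =>
    obtain ⟨a, b, rfl⟩ := exists_bcons b
    rw [mem_arcs_cons] at hA hC
    obtain ⟨C, hC, rfl⟩ | ⟨rfl, v, l, hl, rfl⟩ := hC
    · obtain ⟨A, hA, rfl⟩ | ⟨rfl, v, l, hl, rfl⟩ := hA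
      · simpa using ih hA hC (by simpa using h)
      · simpa using arcs_ups hC ((mem_upsList _ _).1 (by rw [hl]; simp) : v ∈ upArrows b)
    · simp at h

theorem arc_ext {b : Fin N → Bool} {A C : Fin N × Fin N} (hA : A ∈ arcs b) (hC : C ∈ arcs b)
    (h : A.1 = C.1) : A = C := by
  induction N with
  | zero => exact A.1.elim0
  | succ N ih =>
    obtain ⟨a, b, rfl⟩ := exists_bcons b
    rw [mem_arcs_cons] at hA hC
    obtain ⟨C, hC, rfl⟩ | ⟨rfl, v, l, hl, rfl⟩ := hC
    · obtain ⟨A, hA, rfl⟩ | ⟨rfl, v, l, hl, rfl⟩ := hA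
      · rw [ih hA hC (by simpa using h)]
      · exact absurd h (Fin.succ_ne_zero _).symm
    · obtain ⟨A, hA, rfl⟩ | ⟨-, v', l', hl', rfl⟩ := hA
      · exact absurd h (Fin.succ_ne_zero _)
      · rw [hl] at hl'
        rw [(List.cons.inj hl').1]

theorem arc_ext_snd {b : Fin N → Bool} {A C : Fin N × Fin N} (hA : A ∈ arcs b)
    (hC : C ∈ arcs b) (h : A.2 = C.2) : A = C := by
  have h1 := arc_fst_lt_snd hA
  have h2 := arc_fst_lt_snd hC
  rcases lt_trichotomy A.1 C.1 with h' | h' | h'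
  · have := arcs_noncrossing hA hC h'; omega
  · exact arc_ext hA hC h'
  · have := arcs_noncrossing hC hA h'; omega

theorem two_mul_card_arcs (b : Fin N → Bool) :
    2 * (arcs b).card + (upArrows b).card + (downArrows b).card = N := by
  have := length_eq (List.ofFn b)
  rw [length_lups, length_upsList, ldn_ofFn, lna_ofFn, List.length_ofFn] at this
  omega

/-- The number of arcs that start weakly to the right of `x`. -/
def arcsFrom (b : Fin N → Bool) (x : Fin N) : ℕ := ((arcs b).filter fun A => x ≤ A.1).card

/-- The number of down arrows in no arc to the right of the arc `A`. -/
def level (b : Fin N → Bool) (A : Fin N × Fin N) : ℕ :=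
  ((downArrows b).filter fun d => A.1 < d).card

theorem arcsFrom_zero (b : Fin (N + 1) → Bool) : arcsFrom b 0 = (arcs b).card := by
  simp [arcsFrom]

theorem arcsFrom_succ (a : Bool) (b : Fin N → Bool) (x : Fin N) :
    arcsFrom (bcons a b) x.succ = arcsFrom b x := by
  rw [arcsFrom, arcsFrom, ← Finset.card_map (succPair N)]
  congr 1
  ext A
  simp only [Finset.mem_filter, mem_arcs_cons, Finset.mem_map]
  constructor
  · rintro ⟨⟨A, hA, rfl⟩ | ⟨-, u, l, -, rfl⟩, h⟩
    · exact ⟨A, ⟨hA, by simpa using h⟩, rfl⟩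
    · simp at h
  · rintro ⟨A, ⟨hA, h⟩, rfl⟩
    exact ⟨.inl ⟨A, hA, rfl⟩, by simpa using h⟩

theorem level_succ (a : Bool) (b : Fin N → Bool) (A : Fin N × Fin N) :
    level (bcons a b) (A.1.succ, A.2.succ) = level b A := by
  rw [level, level, ← Finset.card_map (Fin.succEmb N)]
  congr 1
  ext d
  simp only [Finset.mem_filter, mem_downArrows_cons, Finset.mem_map]
  constructor
  · rintro ⟨⟨d, hd, rfl⟩ | ⟨-, -, rfl⟩, h⟩
    · exact ⟨d, ⟨hd, by simpa using h⟩, rfl⟩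
    · simp at h
  · rintro ⟨d, ⟨hd, h⟩, rfl⟩
    exact ⟨.inl ⟨d, hd, rfl⟩, by simpa using h⟩

theorem level_zero (b : Fin N → Bool) {u : Fin N} {l : List (Fin N)} (h : upsList b = u :: l) :
    level (bcons false b) (0, u.succ) = (downArrows b).card := by
  rw [level, downArrows_cons _ _ (by simp [h]), Finset.filter_true_of_mem, Finset.card_map]
  simp

/-- The letters from `d` on consist of whole arcs and of unmatched down arrows, as unmatched up
arrows are all to the left. With the zero-based value of `d` the count is exact. -/
theorem add_arcsFrom_of_down {b : Fin N → Bool} {d : Fin N} (hd : d ∈ downArrows b) :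
    d + 2 * arcsFrom b d + rank b d = N := by
  induction N with
  | zero => exact d.elim0
  | succ N ih =>
    obtain ⟨a, b, rfl⟩ := exists_bcons b
    rw [mem_downArrows_cons] at hd
    obtain ⟨d, hd, rfl⟩ | ⟨rfl, hn, rfl⟩ := hd
    · rw [arcsFrom_succ, rank_succ, Fin.val_succ]
      have := ih hd
      omega
    · have := two_mul_card_arcs (bcons false b)
      rw [upArrows_false_nil b hn] at this
      rw [arcsFrom_zero, rank_zero]
      simp at this ⊢
      omega

theorem add_arcsFrom_of_up {b : Fin N → Bool} {u : Fin N} (hu : u ∈ upArrows b) :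
    u + 2 * arcsFrom b u + ((upArrows b).filter fun v => u ≤ v).card + (downArrows b).card = N := by
  induction N with
  | zero => exact u.elim0
  | succ N ih =>
    obtain ⟨a, b, rfl⟩ := exists_bcons b
    rw [mem_upArrows_cons] at hu
    obtain ⟨rfl, rfl | ⟨u, hu, rfl⟩⟩ | ⟨rfl, v, l, hl, u, hu, rfl⟩ := hu
    · have := two_mul_card_arcs (bcons true b)
      rw [arcsFrom_zero]
      simp at this ⊢
      omega
    · have h1 : ((upArrows (bcons true b)).filter fun v => u.succ ≤ v).card =
          ((upArrows b).filter fun v => u ≤ v).card := by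
        rw [← Finset.card_map (Fin.succEmb N)]
        congr 1
        ext v
        obtain rfl | ⟨v, rfl⟩ := v.eq_zero_or_eq_succ
        · simp [Fin.succ_ne_zero]
        · simp [upArrows_true, Fin.succ_ne_zero]
      rw [h1, arcsFrom_succ, Fin.val_succ, card_downArrows_cons, if_neg (by simp)]
      have := ih hu
      omega
    · have h1 : ((upArrows (bcons false b)).filter fun v => u.succ ≤ v).card =
          ((upArrows b).filter fun v => u ≤ v).card := by
        rw [← Finset.card_map (Fin.succEmb N)]
        congr 1
        have := head_lt_of_mem_tail hl hu
        ext w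
        obtain rfl | ⟨w, rfl⟩ := w.eq_zero_or_eq_succ
        · simp [Fin.succ_ne_zero]
        · simp [upArrows_false b hl]
          intro h _ h'
          omega
      rw [h1, arcsFrom_succ, Fin.val_succ, card_downArrows_cons, if_neg (by simp [hl])]
      have := ih ((mem_upsList b u).1 (by rw [hl]; simp [hu]))
      omega

/-- No arc passes over an unmatched down arrow, so the relative position is decided by the number of
such arrows to the right of the arc. This turns the definitions of `S_R`, `S_{W'}`, `S_W`, `S_L`
into ranges of `level`. -/
theorem lt_fst_iff_level_lt {b : Fin N → Bool} {A : Fin N × Fin N} {d : Fin N}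
    (hA : A ∈ arcs b) (hd : d ∈ downArrows b) : d < A.1 ↔ level b A < rank b d := by
  have h1 := arc_fst_lt_snd hA
  constructor
  · intro h
    refine Finset.card_lt_card ⟨fun x hx => ?_, fun hs => ?_⟩
    · rw [Finset.mem_filter] at hx ⊢
      exact ⟨hx.1, (h.trans hx.2).le⟩
    · have := hs (Finset.mem_filter.2 ⟨hd, le_rfl⟩)
      exact absurd (Finset.mem_filter.1 this).2 (not_lt.2 h.le)
  · intro h
    by_contra hn
    have h2 := (arcs_downs hA hd).resolve_left hn
    refine absurd (Finset.card_le_card (t := (downArrows b).filter fun d => A.1 < d)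
      fun x hx => ?_) (not_le.2 h)
    rw [Finset.mem_filter] at hx ⊢
    exact ⟨hx.1, (h1.trans h2).trans_le hx.2⟩

theorem snd_lt_iff_le_level {b : Fin N → Bool} {A : Fin N × Fin N} {d : Fin N}
    (hA : A ∈ arcs b) (hd : d ∈ downArrows b) : A.2 < d ↔ rank b d ≤ level b A := by
  have h1 := arc_fst_lt_snd hA
  have h2 := arcs_downs hA hd
  have h3 := lt_fst_iff_level_lt hA hd
  rw [← not_lt, ← h3]
  constructor <;> intro h <;> omega

theorem level_le (b : Fin N → Bool) (A : Fin N × Fin N) : level b A ≤ (downArrows b).card :=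
  Finset.card_filter_le _ _

theorem arcsFrom_eq {b : Fin N → Bool} {d : Fin N} (hd : d ∈ downArrows b) :
    arcsFrom b d = ((arcs b).filter fun A => level b A < rank b d).card := by
  rw [arcsFrom]
  congr 1
  refine Finset.filter_congr fun A hA => ?_
  rw [← lt_fst_iff_level_lt hA hd]
  refine ⟨fun h => lt_of_le_of_ne h ?_, le_of_lt⟩
  have := arcs_downs hA hd
  have := arc_fst_lt_snd hA
  omega

/-- The arcs inside no other arc and to the right of all up arrows that are in no arc. -/
def freeArcs (b : Fin N → Bool) : Finset (Fin N × Fin N) :=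
  (arcs b).filter fun A => (∀ C ∈ arcs b, ¬ (C.1 < A.1 ∧ A.2 < C.2)) ∧ ∀ u ∈ upArrows b, u < A.1

theorem freeArcs_subset (b : Fin N → Bool) : freeArcs b ⊆ arcs b := Finset.filter_subset _ _

theorem freeArcs_true (b : Fin N → Bool) :
    freeArcs (bcons true b) = (freeArcs b).map (succPair N) := by
  ext A
  simp only [freeArcs, Finset.mem_filter, Finset.mem_map]
  constructor
  · rintro ⟨h1, h2, h3⟩
    obtain ⟨A, hA, rfl⟩ | ⟨h, -⟩ := mem_arcs_cons.1 h1
    · refine ⟨A, ⟨hA, fun C hC h => ?_, fun u hu => ?_⟩, rfl⟩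
      · exact h2 _ (mem_arcs_cons.2 (.inl ⟨C, hC, rfl⟩)) (by simpa using h)
      · simpa using h3 _ (mem_upArrows_cons.2 (.inl ⟨rfl, .inr ⟨u, hu, rfl⟩⟩))
    · simp at h
  · rintro ⟨A, ⟨h1, h2, h3⟩, rfl⟩
    refine ⟨mem_arcs_cons.2 (.inl ⟨A, h1, rfl⟩), fun C hC h => ?_, fun u hu => ?_⟩
    · obtain ⟨C, hC', rfl⟩ | ⟨h, -⟩ := mem_arcs_cons.1 hC
      · exact h2 C hC' (by simpa using h)
      · simp at h
    · obtain ⟨-, rfl | ⟨u, hu', rfl⟩⟩ | ⟨h, -⟩ := mem_upArrows_cons.1 hu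
      · exact Fin.succ_pos _
      · simpa using h3 u hu'
      · simp at h

theorem freeArcs_false_nil (b : Fin N → Bool) (h : upsList b = []) :
    freeArcs (bcons false b) = (freeArcs b).map (succPair N) := by
  have hu : upArrows b = ∅ := (upsList_eq_nil b).1 h
  ext A
  simp only [freeArcs, Finset.mem_filter, Finset.mem_map, upArrows_false_nil b h, hu,
    Finset.notMem_empty, false_imp_iff, implies_true, and_true, arcs_false_nil b h]
  constructor
  · rintro ⟨⟨A, hA, rfl⟩, h2⟩
    exact ⟨A, ⟨hA, fun C hC h => h2 _ ⟨C, hC, rfl⟩ (by simpa using h)⟩, rfl⟩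
  · rintro ⟨A, ⟨h1, h2⟩, rfl⟩
    refine ⟨⟨A, h1, rfl⟩, ?_⟩
    rintro _ ⟨C, hC, rfl⟩ h
    exact h2 C hC (by simpa using h)

/-- A new leading arc covers the arcs to the left of the first unmatched up arrow. These were not
free before either, since that up arrow was to their right. -/
theorem succ_mem_freeArcs_false (b : Fin N → Bool) {u : Fin N} {l : List (Fin N)}
    (hl : upsList b = u :: l) (A : Fin N × Fin N) :
    (A.1.succ, A.2.succ) ∈ freeArcs (bcons false b) ↔ A ∈ freeArcs b := by
  have hmem : ∀ v, v ∈ upArrows b ↔ v = u ∨ v ∈ l := fun v => by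
    rw [← mem_upsList, hl, List.mem_cons]
  have hA : (A.1.succ, A.2.succ) ∈ arcs (bcons false b) ↔ A ∈ arcs b := by
    rw [mem_arcs, mem_arcs, isArc_succ]
  simp only [freeArcs, Finset.mem_filter, hA]
  refine and_congr_right fun hA => ?_
  constructor
  · rintro ⟨h2, h3⟩
    refine ⟨fun C hC h => ?_, fun v hv => ?_⟩
    · exact h2 _ (mem_arcs_cons.2 (.inl ⟨C, hC, rfl⟩)) (by simpa using h)
    · obtain rfl | hv' := (hmem v).1 hv
      · refine (arcs_ups hA hv).resolve_right fun h => ?_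
        exact h2 _ (mem_arcs_cons.2 (.inr ⟨rfl, v, l, hl, rfl⟩)) (by simpa using h)
      · simpa using h3 _ (mem_upArrows_cons.2 (.inr ⟨rfl, u, l, hl, v, hv', rfl⟩))
  · rintro ⟨h2, h3⟩
    refine ⟨fun C hC h => ?_, fun v hv => ?_⟩
    · obtain ⟨C, hC', rfl⟩ | ⟨-, v, l', hl', rfl⟩ := mem_arcs_cons.1 hC
      · exact h2 C hC' (by simpa using h)
      · have h4 := h3 v ((mem_upsList _ _).1 (by rw [hl']; simp))
        have h5 := arc_fst_lt_snd hA
        simp at h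
        omega
    · obtain ⟨h, -⟩ | ⟨-, v', l', hl', w, hw, rfl⟩ := mem_upArrows_cons.1 hv
      · simp at h
      · simpa using h3 w ((mem_upsList _ _).1 (by rw [hl']; simp [hw]))

theorem zero_mem_freeArcs_false (b : Fin N → Bool) {u : Fin N} {l : List (Fin N)}
    (hl : upsList b = u :: l) : (0, u.succ) ∈ freeArcs (bcons false b) ↔ l = [] := by
  simp only [freeArcs, Finset.mem_filter]
  constructor
  · rintro ⟨-, -, h⟩
    refine List.eq_nil_iff_forall_not_mem.2 fun v hv => ?_
    simpa using h _ (mem_upArrows_cons.2 (.inr ⟨rfl, u, l, hl, v, hv, rfl⟩))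
  · rintro rfl
    refine ⟨mem_arcs_cons.2 (.inr ⟨rfl, u, _, hl, rfl⟩), fun C _ h => ?_, fun v hv => ?_⟩
    · simp at h
    · obtain ⟨h, -⟩ | ⟨-, v', l', hl', w, hw, rfl⟩ := mem_upArrows_cons.1 hv
      · simp at h
      · rw [hl] at hl'
        simp [← (List.cons.inj hl').2] at hw

theorem freeArcs_false_singleton (b : Fin N → Bool) {u : Fin N} (hl : upsList b = [u]) :
    freeArcs (bcons false b) = insert (0, u.succ) ((freeArcs b).map (succPair N)) := by
  ext A
  rw [Finset.mem_insert, Finset.mem_map]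
  constructor
  · intro h
    obtain ⟨A, hA, rfl⟩ | ⟨-, v, l, hl', rfl⟩ := mem_arcs_cons.1 (freeArcs_subset _ h)
    · exact .inr ⟨A, (succ_mem_freeArcs_false b hl A).1 h, rfl⟩
    · rw [hl] at hl'
      rw [(List.cons.inj hl').1]
      exact .inl rfl
  · rintro (rfl | ⟨A, hA, rfl⟩)
    · exact (zero_mem_freeArcs_false b hl).2 rfl
    · exact (succ_mem_freeArcs_false b hl A).2 hA

theorem freeArcs_false_cons (b : Fin N → Bool) {u v : Fin N} {l : List (Fin N)}
    (hl : upsList b = u :: v :: l) :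
    freeArcs (bcons false b) = (freeArcs b).map (succPair N) := by
  ext A
  rw [Finset.mem_map]
  constructor
  · intro h
    obtain ⟨A, hA, rfl⟩ | ⟨-, u', l', hl', rfl⟩ := mem_arcs_cons.1 (freeArcs_subset _ h)
    · exact ⟨A, (succ_mem_freeArcs_false b hl A).1 h, rfl⟩
    · have := (zero_mem_freeArcs_false b hl').1 h
      rw [hl, this] at hl'
      simp at hl'
  · rintro ⟨A, hA, rfl⟩
    exact (succ_mem_freeArcs_false b hl A).2 hA

/-- From the left end of a free arc on, there are only whole arcs and unmatched down arrows: no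
surrounding arc closes there, and no unmatched up arrow follows. -/
theorem add_arcsFrom_of_free {b : Fin N → Bool} {A : Fin N × Fin N} (hA : A ∈ freeArcs b) :
    (A.1 : ℕ) + 2 * arcsFrom b A.1 + level b A = N := by
  induction N with
  | zero => exact A.1.elim0
  | succ N ih =>
    obtain ⟨a, b, rfl⟩ := exists_bcons b
    have key : ∀ A : Fin (N + 1) × Fin (N + 1), A ∈ (freeArcs b).map (succPair N) →
        (A.1 : ℕ) + 2 * arcsFrom (bcons a b) A.1 + level (bcons a b) A = N + 1 := by
      intro A hA
      obtain ⟨A, hA', rfl⟩ := Finset.mem_map.1 hA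
      have := ih hA'
      have h1 := arcsFrom_succ a b A.1
      have h2 := level_succ a b A
      have h3 : ((succPair N A).1 : ℕ) = A.1 + 1 := rfl
      have h4 : arcsFrom (bcons a b) (succPair N A).1 = arcsFrom b A.1 := h1
      have h5 : level (bcons a b) (succPair N A) = level b A := h2
      omega
    cases a with
    | true => exact key A (by rwa [freeArcs_true] at hA)
    | false =>
      cases hl : upsList b with
      | nil => exact key A (by rwa [freeArcs_false_nil b hl] at hA)
      | cons u l =>
        cases l with
        | cons v l => exact key A (by rwa [freeArcs_false_cons b hl] at hA)
        | nil =>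
          rw [freeArcs_false_singleton b hl, Finset.mem_insert] at hA
          obtain rfl | hA := hA
          · have h1 := two_mul_card_arcs (bcons false b)
            have h2 := upArrows_false b hl
            have h3 : upArrows b = {u} := by rw [← toFinset_upsList, hl]; rfl
            rw [h3, Finset.erase_singleton, Finset.map_empty] at h2
            rw [h2, card_downArrows_cons, if_neg (by simp [hl])] at h1
            rw [arcsFrom_zero, level_zero b hl]
            simp at h1 ⊢
            omega
          · exact key A hA

/-- The left index of an up arrow determines its position. -/
theorem getElem?_lups (b : Fin N → Bool) {i : ℕ} {u : Fin N} (h : (upsList b)[i]? = some u) :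
    ∃ m, (lups (List.ofFn b))[i]? = some m ∧ 2 * m = u + i + 2 := by
  induction N generalizing i with
  | zero => exact u.elim0
  | succ N ih =>
    obtain ⟨a, b, rfl⟩ := exists_bcons b
    rw [ofFn_cons]
    cases a with
    | true =>
      rw [upsList_true] at h
      rw [lups]
      cases i with
      | zero =>
        simp at h
        subst h
        exact ⟨1, by simp⟩
      | succ i =>
        rw [List.getElem?_cons_succ, List.getElem?_map, Option.map_eq_some_iff] at h
        obtain ⟨v, hv, rfl⟩ := h
        obtain ⟨m, hm, hm'⟩ := ih b hv
        refine ⟨m + 1, by simp [hm], ?_⟩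
        rw [Fin.val_succ]
        omega
    | false =>
      rw [upsList_false, List.getElem?_tail, List.getElem?_map, Option.map_eq_some_iff] at h
      obtain ⟨v, hv, rfl⟩ := h
      obtain ⟨m, hm, hm'⟩ := ih b hv
      refine ⟨m, by simp [lups, hm], ?_⟩
      rw [Fin.val_succ]
      omega

/-- Only whole arcs precede the first unmatched up arrow, so its left index is half the length of
the arc that a leading down arrow forms with it. -/
theorem head_lups (b : Fin N → Bool) {u : Fin N} {l : List (Fin N)} (h : upsList b = u :: l) :
    ∃ l', lups (List.ofFn b) = size ((0 : Fin (N + 1)), u.succ) :: l' ∧ l'.length = l.length ∧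
      2 * size ((0 : Fin (N + 1)), u.succ) = u + 2 := by
  obtain ⟨m, hm, hm'⟩ := getElem?_lups b (i := 0) (u := u) (by simp [h])
  have h1 := length_lups b
  have h2 : size ((0 : Fin (N + 1)), u.succ) = m := by
    simp only [size, pos, Fin.val_succ, Fin.val_zero]
    omega
  cases hl : lups (List.ofFn b) with
  | nil => simp [hl] at hm
  | cons m' l' =>
    rw [hl] at hm
    rw [hl, h] at h1
    simp at hm h1
    subst hm
    exact ⟨l', by rw [h2], h1, by omega⟩

theorem size_succ (A : Fin N × Fin N) : size (A.1.succ, A.2.succ) = size A := by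
  simp [size, pos]

theorem two_mul_size {b : Fin N → Bool} {A : Fin N × Fin N} (hA : A ∈ arcs b) :
    2 * size A = A.2 - A.1 + 1 := by
  induction N with
  | zero => exact A.1.elim0
  | succ N ih =>
    obtain ⟨a, b, rfl⟩ := exists_bcons b
    obtain ⟨A, hA', rfl⟩ | ⟨-, u, l, hl, rfl⟩ := mem_arcs_cons.1 hA
    · rw [size_succ, ih hA']
      simp
    · obtain ⟨-, -, -, h⟩ := head_lups b hl
      rw [h]
      simp

end Geometry

end TypeBI

namespace TypeBI

/-! ### Indices of the objects of a diagram -/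

section Indices

variable {N : ℕ} (M : ℕ)

theorem mem_setU {b : Fin N → Bool} {i : Fin N} :
    i ∈ setU M b ↔ i ∈ downArrows b ∧ rank b i < M := by
  rw [setU, Finset.mem_filter, mem_setV, label]
  constructor
  · rintro ⟨⟨h1, h2⟩, h3⟩
    exact ⟨h1, by omega⟩
  · rintro ⟨h1, h2⟩
    exact ⟨⟨h1, by omega⟩, by omega⟩

theorem mem_labelled_one {b : Fin N → Bool} {i : Fin N} :
    i ∈ labelled M b 1 ↔ i ∈ downArrows b ∧ rank b i = M := by
  simp [labelled]

theorem setV_sdiff_setU (b : Fin N → Bool) : setV M b \ setU M b = labelled M b 1 := by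
  ext i
  rw [Finset.mem_sdiff, mem_setU, mem_setV, mem_labelled_one]
  constructor
  · rintro ⟨⟨h1, h2⟩, h3⟩
    exact ⟨h1, by by_contra h; exact h3 ⟨h1, by omega⟩⟩
  · rintro ⟨h1, h2⟩
    exact ⟨⟨h1, by omega⟩, by rintro ⟨-, h⟩; omega⟩

theorem mem_labelled_self (hM : 1 ≤ M) {b : Fin N → Bool} {i : Fin N} :
    i ∈ labelled M b M ↔ i ∈ downArrows b ∧ rank b i = 1 := by
  simp only [labelled, Finset.mem_filter]
  refine and_congr_right fun _ => ?_
  omega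

/-- The rank is a bijection from the unmatched down arrows to `1, …, k`. -/
theorem card_filter_rank (b : Fin N → Bool) (p : ℕ → Prop) [DecidablePred p] :
    ((downArrows b).filter fun d => p (rank b d)).card =
      ((Finset.Icc 1 (downArrows b).card).filter p).card := by
  rw [← Finset.card_image_of_injOn (f := rank b)]
  · congr 1
    ext j
    simp only [Finset.mem_image, Finset.mem_filter, Finset.mem_Icc]
    constructor
    · rintro ⟨d, ⟨hd, hp⟩, rfl⟩
      exact ⟨⟨rank_pos hd, rank_le_card b d⟩, hp⟩
    · rintro ⟨⟨h1, h2⟩, hp⟩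
      obtain ⟨d, hd, rfl⟩ := exists_rank b h1 h2
      exact ⟨d, ⟨hd, hp⟩, rfl⟩
  · intro i hi j hj h
    exact rank_inj (Finset.mem_filter.1 hi).1 (Finset.mem_filter.1 hj).1 h

theorem card_setV (b : Fin N → Bool) : (setV M b).card = min (downArrows b).card M := by
  rw [setV, card_filter_rank b fun j => j ≤ M,
    show (Finset.Icc 1 (downArrows b).card).filter (fun j => j ≤ M) =
      Finset.Icc 1 (min (downArrows b).card M) by ext j; simp; omega, Nat.card_Icc]
  omega

theorem card_setU (b : Fin N → Bool) : (setU M b).card = min (downArrows b).card (M - 1) := by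
  rw [show setU M b = (downArrows b).filter fun i => rank b i < M by ext i; simp [mem_setU],
    card_filter_rank b fun j => j < M,
    show (Finset.Icc 1 (downArrows b).card).filter (fun j => j < M) =
      Finset.Icc 1 (min (downArrows b).card (M - 1)) by ext j; simp; omega, Nat.card_Icc]
  omega

theorem n1_eq (b : Fin N → Bool) :
    n1 M b = if M < (downArrows b).card ∧ ((downArrows b).card - M) % 2 = 1 then 1 else 0 := by
  rw [n1]
  split_ifs with h
  · obtain ⟨j, hj⟩ := unpairedDown_nonempty M h.1 h.2
    rw [unpairedDown_eq_singleton M hj, Finset.card_singleton]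
  · rw [unpairedDown_eq_empty M h, Finset.card_empty]

theorem card_dashedArcs (b : Fin N → Bool) :
    (dashedArcs M b).card = ((downArrows b).card - M) / 2 := by
  induction N with
  | zero => simp [dashedArcs, downArrows]
  | succ N ih =>
    obtain ⟨a, b, rfl⟩ := exists_bcons b
    by_cases h : (a = false ∧ upsList b = []) ∧ (unpairedDown M b).Nonempty
    · have h' := (unpairedDown_nonempty_iff M).1 h.2
      obtain ⟨⟨rfl, hn⟩, j, hj⟩ := h
      rw [dashedArcs_false M b hn hj, Finset.card_insert_of_notMem (by simp [Fin.succ_ne_zero]),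
        Finset.card_map, ih, card_downArrows_cons, if_pos ⟨rfl, hn⟩]
      omega
    · rw [dashedArcs_cons M a b h, Finset.card_map, ih, card_downArrows_cons]
      rw [unpairedDown_nonempty_iff] at h
      split_ifs with hn
      · have : ¬ (M < (downArrows b).card ∧ ((downArrows b).card - M) % 2 = 1) :=
          fun h' => h ⟨hn, h'⟩
        omega
      · rfl

/-- The dashed arcs from `E` rightwards use up the ranks `M + 1, …, rank E.1` in pairs. -/
theorem card_dashedArcs_from {b : Fin N → Bool} {E : Fin N × Fin N} (hE : E ∈ dashedArcs M b) :
    2 * ((dashedArcs M b).filter fun C => E.1 ≤ C.1).card + M = rank b E.1 := by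
  induction N with
  | zero => exact E.1.elim0
  | succ N ih =>
    obtain ⟨a, b, rfl⟩ := exists_bcons b
    obtain ⟨i, j⟩ := E
    obtain rfl | ⟨j, rfl⟩ := j.eq_zero_or_eq_succ
    · exact absurd hE (zero_snd_notMem_dashedArcs M _ _)
    obtain rfl | ⟨i, rfl⟩ := i.eq_zero_or_eq_succ
    · have h := (mem_dashedArcs M).1 hE
      rw [rank_zero, Finset.filter_true_of_mem fun _ _ => Fin.zero_le _, card_dashedArcs]
      simp only [rank_zero] at h
      omega
    · rw [rank_succ, ← ih ((succ_mem_dashedArcs M a b i j).1 hE)]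
      congr 2
      rw [← Finset.card_map (succPair N)]
      congr 1
      ext ⟨i', j'⟩
      obtain rfl | ⟨j', rfl⟩ := j'.eq_zero_or_eq_succ
      · simp [zero_snd_notMem_dashedArcs, Fin.succ_ne_zero]
      obtain rfl | ⟨i', rfl⟩ := i'.eq_zero_or_eq_succ
      · simp [Fin.succ_ne_zero]
      · simp [succ_mem_dashedArcs]

theorem dashed_ext {b : Fin N → Bool} {E C : Fin N × Fin N} (hE : E ∈ dashedArcs M b)
    (hC : C ∈ dashedArcs M b) (h : E.1 = C.1) : E = C := by
  rw [mem_dashedArcs] at hE hC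
  refine Prod.ext h (rank_inj hE.2.1 hC.2.1 ?_)
  rw [h] at hE
  omega

theorem arc_fst_notMem_downArrows {b : Fin N → Bool} {A : Fin N × Fin N} (hA : A ∈ arcs b) :
    A.1 ∉ downArrows b := by
  intro h
  have := arcs_downs hA h
  have := arc_fst_lt_snd hA
  omega

theorem arc_fst_notMem_upArrows {b : Fin N → Bool} {A : Fin N × Fin N} (hA : A ∈ arcs b) :
    A.1 ∉ upArrows b := by
  intro h
  have := arcs_ups hA h
  have := arc_fst_lt_snd hA
  omega

theorem card_filter_image_fst {S : Finset (Fin N × Fin N)}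
    (hS : ∀ A ∈ S, ∀ C ∈ S, A.1 = C.1 → A = C) (p : Fin N → Prop) [DecidablePred p] :
    ((S.image Prod.fst).filter p).card = (S.filter fun A => p A.1).card := by
  rw [Finset.filter_image, Finset.card_image_of_injOn]
  intro A hA C hC h
  exact hS A (Finset.mem_filter.1 hA).1 C (Finset.mem_filter.1 hC).1 h

theorem dashed_fst_rank {b : Fin N → Bool} {E : Fin N × Fin N} (hE : E ∈ dashedArcs M b) :
    E.1 ∈ downArrows b ∧ M + 2 ≤ rank b E.1 ∧ (rank b E.1 - M) % 2 = 0 := by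
  rw [mem_dashedArcs] at hE
  exact ⟨hE.1, by omega, by omega⟩

theorem rightIndex_eq (b : Fin N → Bool) (x : Fin N) :
    rightIndex M b x = arcsFrom b x + ((dashedArcs M b).filter fun E => x ≤ E.1).card +
      ((setV M b).filter fun c => x ≤ c).card := by
  rw [rightIndex, rightEnum, Finset.filter_union, Finset.filter_union,
    Finset.card_union_of_disjoint, Finset.card_union_of_disjoint,
    card_filter_image_fst fun A hA C hC h => arc_ext hA hC h,
    card_filter_image_fst fun A hA C hC h => dashed_ext M hA hC h, arcsFrom]
  · refine Finset.disjoint_filter_filter (Finset.disjoint_left.2 fun i hi hj => ?_)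
    obtain ⟨A, hA, rfl⟩ := Finset.mem_image.1 hi
    obtain ⟨E, hE, h⟩ := Finset.mem_image.1 hj
    exact arc_fst_notMem_downArrows hA (h ▸ (dashed_fst_rank M hE).1)
  · rw [← Finset.filter_union]
    refine Finset.disjoint_filter_filter (Finset.disjoint_left.2 fun i hi hj => ?_)
    rw [mem_setV] at hj
    obtain hi | hi := Finset.mem_union.1 hi
    · obtain ⟨A, hA, rfl⟩ := Finset.mem_image.1 hi
      exact arc_fst_notMem_downArrows hA hj.1
    · obtain ⟨E, hE, rfl⟩ := Finset.mem_image.1 hi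
      have := dashed_fst_rank M hE
      omega

/-- No dashed arc starts to the right of a labelled arrow, and all unmatched down arrows there are
labelled. -/
theorem rightIndex_of_mem_setV {b : Fin N → Bool} {c : Fin N} (hc : c ∈ setV M b) :
    rightIndex M b c = arcsFrom b c + rank b c := by
  rw [mem_setV] at hc
  have h1 : ((dashedArcs M b).filter fun E => c ≤ E.1) = ∅ := by
    refine Finset.filter_eq_empty_iff.2 fun E hE h => ?_
    have h1 := dashed_fst_rank M hE
    have h2 := (lt_iff_rank_lt h1.1 hc.1).2 (by omega)
    omega
  have h2 : ((setV M b).filter fun x => c ≤ x) = (downArrows b).filter fun x => c ≤ x := by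
    ext x
    simp only [Finset.mem_filter, mem_setV]
    constructor
    · rintro ⟨⟨h1, -⟩, h2⟩
      exact ⟨h1, h2⟩
    · rintro ⟨h1, h2⟩
      have := lt_iff_rank_lt h1 hc.1
      exact ⟨⟨h1, by omega⟩, h2⟩
  rw [rightIndex_eq, h1, h2, rank, Finset.card_empty, add_zero]

/-- All `M` labelled arrows lie to the right, and the `rank - M` further down arrows form half as
many dashed arcs. Doubling avoids the division. -/
theorem rightIndex_of_mem_dashedArcs {b : Fin N → Bool} {E : Fin N × Fin N}
    (hE : E ∈ dashedArcs M b) :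
    2 * rightIndex M b E.1 = 2 * arcsFrom b E.1 + M + rank b E.1 := by
  have h1 := dashed_fst_rank M hE
  have h2 : ((setV M b).filter fun x => E.1 ≤ x) = setV M b := by
    refine Finset.filter_true_of_mem fun x hx => ?_
    rw [mem_setV] at hx
    exact ((lt_iff_rank_lt h1.1 hx.1).2 (by omega)).le
  have h3 := card_dashedArcs_from M hE
  have h4 := rank_le_card b E.1
  rw [rightIndex_eq, h2, card_setV]
  omega

theorem rightIndex_succ (a : Bool) (b : Fin N → Bool) (x : Fin N) :
    rightIndex M (bcons a b) x.succ = rightIndex M b x := by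
  rw [rightIndex_eq, rightIndex_eq, arcsFrom_succ]
  congr 1
  · congr 1
    rw [← Finset.card_map (succPair N)]
    congr 1
    ext ⟨i, j⟩
    obtain rfl | ⟨j, rfl⟩ := j.eq_zero_or_eq_succ
    · simp [zero_snd_notMem_dashedArcs, Fin.succ_ne_zero]
    obtain rfl | ⟨i, rfl⟩ := i.eq_zero_or_eq_succ
    · simp [Fin.succ_ne_zero]
    · simp [succ_mem_dashedArcs]
  · rw [← Finset.card_map (Fin.succEmb N)]
    congr 1
    ext i
    obtain rfl | ⟨i, rfl⟩ := i.eq_zero_or_eq_succ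
    · simp [Fin.succ_ne_zero]
    · simp [succ_mem_setV]

theorem setU_cons (a : Bool) (b : Fin N → Bool)
    (h : ¬ ((a = false ∧ upsList b = []) ∧ (downArrows b).card + 1 < M)) :
    setU M (bcons a b) = (setU M b).map (Fin.succEmb N) := by
  ext i
  obtain rfl | ⟨i, rfl⟩ := i.eq_zero_or_eq_succ
  · rw [mem_setU, zero_mem_downArrows, rank_zero, card_downArrows_cons]
    simp only [Finset.mem_map, Fin.coe_succEmb, Fin.succ_ne_zero, and_false, exists_false, iff_false]
    rintro ⟨h1, h2⟩
    rw [if_pos h1] at h2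
    exact h ⟨h1, h2⟩
  · rw [mem_setU, succ_mem_downArrows, rank_succ]
    simp [mem_setU]

theorem setU_false (b : Fin N → Bool) (h : upsList b = []) (hk : (downArrows b).card + 1 < M) :
    setU M (bcons false b) = insert 0 ((setU M b).map (Fin.succEmb N)) := by
  ext i
  obtain rfl | ⟨i, rfl⟩ := i.eq_zero_or_eq_succ
  · simp [mem_setU, zero_mem_downArrows, h, rank_zero, card_downArrows_cons, hk]
  · simp [mem_setU, succ_mem_downArrows, rank_succ, Fin.succ_ne_zero]

theorem star_cons (a : Bool) (b : Fin N → Bool)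
    (h : ¬ ((a = false ∧ upsList b = []) ∧ (downArrows b).card + 1 = M)) :
    labelled M (bcons a b) 1 = (labelled M b 1).map (Fin.succEmb N) := by
  ext i
  obtain rfl | ⟨i, rfl⟩ := i.eq_zero_or_eq_succ
  · rw [mem_labelled_one, zero_mem_downArrows, rank_zero, card_downArrows_cons]
    simp only [Finset.mem_map, Fin.coe_succEmb, Fin.succ_ne_zero, and_false, exists_false, iff_false]
    rintro ⟨h1, h2⟩
    rw [if_pos h1] at h2
    exact h ⟨h1, h2⟩
  · rw [mem_labelled_one, succ_mem_downArrows, rank_succ]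
    simp only [Finset.mem_map, mem_labelled_one, Fin.coe_succEmb, Fin.succ_inj, exists_eq_right]

theorem star_false (b : Fin N → Bool) (h : upsList b = []) (hk : (downArrows b).card + 1 = M) :
    labelled M (bcons false b) 1 = insert 0 ((labelled M b 1).map (Fin.succEmb N)) := by
  ext i
  obtain rfl | ⟨i, rfl⟩ := i.eq_zero_or_eq_succ
  · rw [mem_labelled_one, zero_mem_downArrows, rank_zero, card_downArrows_cons]
    simp [h, hk]
  · rw [mem_labelled_one, succ_mem_downArrows, rank_succ, Finset.mem_insert]
    simp only [Finset.mem_map, mem_labelled_one, Fin.coe_succEmb, Fin.succ_inj, exists_eq_right,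
      Fin.succ_ne_zero, false_or]

end Indices

/-! ### The hook lengths of a diagram. -/

section Products

variable {N : ℕ} (M : ℕ) {K : Type*} [Field K] {q : K}

/-- Each object contributes at the step where its left end is prepended, when all objects to its
right are already present. Doubled right indices occur for the star and the dashed arcs because the
sums `q^R + q^{-R}` are included. -/
theorem lacc_ofFn (b : Fin N → Bool) :
    lacc M q (List.ofFn b) = (∏ A ∈ arcs b, qint q (size A)) *
      ((∏ C ∈ setU M b, qint q (rightIndex M b C)) *
        ((∏ C ∈ labelled M b 1, qint q (2 * rightIndex M b C)) *
          ∏ E ∈ dashedArcs M b, qint q (2 * rightIndex M b E.1))) := by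
  induction N with
  | zero => simp [lacc, arcs, setU, setV, labelled, downArrows, dashedArcs]
  | succ N ih =>
    obtain ⟨a, b, rfl⟩ := exists_bcons b
    have hR : ∀ x, rightIndex M (bcons a b) (Fin.succEmb N x) = rightIndex M b x :=
      rightIndex_succ M a b
    have hE : ∀ E, rightIndex M (bcons a b) (succPair N E).1 = rightIndex M b E.1 :=
      fun E => rightIndex_succ M a b E.1
    have hS : ∀ A : Fin N × Fin N, size (succPair N A) = size A := size_succ
    rw [ofFn_cons]
    cases a with
    | true =>
      rw [lacc, ih b, arcs_true, setU_cons M true b (by simp), star_cons M true b (by simp),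
        dashedArcs_cons M true b (by simp)]
      simp only [Finset.prod_map, hR, hE, hS]
    | false =>
      cases hu : upsList b with
      | cons u l =>
        obtain ⟨l', hl', -, -⟩ := head_lups b hu
        rw [lacc, hl']
        simp only
        rw [ih b, arcs_false b hu, setU_cons M false b (by simp [hu]),
          star_cons M false b (by simp [hu]), dashedArcs_cons M false b (by simp [hu]),
          Finset.prod_insert (by simp [Fin.succ_ne_zero])]
        simp only [Finset.prod_map, hR, hE, hS]
        ring
      | nil =>
        have hc : (arcs (bcons false b)).card = (arcs b).card := by
          rw [arcs_false_nil b hu, Finset.card_map]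
        have hk : (downArrows (bcons false b)).card = (downArrows b).card + 1 := by
          rw [card_downArrows_cons, if_pos ⟨rfl, hu⟩]
        rw [lacc, (lups_eq_nil b).2 hu]
        simp only [ldn_ofFn, lna_ofFn]
        rw [ih b, arcs_false_nil b hu]
        split_ifs with h1 h2
        · have h0 : (0 : Fin (N + 1)) ∈ setV M (bcons false b) := by
            rw [zero_mem_setV]
            exact ⟨⟨rfl, hu⟩, h1.le⟩
          rw [setU_false M b hu h1, star_cons M false b (by omega),
            dashedArcs_cons M false b (by rw [unpairedDown_nonempty_iff]; omega),
            Finset.prod_insert (by simp [Fin.succ_ne_zero]), rightIndex_of_mem_setV M h0,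
            rank_zero, arcsFrom_zero, hc, hk]
          simp only [Finset.prod_map, hR, hE, hS]
          rw [add_comm (arcs b).card]
          ring
        · obtain ⟨h2, h3⟩ := h2
          rw [setU_cons M false b (by omega)]
          by_cases h4 : (downArrows b).card + 1 = M
          · have h0 : (0 : Fin (N + 1)) ∈ setV M (bcons false b) := by
              rw [zero_mem_setV]
              exact ⟨⟨rfl, hu⟩, h4.le⟩
            rw [star_false M b hu h4,
              dashedArcs_cons M false b (by rw [unpairedDown_nonempty_iff]; omega),
              Finset.prod_insert (by simp [Fin.succ_ne_zero]), rightIndex_of_mem_setV M h0,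
              rank_zero, arcsFrom_zero, hc, hk]
            simp only [Finset.prod_map, hR, hE, hS]
            rw [show 2 * ((arcs b).card + ((downArrows b).card + 1)) =
              (downArrows b).card + 1 + M + 2 * (arcs b).card by omega]
            ring
          · obtain ⟨j, hj⟩ := unpairedDown_nonempty M (b := b) (by omega) (by omega)
            have h0 : ((0 : Fin (N + 1)), j.succ) ∈ dashedArcs M (bcons false b) := by
              rw [zero_fst_mem_dashedArcs]
              exact ⟨⟨rfl, hu⟩, hj⟩
            have h5 := rightIndex_of_mem_dashedArcs M h0
            simp only [rank_zero, arcsFrom_zero, hc, hk] at h5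
            rw [star_cons M false b (by omega), dashedArcs_false M b hu hj,
              Finset.prod_insert (by simp [Fin.succ_ne_zero])]
            simp only [Finset.prod_map, hR, hE, hS]
            rw [h5, show 2 * (arcs b).card + M + ((downArrows b).card + 1) =
              (downArrows b).card + 1 + M + 2 * (arcs b).card by omega]
            ring
        · have h4 : ¬ (M < (downArrows b).card ∧ ((downArrows b).card - M) % 2 = 1) :=
            fun h => h2 ⟨by omega, by omega⟩
          have h5 : (downArrows b).card + 1 ≠ M := fun h => h2 ⟨by omega, by omega⟩
          rw [setU_cons M false b (by omega), star_cons M false b (fun h => h5 h.2),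
            dashedArcs_cons M false b (by rw [unpairedDown_nonempty_iff]; exact fun h => h4 h.2)]
          simp only [Finset.prod_map, hR, hE, hS]

end Products

end TypeBI

namespace TypeBI

/-! ### The sets of arcs described by levels. -/

section Sets

variable {N : ℕ} (M : ℕ)

theorem mem_setSR (hM : 1 ≤ M) {b : Fin N → Bool} {A : Fin N × Fin N} :
    A ∈ setSR M b ↔ A ∈ arcs b ∧ level b A = 0 ∧ 1 ≤ (downArrows b).card := by
  rw [setSR, Finset.mem_filter]
  refine and_congr_right fun hA => ?_
  simp only [mem_labelled_self M hM]
  constructor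
  · rintro ⟨c, ⟨hc, hr⟩, h⟩
    rw [lt_fst_iff_level_lt hA hc] at h
    have := rank_le_card b c
    omega
  · rintro ⟨h1, h2⟩
    obtain ⟨c, hc, hr⟩ := exists_rank b one_pos h2
    exact ⟨c, ⟨hc, hr⟩, (lt_fst_iff_level_lt hA hc).2 (by omega)⟩

theorem mem_setSW' (hM : 1 ≤ M) {b : Fin N → Bool} {A : Fin N × Fin N} :
    A ∈ setSW' M b ↔ A ∈ arcs b ∧ 1 ≤ level b A ∧ level b A < M ∧ M ≤ (downArrows b).card := by
  rw [setSW', Finset.mem_filter]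
  refine and_congr_right fun hA => ?_
  simp only [mem_labelled_self M hM, mem_labelled_one]
  constructor
  · rintro ⟨⟨c, ⟨hc, hr⟩, h⟩, ⟨d, ⟨hd, hs⟩, h'⟩⟩
    rw [lt_fst_iff_level_lt hA hc] at h
    rw [snd_lt_iff_le_level hA hd] at h'
    have := rank_le_card b c
    omega
  · rintro ⟨h1, h2, h3⟩
    obtain ⟨c, hc, hr⟩ := exists_rank b hM h3
    obtain ⟨d, hd, hs⟩ := exists_rank b one_pos (hM.trans h3)
    exact ⟨⟨c, ⟨hc, hr⟩, (lt_fst_iff_level_lt hA hc).2 (by omega)⟩,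
      ⟨d, ⟨hd, hs⟩, (snd_lt_iff_le_level hA hd).2 (by omega)⟩⟩

theorem exists_leftmost_dashedArc {b : Fin N → Bool} (h1 : M < (downArrows b).card)
    (h2 : ((downArrows b).card - M) % 2 = 0) :
    ∃ E ∈ dashedArcs M b, rank b E.1 = (downArrows b).card := by
  obtain ⟨i, hi, hr⟩ := exists_rank b (j := (downArrows b).card) (by omega) le_rfl
  obtain ⟨j, hj, hs⟩ := exists_rank b (j := (downArrows b).card - 1) (by omega) (by omega)
  exact ⟨(i, j), (mem_dashedArcs M).2 ⟨hi, hj, by simp only; omega, by simp only; omega,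
    by simp only; omega⟩, hr⟩

/-- Both forms of the left bound refer to the leftmost unmatched down arrow, which is either
unpaired or the start of a dashed arc; lying to its right means that the level is not maximal. -/
theorem mem_setSW (hM : 1 ≤ M) {b : Fin N → Bool} {A : Fin N × Fin N} :
    A ∈ setSW M b ↔ A ∈ arcs b ∧ M ≤ level b A ∧ level b A < (downArrows b).card := by
  rw [setSW, Finset.mem_filter]
  refine and_congr_right fun hA => ?_
  have hstar : (∃ c ∈ labelled M b 1, A.2 < c) ↔ M ≤ level b A := by
    simp only [mem_labelled_one]
    constructor
    · rintro ⟨c, ⟨hc, hr⟩, h⟩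
      rwa [snd_lt_iff_le_level hA hc, hr] at h
    · intro h
      obtain ⟨c, hc, hr⟩ := exists_rank b hM (h.trans (level_le b A))
      exact ⟨c, ⟨hc, hr⟩, (snd_lt_iff_le_level hA hc).2 (by omega)⟩
  rw [hstar]
  refine and_congr_right fun hl => ?_
  have h0 := level_le b A
  constructor
  · rintro (⟨d, hd, h⟩ | ⟨-, E, hE, h⟩)
    · rw [mem_unpairedDown] at hd
      rw [lt_fst_iff_level_lt hA hd.1] at h
      omega
    · rw [mem_dashedArcs] at hE
      rw [lt_fst_iff_level_lt hA hE.1] at h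
      have := rank_le_card b E.1
      omega
  · intro h
    by_cases hu : M < (downArrows b).card ∧ ((downArrows b).card - M) % 2 = 1
    · obtain ⟨d, hd⟩ := unpairedDown_nonempty M hu.1 hu.2
      refine .inl ⟨d, hd, ?_⟩
      rw [mem_unpairedDown] at hd
      exact (lt_fst_iff_level_lt hA hd.1).2 (by omega)
    · refine .inr ⟨unpairedDown_eq_empty M hu, ?_⟩
      obtain ⟨E, hE, hr⟩ := exists_leftmost_dashedArc M (b := b) (by omega) (by omega)
      exact ⟨E, hE, (lt_fst_iff_level_lt hA (dashed_fst_rank M hE).1).2 (by omega)⟩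

theorem mem_setSL (hM : 1 ≤ M) {b : Fin N → Bool} {A : Fin N × Fin N} :
    A ∈ setSL M b ↔ A ∈ arcs b ∧ M ≤ (downArrows b).card ∧ level b A = (downArrows b).card ∧
      ∀ u ∈ upArrows b, u < A.1 := by
  rw [setSL, Finset.mem_filter]
  refine and_congr_right fun hA => ?_
  rw [← and_assoc, ← and_assoc]
  refine and_congr_left fun _ => ?_
  constructor
  · rintro ⟨⟨c, hc⟩, h⟩
    rw [mem_labelled_one] at hc
    have := rank_le_card b c
    refine ⟨by omega, ?_⟩
    obtain ⟨d, hd, hr⟩ := exists_rank b (j := (downArrows b).card) (by omega) le_rfl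
    have h1 := (snd_lt_iff_le_level hA hd).1 (h d hd)
    have h2 := level_le b A
    omega
  · rintro ⟨h1, h2⟩
    obtain ⟨c, hc, hr⟩ := exists_rank b hM h1
    refine ⟨⟨c, (mem_labelled_one M).2 ⟨hc, hr⟩⟩, fun d hd => ?_⟩
    rw [snd_lt_iff_le_level hA hd, h2]
    exact rank_le_card b d

theorem up_lt_of_level_lt {b : Fin N → Bool} {A : Fin N × Fin N} (hA : A ∈ arcs b)
    (h : level b A < (downArrows b).card) {u : Fin N} (hu : u ∈ upArrows b) : u < A.1 := by
  obtain ⟨d, hd, hr⟩ := exists_rank b (j := (downArrows b).card) (by omega) le_rfl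
  exact (ups_lt_downs hu hd).trans ((lt_fst_iff_level_lt hA hd).2 (by omega))

/-- The number of arcs to the right of all arrows that are in no arc. -/
def tailCount (b : Fin N → Bool) : ℕ :=
  ((arcs b).filter fun A => level b A = 0 ∧ ∀ u ∈ upArrows b, u < A.1).card

theorem card_setSR (hM : 1 ≤ M) {b : Fin N → Bool} (hk : 1 ≤ (downArrows b).card) :
    (setSR M b).card = tailCount b := by
  rw [tailCount]
  congr 1
  ext A
  rw [mem_setSR M hM, Finset.mem_filter]
  refine and_congr_right fun hA => ?_
  constructor
  · rintro ⟨h1, -⟩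
    exact ⟨h1, fun u hu => up_lt_of_level_lt hA (by omega) hu⟩
  · rintro ⟨h1, -⟩
    exact ⟨h1, hk⟩

/-- An arc is inside a dashed arc if and only if an odd number of unlabelled down arrows in no arc
are to its right and another one to its left. -/
theorem exists_dashedArc_iff {b : Fin N → Bool} {A : Fin N × Fin N} (hA : A ∈ arcs b) :
    (∃ E ∈ dashedArcs M b, E.1 < A.1 ∧ A.2 < E.2) ↔
      M < level b A ∧ (level b A - M) % 2 = 1 ∧ level b A < (downArrows b).card := by
  constructor
  · rintro ⟨E, hE, h1, h2⟩
    rw [mem_dashedArcs] at hE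
    rw [lt_fst_iff_level_lt hA hE.1] at h1
    rw [snd_lt_iff_le_level hA hE.2.1] at h2
    have := rank_le_card b E.1
    have : level b A = rank b E.2 := by omega
    rw [this]
    exact ⟨hE.2.2.1, hE.2.2.2.1, by omega⟩
  · rintro ⟨h1, h2, h3⟩
    obtain ⟨i, hi, hr⟩ := exists_rank b (j := level b A + 1) (by omega) (by omega)
    obtain ⟨j, hj, hs⟩ := exists_rank b (j := level b A) (by omega) (by omega)
    refine ⟨(i, j), (mem_dashedArcs M).2 ⟨hi, hj, by simp only; omega, by simp only; omega,
      by simp only; omega⟩, ?_, ?_⟩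
    · exact (lt_fst_iff_level_lt hA hi).2 (by omega)
    · exact (snd_lt_iff_le_level hA hj).2 (by omega)

theorem mem_outerArcs {b : Fin N → Bool} {A : Fin N × Fin N} :
    A ∈ outerArcs M b ↔ A ∈ arcs b ∧ (∀ C ∈ arcs b, ¬ (C.1 < A.1 ∧ A.2 < C.2)) ∧
      ¬ (M < level b A ∧ (level b A - M) % 2 = 1 ∧ level b A < (downArrows b).card) := by
  rw [outerArcs, Finset.mem_filter]
  refine and_congr_right fun hA => ?_
  rw [← exists_dashedArc_iff M hA]
  simp only [Finset.mem_union]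
  constructor
  · intro h
    exact ⟨fun C hC => h C (.inl hC), fun ⟨E, hE, hE'⟩ => h E (.inr hE) hE'⟩
  · rintro ⟨h1, h2⟩ C (hC | hC)
    · exact h1 C hC
    · exact fun h => h2 ⟨C, hC, h⟩

theorem setSR_inter_outerArcs (hM : 1 ≤ M) {b : Fin N → Bool} (hk : 1 ≤ (downArrows b).card) :
    setSR M b ∩ outerArcs M b = (freeArcs b).filter fun A => level b A = 0 := by
  ext A
  rw [Finset.mem_inter, mem_setSR M hM, mem_outerArcs, Finset.mem_filter, freeArcs,
    Finset.mem_filter]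
  constructor
  · rintro ⟨⟨h1, h2, -⟩, -, h3, -⟩
    exact ⟨⟨h1, h3, fun u hu => up_lt_of_level_lt h1 (by omega) hu⟩, h2⟩
  · rintro ⟨⟨h1, h2, -⟩, h3⟩
    exact ⟨⟨h1, h3, hk⟩, h1, h2, by omega⟩

/-- An arc of `S_W` lies inside a dashed arc exactly if its level exceeds `M` by an odd number. For
arcs of `S_L` the level is the number of all unmatched down arrows, and its parity decides between
the cases `N₁ = 0` and `N₁ = 1`. So both cases select the free arcs of even-full level. -/
theorem f9_index (hM : 1 ≤ M) (b : Fin N → Bool) :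
    (if n1 M b = 1 then setSW M b ∩ outerArcs M b
      else (setSW M b ∩ outerArcs M b) ∪ (setSL M b ∩ outerArcs M b)) =
      (freeArcs b).filter fun A => EvenFull M (level b A) := by
  ext A
  have h0 := level_le b A
  have hup : ∀ hA : A ∈ arcs b, level b A < (downArrows b).card → ∀ u ∈ upArrows b, u < A.1 :=
    fun hA h u hu => up_lt_of_level_lt hA h hu
  rw [n1_eq, Finset.mem_filter, freeArcs, Finset.mem_filter, EvenFull]
  by_cases hA : A ∈ arcs b
  · split_ifs with h1 h2 h2
    · rw [Finset.mem_inter, mem_setSW M hM, mem_outerArcs]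
      simp only [hA, true_and]
      constructor
      · rintro ⟨⟨h3, h4⟩, h5, h6⟩
        exact ⟨⟨h5, hup hA h4⟩, h3, by omega⟩
      · rintro ⟨⟨h3, -⟩, h4, h5⟩
        exact ⟨⟨h4, by omega⟩, h3, by omega⟩
    · simp at h2
    · simp at h2
    · rw [Finset.mem_union, Finset.mem_inter, Finset.mem_inter, mem_setSW M hM, mem_setSL M hM,
        mem_outerArcs]
      simp only [hA, true_and]
      constructor
      · rintro (⟨⟨h3, h4⟩, h5, h6⟩ | ⟨⟨h3, h4, h5⟩, h6, h7⟩)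
        · exact ⟨⟨h5, hup hA h4⟩, h3, by omega⟩
        · exact ⟨⟨h6, h5⟩, by omega, by omega⟩
      · rintro ⟨⟨h3, h3'⟩, h4, h5⟩
        by_cases h6 : level b A < (downArrows b).card
        · exact .inl ⟨⟨h4, h6⟩, h3, by omega⟩
        · exact .inr ⟨⟨by omega, by omega, h3'⟩, h3, by omega⟩
  · split_ifs <;> simp [mem_outerArcs, hA]

/-- With `k` unmatched down arrows, the four sets are the ranges `k`, `[M, k)`, `[1, M)` and `0` of
the level; an arc of level below `k` is automatically to the right of the unmatched up arrows. -/
theorem card_arcs_right_of_ups (hM : 1 ≤ M) {b : Fin N → Bool} (hk : M ≤ (downArrows b).card) :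
    (setSL M b).card + (setSW M b).card + (setSW' M b).card + (setSR M b).card =
      ((arcs b).filter fun A => ∀ u ∈ upArrows b, u < A.1).card := by
  rw [← Finset.card_union_of_disjoint, ← Finset.card_union_of_disjoint,
    ← Finset.card_union_of_disjoint]
  · congr 1
    ext A
    simp only [Finset.mem_union, mem_setSL M hM, mem_setSW M hM, mem_setSW' M hM, mem_setSR M hM,
      Finset.mem_filter]
    have h0 := level_le b A
    by_cases hA : A ∈ arcs b
    · have hup : level b A < (downArrows b).card → ∀ u ∈ upArrows b, u < A.1 :=
        fun h u hu => up_lt_of_level_lt hA h hu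
      simp only [hA, true_and]
      constructor
      · rintro (((⟨-, -, h⟩ | ⟨-, h⟩) | ⟨h1, h2, -⟩) | ⟨h1, -⟩)
        · exact h
        · exact hup h
        · exact hup (by omega)
        · exact hup (by omega)
      · intro h
        by_cases h1 : level b A = (downArrows b).card
        · exact .inl (.inl (.inl ⟨hk, h1, h⟩))
        · by_cases h2 : M ≤ level b A
          · exact .inl (.inl (.inr ⟨h2, by omega⟩))
          · by_cases h3 : level b A = 0
            · exact .inr ⟨h3, by omega⟩
            · exact .inl (.inr ⟨by omega, by omega, hk⟩)
    · simp [hA]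
  all_goals
    refine Finset.disjoint_left.2 fun A h1 h2 => ?_
    simp only [Finset.mem_union, mem_setSL M hM, mem_setSW M hM, mem_setSW' M hM, mem_setSR M hM]
      at h1 h2
    omega

theorem card_arcs_right_of_leftmost (hM : 1 ≤ M) {b : Fin N → Bool} {x : Fin N}
    (hx : x ∈ downArrows b) (hr : rank b x = (downArrows b).card) (hk : M ≤ (downArrows b).card) :
    (setSW' M b).card + (setSW M b).card + (setSR M b).card = arcsFrom b x := by
  rw [arcsFrom_eq hx, hr, ← Finset.card_union_of_disjoint, ← Finset.card_union_of_disjoint]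
  · congr 1
    ext A
    simp only [Finset.mem_union, mem_setSW M hM, mem_setSW' M hM, mem_setSR M hM,
      Finset.mem_filter]
    by_cases hA : A ∈ arcs b
    · simp only [hA, true_and]
      omega
    · simp [hA]
  all_goals
    refine Finset.disjoint_left.2 fun A h1 h2 => ?_
    simp only [Finset.mem_union, mem_setSW M hM, mem_setSW' M hM, mem_setSR M hM] at h1 h2
    omega

theorem tailCount_le_arcsFrom {b : Fin N → Bool} {d : Fin N} (hd : d ∈ downArrows b) :
    tailCount b ≤ arcsFrom b d := by
  rw [arcsFrom_eq hd]
  refine Finset.card_le_card fun A hA => ?_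
  rw [Finset.mem_filter] at hA ⊢
  have := rank_pos hd
  exact ⟨hA.1, by omega⟩

theorem arcsFrom_of_rank_eq_one {b : Fin N → Bool} {d : Fin N} (hd : d ∈ downArrows b)
    (h : rank b d = 1) : arcsFrom b d = tailCount b := by
  rw [arcsFrom_eq hd, tailCount]
  congr 1
  refine Finset.filter_congr fun A hA => ?_
  have := rank_le_card b d
  rw [h]
  constructor
  · intro h'
    exact ⟨by omega, fun u hu => up_lt_of_level_lt hA (by omega) hu⟩
  · rintro ⟨h', -⟩
    omega

end Sets

/-! ### Telescoping products over outer arcs. -/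

section Telescoping

variable {N : ℕ} {K : Type*} [Field K]

theorem filter_map_succPair (a : Bool) (b : Fin N → Bool) (S : Finset (Fin N × Fin N))
    (p : ℕ → Prop) [DecidablePred p] :
    ((S.map (succPair N)).filter fun A => p (level (bcons a b) A)) =
      (S.filter fun A => p (level b A)).map (succPair N) := by
  rw [Finset.filter_map]
  congr 1
  refine Finset.filter_congr fun A _ => ?_
  have : level (bcons a b) (succPair N A) = level b A := level_succ a b A
  rw [Function.comp_apply, this]

theorem tailCount_cons (a : Bool) (b : Fin N → Bool)
    (h : ¬ (a = false ∧ (upsList b).length = 1 ∧ (downArrows b).card = 0)) :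
    tailCount (bcons a b) = tailCount b := by
  rw [tailCount, tailCount, ← Finset.card_map (succPair N)]
  congr 1
  ext A
  rw [Finset.mem_filter, mem_arcs_cons, Finset.mem_map]
  constructor
  · rintro ⟨⟨A, hA, rfl⟩ | ⟨rfl, u, l, hl, rfl⟩, h1, h2⟩
    · rw [level_succ] at h1
      refine ⟨A, Finset.mem_filter.2 ⟨hA, h1, fun u hu => ?_⟩, rfl⟩
      by_cases hk : (downArrows b).card = 0
      · cases a with
        | true => simpa using h2 _ (mem_upArrows_cons.2 (.inl ⟨rfl, .inr ⟨u, hu, rfl⟩⟩))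
        | false =>
          rcases hl : upsList b with _ | ⟨v, _ | ⟨w, l⟩⟩
          · rw [← mem_upsList, hl] at hu
            simp at hu
          · simp [hl, hk] at h
          · have h3 : w < A.1 := by
              simpa using h2 _ (mem_upArrows_cons.2 (.inr ⟨rfl, v, _, hl, w, by simp, rfl⟩))
            rw [← mem_upsList, hl] at hu
            obtain rfl | hu := List.mem_cons.1 hu
            · exact (head_lt_of_mem_tail hl (by simp)).trans h3
            · simpa using h2 _ (mem_upArrows_cons.2 (.inr ⟨rfl, v, _, hl, u, hu, rfl⟩))
      · exact up_lt_of_level_lt hA (by omega) hu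
    · rw [level_zero b hl] at h1
      refine absurd ⟨rfl, ?_, h1⟩ h
      cases l with
      | nil => simp [hl]
      | cons v l =>
        simpa using h2 _ (mem_upArrows_cons.2 (.inr ⟨rfl, u, _, hl, v, by simp, rfl⟩))
  · rintro ⟨A, hA, rfl⟩
    obtain ⟨h1, h2, h3⟩ := Finset.mem_filter.1 hA
    refine ⟨.inl ⟨A, h1, rfl⟩, (level_succ a b A).trans h2, fun u hu => ?_⟩
    obtain ⟨-, rfl | ⟨u, hu', rfl⟩⟩ | ⟨-, v, l, hl, u, hu', rfl⟩ := mem_upArrows_cons.1 hu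
    · exact Fin.succ_pos _
    · exact Fin.succ_lt_succ_iff.2 (h3 u hu')
    · exact Fin.succ_lt_succ_iff.2 (h3 u ((mem_upsList _ _).1 (by rw [hl]; simp [hu'])))

/-- Once the last unmatched arrow becomes part of an arc, every arc counts. Before that only the
arcs after `u` did; the others lie inside the new arc and, together with it, are counted by its
size. -/
theorem tailCount_singleton (b : Fin N → Bool) {u : Fin N} (hl : upsList b = [u])
    (hk : (downArrows b).card = 0) :
    tailCount (bcons false b) = (arcs b).card + 1 ∧
      tailCount b + size ((0 : Fin (N + 1)), u.succ) = (arcs b).card + 1 := by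
  have hups : upArrows b = {u} := by rw [← toFinset_upsList, hl]; rfl
  have hd : downArrows b = ∅ := Finset.card_eq_zero.1 hk
  constructor
  · have h1 : downArrows (bcons false b) = ∅ := by
      rw [← Finset.card_eq_zero, card_downArrows_cons, if_neg (by simp [hl]), hk]
    have h2 : upArrows (bcons false b) = ∅ := by
      rw [upArrows_false b hl, hups, Finset.erase_singleton, Finset.map_empty]
    rw [tailCount, Finset.filter_true_of_mem, arcs_false b hl,
      Finset.card_insert_of_notMem (by simp [Fin.succ_ne_zero]), Finset.card_map]
    simp [level, h1, h2]
  · obtain ⟨-, -, -, h1⟩ := head_lups b hl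
    have h2 := add_arcsFrom_of_up (b := b) (u := u) (by simp [hups])
    have h3 : tailCount b = arcsFrom b u := by
      rw [tailCount, arcsFrom]
      congr 1
      refine Finset.filter_congr fun A hA => ?_
      simp only [level, hd, hups, Finset.filter_empty, Finset.card_empty, true_and,
        Finset.mem_singleton, forall_eq]
      refine ⟨le_of_lt, fun h => lt_of_le_of_ne h ?_⟩
      rintro rfl
      exact arc_fst_notMem_upArrows hA (by simp [hups])
    have h4 := two_mul_card_arcs b
    rw [hups, Finset.filter_singleton, if_pos le_rfl, Finset.card_singleton] at h2
    rw [hups, Finset.card_singleton] at h4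
    omega

/-- The outer arcs to the right of all unmatched arrows stand side by side, and removing an arc with
its contents leaves `arcsFrom - size` arcs, the value of `arcsFrom` at the next outer arc. So
consecutive factors cancel. -/
theorem prod_freeArcs (b : Fin N → Bool) (g : ℕ → K) (hg : ∀ i ≤ tailCount b, g i ≠ 0) :
    ∏ A ∈ (freeArcs b).filter (fun A => level b A = 0),
      g (arcsFrom b A.1) / g (arcsFrom b A.1 - size A) = g (tailCount b) / g 0 := by
  induction N with
  | zero =>
    have h : arcs b = ∅ := by simp [arcs]
    rw [freeArcs, tailCount, h]
    simp only [Finset.filter_empty, Finset.prod_empty, Finset.card_empty]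
    rw [div_self (hg 0 (Nat.zero_le _))]
  | succ N ih =>
    obtain ⟨a, b, rfl⟩ := exists_bcons b
    have h1 : ∀ A, arcsFrom (bcons a b) (succPair N A).1 = arcsFrom b A.1 :=
      fun A => arcsFrom_succ a b A.1
    have h2 : ∀ A : Fin N × Fin N, size (succPair N A) = size A := size_succ
    by_cases h : a = false ∧ (upsList b).length = 1
    · obtain ⟨rfl, hlen⟩ := h
      obtain ⟨u, hl⟩ := List.length_eq_one_iff.1 hlen
      rw [freeArcs_false_singleton b hl, Finset.filter_insert, level_zero b hl,
        filter_map_succPair false b _ fun i => i = 0]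
      split_ifs with hk
      · obtain ⟨h3, h4⟩ := tailCount_singleton b hl hk
        rw [Finset.prod_insert (by simp [Fin.succ_ne_zero]), Finset.prod_map]
        simp only [h1, h2]
        rw [ih b fun i hi => hg i (by omega), h3, arcsFrom_zero, arcs_false b hl,
          Finset.card_insert_of_notMem (by simp [Fin.succ_ne_zero]), Finset.card_map,
          show (arcs b).card + 1 - size ((0 : Fin (N + 1)), u.succ) = tailCount b by omega,
          div_mul_div_cancel₀ (hg _ (by omega))]
      · rw [tailCount_cons false b (by simp [hk])] at hg ⊢
        rw [Finset.prod_map]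
        simp only [h1, h2]
        exact ih b hg
    · have h3 : freeArcs (bcons a b) = (freeArcs b).map (succPair N) := by
        cases a with
        | true => exact freeArcs_true b
        | false =>
          rcases hl : upsList b with _ | ⟨v, _ | ⟨w, l⟩⟩
          · exact freeArcs_false_nil b hl
          · simp [hl] at h
          · exact freeArcs_false_cons b hl
      rw [tailCount_cons a b (by tauto)] at hg ⊢
      rw [h3, filter_map_succPair a b _ fun i => i = 0, Finset.prod_map]
      simp only [h1, h2]
      exact ih b hg

theorem size_le_arcsFrom {b : Fin N → Bool} {A : Fin N × Fin N} (hA : A ∈ freeArcs b)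
    (h : level b A = 0) : size A ≤ arcsFrom b A.1 := by
  have h1 := add_arcsFrom_of_free hA
  have h2 := two_mul_size (freeArcs_subset b hA)
  have h3 := arc_fst_lt_snd (freeArcs_subset b hA)
  have h4 := A.2.isLt
  omega

theorem lf9_ofFn (M : ℕ) (q : K) (b : Fin N → Bool) :
    lf9 M q (List.ofFn b) = ∏ A ∈ (freeArcs b).filter (fun A => EvenFull M (level b A)),
      qint q (d3 A + size A + M) / qint q (d3 A + 2 * size A + M) := by
  induction N with
  | zero => simp [lf9, freeArcs, arcs]
  | succ N ih =>
    obtain ⟨a, b, rfl⟩ := exists_bcons b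
    have h2 : ∀ A : Fin N × Fin N, size (succPair N A) = size A := size_succ
    have h3 : ∀ A : Fin N × Fin N, d3 (succPair N A) = d3 A := fun A => by
      simp [d3, pos]
    rw [ofFn_cons]
    cases a with
    | true =>
      rw [lf9, ih b, freeArcs_true, filter_map_succPair true b _ fun i => EvenFull M i,
        Finset.prod_map]
      simp only [h2, h3]
    | false =>
      rw [lf9, ih b]
      cases hl : upsList b with
      | nil =>
        rw [(lups_eq_nil b).2 hl, freeArcs_false_nil b hl,
          filter_map_succPair false b _ fun i => EvenFull M i, Finset.prod_map]
        simp only [h2, h3]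
      | cons u l =>
        obtain ⟨l', hl', hlen, hs⟩ := head_lups b hl
        rw [hl']
        cases l with
        | cons v l =>
          obtain ⟨v', l'', rfl⟩ := List.exists_cons_of_length_pos (l := l') (by simp [hlen])
          rw [freeArcs_false_cons b hl,
            filter_map_succPair false b _ fun i => EvenFull M i, Finset.prod_map]
          simp only [h2, h3]
        | nil =>
          obtain rfl := List.length_eq_zero_iff.1 hlen
          simp only
          rw [freeArcs_false_singleton b hl, Finset.filter_insert, level_zero b hl,
            filter_map_succPair false b _ fun i => EvenFull M i, ldn_ofFn, List.length_ofFn]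
          split_ifs with h
          · rw [Finset.prod_insert (by simp [Fin.succ_ne_zero]), Finset.prod_map]
            simp only [h2, h3]
            -- For the arc that starts at the first letter, `d₃` plus twice the size is the whole
            -- length, the number used by the recursion for `lf9`.
            have h4 : d3 ((0 : Fin (N + 1)), u.succ) + 2 * size ((0 : Fin (N + 1)), u.succ) =
                N + 1 := by
              have := u.isLt
              simp only [d3, pos, Fin.val_succ]
              omega
            rw [h4, show d3 ((0 : Fin (N + 1)), u.succ) + size ((0 : Fin (N + 1)), u.succ) + M =
              N + 1 + M - size ((0 : Fin (N + 1)), u.succ) by omega]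
            ring
          · rw [Finset.prod_map]
            simp only [h2, h3]

theorem f9_eq {M : ℕ} (hM : 1 ≤ M) (q : K) (b : Fin N → Bool) :
    f9 M b q = lf9 M q (List.ofFn b) := by
  rw [f9, f9_index M hM, lf9_ofFn]

end Telescoping

end TypeBI

namespace TypeBI

/-! ### Simplification of `N₆`, `N₇`, `N₈` and `N₁₀`. -/

section Factors

variable {N : ℕ} {M : ℕ} {K : Type*} [Field K] {q : K}

theorem labelPos_eq {b : Fin N → Bool} {p : ℕ} {c : Fin N} (hc : c ∈ labelled M b p) :
    labelPos M b p = c + 1 := by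
  have h : labelled M b p = {c} := by
    ext i
    rw [Finset.mem_singleton]
    refine ⟨fun hi => ?_, fun hi => hi ▸ hc⟩
    simp only [labelled, Finset.mem_filter] at hi hc
    exact rank_inj hi.1 hc.1 (by omega)
  rw [labelPos, h, Finset.sup_singleton, pos]

theorem tailCount_lt_rightIndex_of_mem_setV {b : Fin N → Bool} {c : Fin N} (hc : c ∈ setV M b) :
    tailCount b < rightIndex M b c := by
  have h1 := (mem_setV M).1 hc
  have h2 := tailCount_le_arcsFrom h1.1
  have h3 := rank_pos h1.1
  rw [rightIndex_of_mem_setV M hc]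
  omega

theorem tailCount_lt_rightIndex_of_mem_dashedArcs {b : Fin N → Bool} {E : Fin N × Fin N}
    (hE : E ∈ dashedArcs M b) : tailCount b < rightIndex M b E.1 := by
  have h1 := dashed_fst_rank M hE
  have h2 := tailCount_le_arcsFrom h1.1
  have h3 := rightIndex_of_mem_dashedArcs M hE
  omega

theorem mem_setV_of_mem_setU {b : Fin N → Bool} {c : Fin N} (hc : c ∈ setU M b) :
    c ∈ setV M b := (Finset.mem_filter.1 hc).1

theorem mem_setV_of_mem_star {b : Fin N → Bool} {c : Fin N} (hc : c ∈ labelled M b 1) :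
    c ∈ setV M b := by
  rw [mem_labelled_one] at hc
  exact (mem_setV M).2 ⟨hc.1, hc.2.le⟩

theorem lt_fst_of_level_eq_zero {b : Fin N → Bool} {A : Fin N × Fin N} {c : Fin N}
    (hA : A ∈ arcs b) (hc : c ∈ downArrows b) (h : level b A = 0) : c < A.1 :=
  (lt_fst_iff_level_lt hA hc).2 (h ▸ rank_pos hc)

/-- Positions are traded for counts of arcs and ranks by `add_arcsFrom_of_free` and
`add_arcsFrom_of_down`; the half-sum becomes a difference of counts, the form required by
`prod_freeArcs`. -/
theorem d1_eq {b : Fin N → Bool} {A : Fin N × Fin N} {C : Fin N} (hA : A ∈ freeArcs b)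
    (hl : level b A = 0) (hC : C ∈ setV M b) :
    d1 M b A C = rightIndex M b C - arcsFrom b A.1 := by
  have h1 := (mem_setV M).1 hC
  have h2 := add_arcsFrom_of_free hA
  have h3 := add_arcsFrom_of_down h1.1
  have h4 := lt_fst_of_level_eq_zero (freeArcs_subset b hA) h1.1 hl
  have h5 := rank_pos h1.1
  rw [rightIndex_of_mem_setV M hC, d1, label, pos, pos]
  omega

theorem d2_eq {b : Fin N → Bool} {A : Fin N × Fin N} {C : Fin N} (hA : A ∈ freeArcs b)
    (hl : level b A = 0) (hC : C ∈ labelled M b 1) :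
    d2 M b A = rightIndex M b C - arcsFrom b A.1 := by
  have h1 := (mem_labelled_one M).1 hC
  have h2 := add_arcsFrom_of_free hA
  have h3 := add_arcsFrom_of_down h1.1
  have h4 := lt_fst_of_level_eq_zero (freeArcs_subset b hA) h1.1 hl
  rw [rightIndex_of_mem_setV M (mem_setV_of_mem_star hC), d2, labelPos_eq hC, pos]
  omega

theorem d4_eq (hM : 1 ≤ M) {b : Fin N → Bool} {C : Fin N} (hC : C ∈ setV M b) :
    d4 M b C = rightIndex M b C - tailCount b := by
  have h1 := (mem_setV M).1 hC
  have h3 := add_arcsFrom_of_down h1.1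
  have h4 := rank_pos h1.1
  obtain ⟨c, hc, hr⟩ := exists_rank b one_pos (h4.trans_le (rank_le_card b C))
  have h5 := add_arcsFrom_of_down hc
  have h6 := arcsFrom_of_rank_eq_one hc hr
  have h7 := lt_iff_rank_lt hc h1.1
  have h8 := tailCount_le_arcsFrom h1.1
  rw [rightIndex_of_mem_setV M hC, d4, labelPos_eq ((mem_labelled_self M hM).2 ⟨hc, hr⟩), label,
    pos]
  omega

/-- The position of the down arrow labelled `M` is fixed by `tailCount`, since the arcs after it are
exactly those to the right of all unmatched arrows. -/
theorem d5_eq (hM : 1 ≤ M) {b : Fin N → Bool} {E : Fin N × Fin N} (hE : E ∈ dashedArcs M b) :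
    d5 M b E = rightIndex M b E.1 - tailCount b := by
  have h1 := dashed_fst_rank M hE
  have h3 := add_arcsFrom_of_down h1.1
  have h4 := rank_pos h1.1
  obtain ⟨c, hc, hr⟩ := exists_rank b one_pos (h4.trans_le (rank_le_card b E.1))
  have h5 := add_arcsFrom_of_down hc
  have h6 := arcsFrom_of_rank_eq_one hc hr
  have h7 := lt_iff_rank_lt hc h1.1
  have h8 := tailCount_le_arcsFrom h1.1
  have h9 := rightIndex_of_mem_dashedArcs M hE
  rw [d5, labelPos_eq ((mem_labelled_self M hM).2 ⟨hc, hr⟩), pos]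
  omega

theorem arcsFrom_le_tailCount {b : Fin N → Bool} {A : Fin N × Fin N} (hA : A ∈ freeArcs b)
    (hl : level b A = 0) : arcsFrom b A.1 ≤ tailCount b := by
  refine Finset.card_le_card fun C hC => ?_
  rw [Finset.mem_filter] at hC ⊢
  refine ⟨hC.1, ?_, fun u hu => ?_⟩
  · have : level b C ≤ level b A := Finset.card_le_card fun d hd => by
      rw [Finset.mem_filter] at hd ⊢
      exact ⟨hd.1, hC.2.trans_lt hd.2⟩
    omega
  · exact ((Finset.mem_filter.1 hA).2.2 u hu).trans_le hC.2

/-- For each `C` the product over arcs telescopes with `g x = [R_C - x]`. -/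
theorem f7_eq (hq0 : q ≠ 0) (hq : ∀ n : ℕ, 0 < n → q ^ n ≠ 1) (hM : 1 ≤ M) (b : Fin N → Bool) :
    f7 M b q = ∏ C ∈ setU M b,
      qint q (rightIndex M b C - tailCount b) / qint q (rightIndex M b C) := by
  rw [f7]
  refine Finset.prod_congr rfl fun C hC => ?_
  have hV := mem_setV_of_mem_setU hC
  have hlt := tailCount_lt_rightIndex_of_mem_setV hV
  have hk := (rank_pos ((mem_setV M).1 hV).1).trans_le (rank_le_card b C)
  have := prod_freeArcs b (fun x => qint q (rightIndex M b C - x))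
    fun i hi => qint_ne_zero hq0 hq (by omega)
  rw [Nat.sub_zero] at this
  rw [← this, setSR_inter_outerArcs M hM hk]
  refine Finset.prod_congr rfl fun A hA => ?_
  obtain ⟨hA, hl⟩ := Finset.mem_filter.1 hA
  have h1 := size_le_arcsFrom hA hl
  have h2 := arcsFrom_le_tailCount hA hl
  rw [d1_eq hA hl hV]
  congr 2
  omega

/-- Between the left end of `E` and the star there are only arcs of `S_W` and dashed arcs. Such an
arc cannot pass over the left end of `E`, so it may be located by its right end. -/
theorem dashed_from_eq {b : Fin N → Bool} {E : Fin N × Fin N} (hE : E ∈ dashedArcs M b)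
    {C : Fin N} (hC : C ∈ labelled M b 1) (hM : 1 ≤ M) :
    rightIndex M b C + (((setSW M b).filter fun A => E.1 ≤ A.2).card +
      ((dashedArcs M b).filter fun E' => E.1 ≤ E'.1).card) = rightIndex M b E.1 := by
  have hC' := (mem_labelled_one M).1 hC
  have h1 := rightIndex_of_mem_setV M (mem_setV_of_mem_star hC)
  have h2 := rightIndex_of_mem_dashedArcs M hE
  have h3 := card_dashedArcs_from M hE
  have h4 := dashed_fst_rank M hE
  have h5 : arcsFrom b C + ((setSW M b).filter fun A => E.1 ≤ A.2).card = arcsFrom b E.1 := by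
    rw [arcsFrom_eq hC'.1, arcsFrom_eq h4.1, ← Finset.card_union_of_disjoint]
    · congr 1
      ext A
      simp only [Finset.mem_union, Finset.mem_filter, mem_setSW M hM]
      by_cases hA : A ∈ arcs b
      · have h5 := snd_lt_iff_le_level hA h4.1
        have h6 := rank_le_card b E.1
        have h7 : A.2 ≠ E.1 := fun h => by
          have := arcs_downs hA h4.1
          have := arc_fst_lt_snd hA
          omega
        simp only [hA, true_and]
        omega
      · simp [hA]
    · refine Finset.disjoint_left.2 fun A hA hA' => ?_
      simp only [Finset.mem_filter, mem_setSW M hM] at hA hA'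
      omega
  omega

/-- As arcs do not cross, lying to the right of `A` or around it amounts to ending weakly to the
right of its end. So `h_A` is a rank among right ends of arcs in `S_W` and left ends of dashed arcs.
-/
theorem arcH_eq (hM : 1 ≤ M) {b : Fin N → Bool} {A : Fin N × Fin N} (hA : A ∈ setSW M b) :
    arcH M b A = ((setSW M b).filter fun C => A.2 ≤ C.2).card +
      ((dashedArcs M b).filter fun E => A.2 ≤ E.1).card := by
  have hA' := ((mem_setSW M hM).1 hA).1
  rw [arcH]
  congr 2
  · refine Finset.filter_congr fun C hC => ?_
    have hC' := ((mem_setSW M hM).1 hC).1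
    have h1 := arc_fst_lt_snd hA'
    have h2 := arc_fst_lt_snd hC'
    constructor
    · omega
    · intro h
      by_cases h3 : A.1 < C.1
      · have := arcs_noncrossing hA' hC' h3
        obtain h4 | h4 := this
        · exact .inl h4
        · omega
      · exact .inr ⟨not_lt.1 h3, h⟩
  · refine Finset.filter_congr fun E hE => ?_
    have h1 := arcs_downs hA' (dashed_fst_rank M hE).1
    have h2 := arc_fst_lt_snd hA'
    omega

/-- The ranks of the right ends of the arcs in `S_W` among these and the left ends of the dashed
arcs are complementary to the ranks of the latter. -/
theorem prod_rank_setSW (hM : 1 ≤ M) (b : Fin N → Bool) (F : ℕ → K) :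
    (∏ A ∈ setSW M b, F (arcH M b A)) * (∏ E ∈ dashedArcs M b,
      F (((setSW M b).filter fun A => E.1 ≤ A.2).card +
        ((dashedArcs M b).filter fun E' => E.1 ≤ E'.1).card)) =
      ∏ i ∈ Finset.range (n3 M b), F (i + 1) := by
  have hinj : ∀ A ∈ setSW M b, ∀ C ∈ setSW M b, A.2 = C.2 → A = C := fun A hA C hC h =>
    arc_ext_snd ((mem_setSW M hM).1 hA).1 ((mem_setSW M hM).1 hC).1 h
  have hinj' : ∀ A ∈ dashedArcs M b, ∀ C ∈ dashedArcs M b, A.1 = C.1 → A = C :=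
    fun A hA C hC h => dashed_ext M hA hC h
  have hdisj : Disjoint ((setSW M b).image Prod.snd) ((dashedArcs M b).image Prod.fst) := by
    refine Finset.disjoint_left.2 fun x hx hx' => ?_
    obtain ⟨A, hA, rfl⟩ := Finset.mem_image.1 hx
    obtain ⟨E, hE, h⟩ := Finset.mem_image.1 hx'
    have h1 := ((mem_setSW M hM).1 hA).1
    have h2 := arcs_downs h1 (dashed_fst_rank M hE).1
    have h3 := arc_fst_lt_snd h1
    omega
  have hcard : ∀ x, (((setSW M b).image Prod.snd ∪ (dashedArcs M b).image Prod.fst).filter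
      fun y => x ≤ y).card = ((setSW M b).filter fun A => x ≤ A.2).card +
        ((dashedArcs M b).filter fun E' => x ≤ E'.1).card := fun x => by
    rw [Finset.filter_union, Finset.card_union_of_disjoint
      (Finset.disjoint_filter_filter hdisj), card_filter_image_fst hinj', Finset.filter_image,
      Finset.card_image_of_injOn]
    intro A hA C hC h
    exact hinj A (Finset.mem_filter.1 hA).1 C (Finset.mem_filter.1 hC).1 h
  have h := prod_rank_ge ((setSW M b).image Prod.snd ∪ (dashedArcs M b).image Prod.fst) F
  rw [Finset.prod_union hdisj, Finset.prod_image hinj, Finset.prod_image hinj',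
    Finset.card_union_of_disjoint hdisj, Finset.card_image_of_injOn (fun A hA C hC => hinj A hA C hC),
    Finset.card_image_of_injOn (fun A hA C hC => hinj' A hA C hC)] at h
  simp only [hcard] at h
  rw [n3, ← h]
  congr 1
  exact Finset.prod_congr rfl fun A hA => by rw [arcH_eq hM hA]

/-- In each factor of `N₈` the run of `N₃ + 1` consecutive quantum integers is thinned out by the
ranks `h_{A'}`. By `prod_rank_setSW` the survivors are one term for the star and one for each dashed
arc, and the product over `S_R⁺` telescopes for all of them at once. -/
theorem f8_eq (hq0 : q ≠ 0) (hq : ∀ n : ℕ, 0 < n → q ^ n ≠ 1) (hM : 1 ≤ M) (b : Fin N → Bool) :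
    f8 M b q = (∏ C ∈ labelled M b 1,
        qint q (rightIndex M b C - tailCount b) / qint q (rightIndex M b C)) *
      ∏ E ∈ dashedArcs M b,
        qint q (rightIndex M b E.1 - tailCount b) / qint q (rightIndex M b E.1) := by
  rw [f8, card_setV]
  split_ifs with hk
  · obtain ⟨c, hc, hr⟩ := exists_rank b hM (by omega : M ≤ (downArrows b).card)
    have hstar : c ∈ labelled M b 1 := (mem_labelled_one M).2 ⟨hc, hr⟩
    have hsing : labelled M b 1 = {c} := by
      ext i
      rw [mem_labelled_one, Finset.mem_singleton]
      exact ⟨fun h => rank_inj h.1 hc (by omega), fun h => h ▸ ⟨hc, hr⟩⟩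
    have hlt := tailCount_lt_rightIndex_of_mem_setV (mem_setV_of_mem_star hstar)
    set e : Fin N × Fin N → ℕ := fun E => ((setSW M b).filter fun A => E.1 ≤ A.2).card +
        ((dashedArcs M b).filter fun E' => E.1 ≤ E'.1).card with he
    -- The surviving terms: `y` itself belongs to the star and `y + e E` to the dashed arc `E`,
    -- where `e E` is the difference of the two right indices.
    set Φ : ℕ → K := fun y => qint q y * ∏ E ∈ dashedArcs M b, qint q (y + e E) with hΦ
    have key : ∀ y, 0 < y → (∏ i ∈ Finset.range (n3 M b + 1), qint q (y + i)) =
        Φ y * ∏ A ∈ setSW M b, qint q (y + arcH M b A) := fun y hy => by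
      rw [Finset.prod_range_succ', ← prod_rank_setSW hM b fun i => qint q (y + i), hΦ]
      simp only [add_zero]
      ring
    have hne : ∀ y, 0 < y → (∏ A ∈ setSW M b, qint q (y + arcH M b A)) ≠ 0 := fun y hy =>
      Finset.prod_ne_zero_iff.2 fun A _ => qint_ne_zero hq0 hq (by omega)
    have hΦ0 : ∀ y, 0 < y → Φ y ≠ 0 := fun y hy =>
      mul_ne_zero (qint_ne_zero hq0 hq hy)
        (Finset.prod_ne_zero_iff.2 fun A _ => qint_ne_zero hq0 hq (by omega))
    have htel := prod_freeArcs b (fun x => Φ (rightIndex M b c - x))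
      fun i hi => hΦ0 _ (by omega)
    have hfin : ∀ x ≤ tailCount b, Φ (rightIndex M b c - x) =
        qint q (rightIndex M b c - x) *
          ∏ E ∈ dashedArcs M b, qint q (rightIndex M b E.1 - x) := fun x hx => by
      refine congrArg₂ (· * ·) rfl (Finset.prod_congr rfl fun E hE => congrArg _ ?_)
      rw [← dashed_from_eq hE hstar hM]
      simp only [he]
      omega
    rw [hfin _ le_rfl, hfin 0 (Nat.zero_le _)] at htel
    rw [hsing, Finset.prod_singleton, Finset.prod_div_distrib, div_mul_div_comm]
    simp only [Nat.sub_zero] at htel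
    rw [← htel, setSR_inter_outerArcs M hM (by omega)]
    refine Finset.prod_congr rfl fun A hA => ?_
    obtain ⟨hA, hl⟩ := Finset.mem_filter.1 hA
    have h1 := size_le_arcsFrom hA hl
    have h2 := arcsFrom_le_tailCount hA hl
    have h3 : rightIndex M b c - (arcsFrom b A.1 - size A) = d2 M b A + size A := by
      rw [d2_eq hA hl hstar]
      omega
    have h4 : 0 < d2 M b A := by
      rw [d2_eq hA hl hstar]
      omega
    rw [h3, ← d2_eq hA hl hstar, Finset.prod_div_distrib, Finset.prod_div_distrib, key _ h4,
      key _ (by omega)]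
    have h5 := hne _ h4
    have h6 := hne (d2 M b A + size A) (by omega)
    have h7 := hΦ0 (d2 M b A + size A) (by omega)
    field_simp
  · have h1 : labelled M b 1 = ∅ := Finset.eq_empty_of_forall_notMem fun c hc => by
      rw [mem_labelled_one] at hc
      have := rank_le_card b c
      omega
    have h2 : dashedArcs M b = ∅ := by
      rw [← Finset.card_eq_zero, card_dashedArcs]
      omega
    rw [h1, h2, Finset.prod_empty, Finset.prod_empty, one_mul]

/-- So `N₄` is the right index of the leftmost unmatched down arrow, reduced by `tailCount`: the
very factor that `N₁₀` omits when `N₁ = 0`. -/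
theorem n4_eq (hM : 1 ≤ M) {b : Fin N → Bool} {x : Fin N} (hx : x ∈ downArrows b)
    (hr : rank b x = (downArrows b).card) (hk : EvenFull M (downArrows b).card) :
    2 * (n4 M b + tailCount b) = 2 * arcsFrom b x + M + (downArrows b).card := by
  obtain ⟨h1, h2⟩ := hk
  have h3 := card_arcs_right_of_leftmost M hM hx hr h1
  rw [card_setSR M hM (by omega)] at h3
  rw [n4, card_dashedArcs]
  omega

/-- The arrow with the integer `M` may be included for free, because its factor is `[1] = 1`. -/
theorem prod_setU' (hM : 1 ≤ M) (b : Fin N → Bool) :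
    ∏ C ∈ setU' M b, (qint q (d4 M b C))⁻¹ =
      ∏ C ∈ setU M b, (qint q (rightIndex M b C - tailCount b))⁻¹ := by
  have h : ∏ C ∈ setU M b, (qint q (rightIndex M b C - tailCount b))⁻¹ =
      ∏ C ∈ setU M b, (qint q (d4 M b C))⁻¹ :=
    Finset.prod_congr rfl fun C hC => by rw [d4_eq hM (mem_setV_of_mem_setU hC)]
  rw [h]
  refine Finset.prod_subset (Finset.filter_subset _ _) fun C hC hC' => ?_
  have hV := mem_setV_of_mem_setU hC
  have h1 := (mem_setU M).1 hC
  have h2 := rank_pos h1.1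
  have h3 : rank b C = 1 := by
    by_contra h3
    exact hC' (Finset.mem_filter.2 ⟨hC, by rw [label]; omega⟩)
  rw [d4_eq hM hV, rightIndex_of_mem_setV M hV, arcsFrom_of_rank_eq_one h1.1 h3, h3,
    Nat.add_sub_cancel_left, qint_one, inv_one]

theorem prod_setV' (hM : 1 ≤ M) (b : Fin N → Bool) :
    ∏ C ∈ setV' M b, (qint q (d4 M b C))⁻¹ =
      (∏ C ∈ setU M b, (qint q (rightIndex M b C - tailCount b))⁻¹) *
        ∏ C ∈ labelled M b 1, (qint q (rightIndex M b C - tailCount b))⁻¹ := by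
  rw [setV', Finset.prod_union, prod_setU' hM]
  · congr 1
    exact Finset.prod_congr rfl fun C hC => by rw [d4_eq hM (mem_setV_of_mem_star hC)]
  · refine Finset.disjoint_left.2 fun x hx hx' => ?_
    have h1 := (mem_setU M).1 (Finset.filter_subset _ _ hx)
    rw [mem_labelled_one] at hx'
    omega

theorem prod_setT' (hM : 1 ≤ M) {b : Fin N → Bool} {E₀ : Fin N × Fin N}
    (hE₀ : E₀ ∈ dashedArcs M b) (hr : rank b E₀.1 = (downArrows b).card) :
    (qint q (rightIndex M b E₀.1 - tailCount b))⁻¹ * ∏ E ∈ setT' M b, (qint q (d5 M b E))⁻¹ =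
      ∏ E ∈ dashedArcs M b, (qint q (rightIndex M b E.1 - tailCount b))⁻¹ := by
  have h : setT' M b = (dashedArcs M b).erase E₀ := by
    ext E
    rw [setT', Finset.mem_filter, Finset.mem_erase, and_comm]
    refine and_congr_left fun hE => ?_
    have h1 := (dashed_fst_rank M hE).1
    have h2 := (dashed_fst_rank M hE₀).1
    constructor
    · rintro ⟨E', hE', hlt⟩ rfl
      have h3 := (lt_iff_rank_lt (dashed_fst_rank M hE').1 h1).1 hlt
      have h4 := rank_le_card b E'.1
      omega
    · intro hne
      refine ⟨E₀, hE₀, (lt_iff_rank_lt h2 h1).2 (lt_of_le_of_ne ?_ fun h => hne ?_)⟩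
      · rw [hr]
        exact rank_le_card b E.1
      · exact dashed_ext M hE hE₀ (rank_inj h1 h2 h)
  rw [h, ← Finset.mul_prod_erase _ _ hE₀]
  congr 1
  exact Finset.prod_congr rfl fun E hE => by rw [d5_eq hM (Finset.mem_of_mem_erase hE)]

/-- The telescoped products leave `[R - t] / [R]` for every labelled arrow and dashed arc, with `t =
tailCount`. `N₁₀` cancels the numerators, except that of the leftmost dashed arc, or of the star if
it is leftmost, when `N₁ = 0`; this one is cancelled by the denominator `[N₄]` of `N₆`. -/
theorem f6_mul_f7_mul_f8_mul_f10 (hq0 : q ≠ 0) (hq : ∀ n : ℕ, 0 < n → q ^ n ≠ 1) (hM : 1 ≤ M)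
    (b : Fin N → Bool) :
    f6 M b q * f7 M b q * f8 M b q * f10 M b q =
      (if EvenFull M (downArrows b).card then qint q (n5 M b) else 1) /
        ((∏ C ∈ setU M b, qint q (rightIndex M b C)) *
          ((∏ C ∈ labelled M b 1, qint q (rightIndex M b C)) *
            ∏ E ∈ dashedArcs M b, qint q (rightIndex M b E.1))) := by
  have hU : (∏ C ∈ setU M b, qint q (rightIndex M b C - tailCount b)) ≠ 0 :=
    Finset.prod_ne_zero_iff.2 fun C hC => qint_ne_zero hq0 hq
      (Nat.sub_pos_of_lt (tailCount_lt_rightIndex_of_mem_setV (mem_setV_of_mem_setU hC)))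
  have hS : (∏ C ∈ labelled M b 1, qint q (rightIndex M b C - tailCount b)) ≠ 0 :=
    Finset.prod_ne_zero_iff.2 fun C hC => qint_ne_zero hq0 hq
      (Nat.sub_pos_of_lt (tailCount_lt_rightIndex_of_mem_setV (mem_setV_of_mem_star hC)))
  have hT : (∏ E ∈ dashedArcs M b, qint q (rightIndex M b E.1 - tailCount b)) ≠ 0 :=
    Finset.prod_ne_zero_iff.2 fun C hC => qint_ne_zero hq0 hq
      (Nat.sub_pos_of_lt (tailCount_lt_rightIndex_of_mem_dashedArcs hC))
  have hT0 : dashedArcs M b = ∅ ↔ (downArrows b).card ≤ M + 1 := by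
    rw [← Finset.card_eq_zero, card_dashedArcs]
    omega
  rw [f7_eq hq0 hq hM, f8_eq hq0 hq hM, f6, f10, card_setV, n1_eq]
  simp only [Finset.prod_div_distrib]
  by_cases h1 : M < (downArrows b).card ∧ ((downArrows b).card - M) % 2 = 1
  · have h2 : ¬ EvenFull M (downArrows b).card := fun h => by
      obtain ⟨-, h⟩ := h
      omega
    have h3 : ∏ E ∈ dashedArcs M b, (qint q (d5 M b E))⁻¹ =
        ∏ E ∈ dashedArcs M b, (qint q (rightIndex M b E.1 - tailCount b))⁻¹ :=
      Finset.prod_congr rfl fun E hE => by rw [d5_eq hM hE]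
    simp only [h1, h2, if_true, if_false, and_self, one_ne_zero, and_false]
    rw [prod_setV' hM, h3]
    simp only [Finset.prod_inv_distrib]
    field_simp
  · simp only [if_neg h1, zero_ne_one, if_false, and_true, hT0]
    by_cases h2 : (downArrows b).card ≤ M + 1
    · rw [if_pos h2, prod_setU' hM, hT0.2 h2]
      simp only [Finset.prod_empty, div_one, mul_one, Finset.prod_inv_distrib]
      by_cases h3 : (downArrows b).card = M
      · have h4 : EvenFull M (downArrows b).card := ⟨h3.ge, by omega⟩
        obtain ⟨c, hc, hr⟩ := exists_rank b hM h3.ge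
        have hstar : c ∈ labelled M b 1 := (mem_labelled_one M).2 ⟨hc, hr⟩
        have hsing : labelled M b 1 = {c} := by
          ext i
          rw [mem_labelled_one, Finset.mem_singleton]
          exact ⟨fun h => rank_inj h.1 hc (by omega), fun h => h ▸ ⟨hc, hr⟩⟩
        have h5 := n4_eq hM hc (by omega) h4
        have h6 : n4 M b = rightIndex M b c - tailCount b := by
          rw [rightIndex_of_mem_setV M (mem_setV_of_mem_star hstar), hr]
          omega
        rw [hsing, Finset.prod_singleton] at hS
        rw [if_pos (by omega), if_pos h4, hsing, Finset.prod_singleton, Finset.prod_singleton, h6]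
        field_simp
      · have h4 : (downArrows b).card < M := by omega
        have h5 : labelled M b 1 = ∅ := Finset.eq_empty_of_forall_notMem fun c hc => by
          rw [mem_labelled_one] at hc
          have := rank_le_card b c
          omega
        have h6 : ¬ EvenFull M (downArrows b).card := fun h => by
          obtain ⟨h, -⟩ := h
          omega
        rw [if_neg (by omega), if_neg h6, h5]
        simp only [Finset.prod_empty, div_one, mul_one]
        field_simp
    · have h4 : EvenFull M (downArrows b).card := ⟨by omega, by omega⟩
      obtain ⟨E, hE, hr⟩ := exists_leftmost_dashedArc M (b := b) (by omega) h4.2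
      have h5 := n4_eq hM (dashed_fst_rank M hE).1 hr h4
      have h7 := rightIndex_of_mem_dashedArcs M hE
      have h6 : n4 M b = rightIndex M b E.1 - tailCount b := by omega
      have h8 : qint q (rightIndex M b E.1 - tailCount b) ≠ 0 := qint_ne_zero hq0 hq
        (Nat.sub_pos_of_lt (tailCount_lt_rightIndex_of_mem_dashedArcs hE))
      have h9 := prod_setT' (q := q) hM hE hr
      have h10 : ∏ E ∈ setT' M b, (qint q (d5 M b E))⁻¹ =
          qint q (rightIndex M b E.1 - tailCount b) *
            (∏ E ∈ dashedArcs M b, qint q (rightIndex M b E.1 - tailCount b))⁻¹ := by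
        rw [← Finset.prod_inv_distrib, ← h9, mul_inv_cancel_left₀ h8]
      rw [if_neg h2, if_pos (by omega), if_pos h4, prod_setV' hM, h10, h6]
      simp only [Finset.prod_inv_distrib]
      field_simp

end Factors

end TypeBI

namespace TypeBI

/-! ### Left indices, `N₅`, `N₁₁`, `N₁₂`, and the hook length form of the components. -/

section Psi

variable {N : ℕ} {M : ℕ}

theorem card_filter_le_getElem? {α : Type*} [LinearOrder α] (l : List α) (h : l.Pairwise (· < ·))
    {i : ℕ} {u : α} (hi : l[i]? = some u) : (l.toFinset.filter fun v => v ≤ u).card = i + 1 := by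
  induction l generalizing i with
  | nil => simp at hi
  | cons x l ih =>
    obtain ⟨h1, h2⟩ := List.pairwise_cons.1 h
    rw [List.toFinset_cons, Finset.filter_insert]
    cases i with
    | zero =>
      simp at hi
      subst hi
      rw [if_pos le_rfl, Finset.filter_false_of_mem]
      · simp
      · intro v hv
        exact not_le.2 (h1 v (List.mem_toFinset.1 hv))
    | succ i =>
      rw [List.getElem?_cons_succ] at hi
      have hu := h1 u (List.mem_of_getElem? hi)
      rw [if_pos hu.le, Finset.card_insert_of_notMem, ih h2 hi]
      intro hx
      exact lt_irrefl x (h1 x (List.mem_toFinset.1 (Finset.mem_filter.1 hx).1))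

theorem card_ups_le {b : Fin N → Bool} {i : ℕ} {u : Fin N} (hi : (upsList b)[i]? = some u) :
    ((upArrows b).filter fun v => v ≤ u).card = i + 1 := by
  rw [← toFinset_upsList]
  exact card_filter_le_getElem? _ (upsList_pairwise b) hi

theorem unpairedDown_disjoint {b : Fin N → Bool} {i : Fin N} (hi : i ∈ unpairedDown M b) :
    i ∉ (dashedArcs M b).image Prod.fst := by
  intro h
  obtain ⟨E, hE, rfl⟩ := Finset.mem_image.1 h
  have h1 := dashed_fst_rank M hE
  have h2 := (mem_unpairedDown M).1 hi
  omega

theorem leftEnum_disjoint (b : Fin N → Bool) :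
    Disjoint (upArrows b) (unpairedDown M b) ∧
    Disjoint (upArrows b ∪ unpairedDown M b) ((arcs b).image Prod.fst) ∧
    Disjoint (upArrows b ∪ unpairedDown M b ∪ (arcs b).image Prod.fst)
      ((dashedArcs M b).image Prod.fst) ∧
    Disjoint (upArrows b ∪ unpairedDown M b ∪ (arcs b).image Prod.fst ∪
      (dashedArcs M b).image Prod.fst) (setU M b) := by
  have hud : ∀ u ∈ upArrows b, u ∉ downArrows b := fun u hu hd =>
    lt_irrefl _ (ups_lt_downs hu hd)
  have had : ∀ x ∈ (arcs b).image Prod.fst, x ∉ downArrows b ∧ x ∉ upArrows b := fun x hx => by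
    obtain ⟨A, hA, rfl⟩ := Finset.mem_image.1 hx
    exact ⟨arc_fst_notMem_downArrows hA, arc_fst_notMem_upArrows hA⟩
  have hunp : ∀ x ∈ unpairedDown M b, x ∈ downArrows b ∧ M < rank b x := fun x hx => by
    rw [mem_unpairedDown] at hx
    exact ⟨hx.1, hx.2.2.1⟩
  have hT : ∀ x ∈ (dashedArcs M b).image Prod.fst, x ∈ downArrows b ∧ M < rank b x :=
    fun x hx => by
      obtain ⟨E, hE, rfl⟩ := Finset.mem_image.1 hx
      have := dashed_fst_rank M hE
      exact ⟨this.1, by omega⟩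
  refine ⟨Finset.disjoint_left.2 fun x h1 h2 => hud x h1 (hunp x h2).1,
    Finset.disjoint_left.2 fun x h1 h2 => ?_, Finset.disjoint_left.2 fun x h1 h2 => ?_,
    Finset.disjoint_left.2 fun x h1 h2 => ?_⟩
  · obtain h1 | h1 := Finset.mem_union.1 h1
    · exact (had x h2).2 h1
    · exact (had x h2).1 (hunp x h1).1
  · obtain h1 | h1 := Finset.mem_union.1 h1
    · obtain h1 | h1 := Finset.mem_union.1 h1
      · exact hud x h1 (hT x h2).1
      · exact unpairedDown_disjoint h1 h2
    · exact (had x h1).1 (hT x h2).1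
  · rw [mem_setU] at h2
    obtain h1 | h1 := Finset.mem_union.1 h1
    · obtain h1 | h1 := Finset.mem_union.1 h1
      · obtain h1 | h1 := Finset.mem_union.1 h1
        · exact hud x h1 h2.1
        · have := hunp x h1
          omega
      · exact (had x h1).1 h2.1
    · have := hT x h1
      omega

theorem card_leftEnum (b : Fin N → Bool) : (leftEnum M b).card =
    enumCount M ((upArrows b).card + (arcs b).card) (downArrows b).card := by
  obtain ⟨h1, h2, h3, h4⟩ := leftEnum_disjoint (M := M) b
  have h5 := n1_eq M b
  rw [n1] at h5
  rw [leftEnum, Finset.card_union_of_disjoint h4, Finset.card_union_of_disjoint h3,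
    Finset.card_union_of_disjoint h2, Finset.card_union_of_disjoint h1, h5,
    Finset.card_image_of_injOn (fun A hA C hC h => arc_ext hA hC h),
    Finset.card_image_of_injOn (fun A hA C hC h => dashed_ext M hA hC h), card_dashedArcs,
    card_setU, enumCount, pairCount]
  split_ifs <;> omega

/-- Only unmatched up arrows and arcs can start to the left of `u`. The result has the shape of
`getElem?_lups`, so the two notions of left index agree. -/
theorem leftIndex_up {b : Fin N → Bool} {i : ℕ} {u : Fin N} (hi : (upsList b)[i]? = some u) :
    2 * leftIndex M b u = u + i + 2 := by
  have hu : u ∈ upArrows b := (mem_upsList _ _).1 (List.mem_of_getElem? hi)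
  have h1 : (leftEnum M b).filter (fun j => j ≤ u) =
      (upArrows b).filter (fun v => v ≤ u) ∪ ((arcs b).image Prod.fst).filter fun v => v ≤ u := by
    ext x
    simp only [leftEnum, Finset.mem_filter, Finset.mem_union]
    have h2 : x ∈ downArrows b → ¬ x ≤ u := fun h => not_le.2 (ups_lt_downs hu h)
    have h3 : x ∈ unpairedDown M b → x ∈ downArrows b := fun h => ((mem_unpairedDown M).1 h).1
    have h4 : x ∈ setU M b → x ∈ downArrows b := fun h => ((mem_setU M).1 h).1
    have h5 : x ∈ (dashedArcs M b).image Prod.fst → x ∈ downArrows b := fun h => by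
      obtain ⟨E, hE, rfl⟩ := Finset.mem_image.1 h
      exact (dashed_fst_rank M hE).1
    tauto
  have h2 : (((arcs b).image Prod.fst).filter fun v => v ≤ u).card + arcsFrom b u =
      (arcs b).card := by
    rw [card_filter_image_fst (fun A hA C hC h => arc_ext hA hC h), arcsFrom,
      ← Finset.card_filter_add_card_filter_not (s := arcs b) fun A => A.1 ≤ u]
    congr 2
    refine Finset.filter_congr fun A hA => ?_
    have := arcs_ups hA hu
    have := arc_fst_lt_snd hA
    omega
  have h3 : ((upArrows b).filter fun v => u ≤ v).card = (upArrows b).card - i := by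
    have h4 := Finset.card_filter_add_card_filter_not (s := upArrows b) fun v => v ≤ u
    have h5 : ((upArrows b).filter fun v => u ≤ v) =
        insert u ((upArrows b).filter fun v => ¬ v ≤ u) := by
      ext v
      simp only [Finset.mem_filter, Finset.mem_insert]
      constructor
      · rintro ⟨h, h'⟩
        obtain rfl | h' := eq_or_lt_of_le h'
        · exact .inl rfl
        · exact .inr ⟨h, not_le.2 h'⟩
      · rintro (rfl | ⟨h, h'⟩)
        · exact ⟨hu, le_rfl⟩
        · exact ⟨h, (not_le.1 h').le⟩
    rw [card_ups_le hi] at h4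
    rw [h5, Finset.card_insert_of_notMem (by simp)]
    omega
  have h4 := add_arcsFrom_of_up hu
  have h5 := two_mul_card_arcs b
  have h6 : i < (upArrows b).card := by
    rw [← length_upsList]
    exact (List.getElem?_eq_some_iff.1 hi).1
  rw [leftIndex, h1, Finset.card_union_of_disjoint, card_ups_le hi]
  · omega
  · refine Finset.disjoint_filter_filter (Finset.disjoint_left.2 fun x hx hx' => ?_)
    obtain ⟨A, hA, rfl⟩ := Finset.mem_image.1 hx'
    exact arc_fst_notMem_upArrows hA hx

theorem lups_ofFn (b : Fin N → Bool) :
    lups (List.ofFn b) = (upsList b).map (leftIndex M b) := by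
  refine List.ext_getElem? fun i => ?_
  rw [List.getElem?_map]
  cases h : (upsList b)[i]? with
  | none =>
    rw [Option.map_none, List.getElem?_eq_none_iff, length_lups]
    exact List.getElem?_eq_none_iff.1 h
  | some u =>
    obtain ⟨m, hm, hm'⟩ := getElem?_lups b h
    rw [hm, Option.map_some]
    have := leftIndex_up (M := M) h
    congr 1
    omega

/-- `N₅` adds to `N - |S| + M` the arcs to the right of the last unmatched up arrow, whereas the
left index of that arrow counts the up arrows and the arcs to its left. With `N = 2|S| + N_↑ + k`
the two sides agree. Without unmatched up arrows every arc counts and the default index `0` is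
right. -/
theorem n5_eq (hM : 1 ≤ M) {b : Fin N → Bool} (hk : M ≤ (downArrows b).card) :
    n5 M b = 2 * ((upArrows b).card + (arcs b).card) + (downArrows b).card + M -
      (lups (List.ofFn b)).getLastD 0 := by
  have h1 := card_arcs_right_of_ups M hM hk
  have h2 := two_mul_card_arcs b
  have h0 := length_upsList b
  rw [lups_ofFn (M := M), n5]
  rcases List.eq_nil_or_concat (upsList b) with h | ⟨l, u, h⟩
  · have h3 : upArrows b = ∅ := (upsList_eq_nil b).1 h
    rw [h3, Finset.filter_true_of_mem (by simp)] at h1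
    rw [h, h3]
    simp [h3] at h2 ⊢
    omega
  · rw [h, List.length_concat] at h0
    have h3 : (upsList b)[l.length]? = some u := by simp [h]
    have h4 := leftIndex_up (M := M) h3
    have h5 := card_ups_le h3
    have hu : u ∈ upArrows b := (mem_upsList _ _).1 (List.mem_of_getElem? h3)
    have h6 : ∀ v ∈ upArrows b, v ≤ u := by
      intro v hv
      by_contra hn
      have : ((upArrows b).filter fun v => v ≤ u).card < (upArrows b).card :=
        Finset.card_lt_card ⟨Finset.filter_subset _ _, fun hs =>
          hn (Finset.mem_filter.1 (hs hv)).2⟩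
      omega
    have h7 : ((upArrows b).filter fun v => u ≤ v) = {u} := by
      ext v
      rw [Finset.mem_filter, Finset.mem_singleton]
      exact ⟨fun h => le_antisymm (h6 v h.1) h.2, fun h => by rw [h]; exact ⟨hu, le_rfl⟩⟩
    have h8 : ((arcs b).filter fun A => ∀ v ∈ upArrows b, v < A.1).card = arcsFrom b u := by
      rw [arcsFrom]
      congr 1
      refine Finset.filter_congr fun A hA => ⟨fun h => (h u hu).le, fun h v hv => ?_⟩
      refine (h6 v hv).trans_lt (lt_of_le_of_ne h ?_)
      rintro rfl
      exact arc_fst_notMem_upArrows hA hu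
    have h9 := add_arcsFrom_of_up hu
    rw [h7, Finset.card_singleton] at h9
    rw [h8] at h1
    have h10 : ((upsList b).map (leftIndex M b)).getLastD 0 = leftIndex M b u := by
      simp [h]
    rw [h10]
    omega

variable {K : Type*} [Field K] {q : K}

/-- The left indices of all objects run through `1, 2, …` and give a factorial; `N₁₁` omits those of
the unmatched up arrows. -/
theorem f11_eq (hq0 : q ≠ 0) (hq : ∀ n : ℕ, 0 < n → q ^ n ≠ 1) (b : Fin N → Bool) :
    f11 M b q = qfact q (enumCount M ((upArrows b).card + (arcs b).card) (downArrows b).card) /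
      ((lups (List.ofFn b)).map (qint q)).prod := by
  obtain ⟨h1, h2, h3, h4⟩ := leftEnum_disjoint (M := M) b
  have h := prod_rank_le (leftEnum M b) (qint q)
  rw [card_leftEnum] at h
  have h5 : ((lups (List.ofFn b)).map (qint q)).prod =
      ∏ u ∈ upArrows b, qint q (leftIndex M b u) := by
    rw [lups_ofFn (M := M), ← toFinset_upsList, List.prod_toFinset _
      ((upsList_pairwise b).imp fun h => ne_of_lt h), List.map_map]
    rfl
  have h6 : (∏ u ∈ upArrows b, qint q (leftIndex M b u)) ≠ 0 := by
    rw [← h5]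
    refine List.prod_ne_zero fun h => ?_
    obtain ⟨u, hu, hu'⟩ := List.mem_map.1 h
    exact qint_ne_zero hq0 hq (pos_of_mem_lups hu) hu'
  rw [h5, eq_div_iff h6, qfact, ← h]
  change _ = ∏ x ∈ leftEnum M b, qint q (leftIndex M b x)
  rw [leftEnum, Finset.prod_union h4, Finset.prod_union h3, Finset.prod_union h2,
    Finset.prod_union h1, Finset.prod_image (fun A hA C hC h => arc_ext hA hC h),
    Finset.prod_image (fun A hA C hC h => dashed_ext M hA hC h), f11]
  ring

theorem n2_eq (b : Fin N → Bool) :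
    n2 M b = pairCount M ((upArrows b).card + (arcs b).card) (downArrows b).card := by
  rw [n2, n1_eq, card_dashedArcs, pairCount]
  split_ifs <;> omega

theorem f12_eq (b : Fin N → Bool) :
    f12 M b q = qangProd M q
        (pairCount M ((upArrows b).card + (arcs b).card) (downArrows b).card) /
      ((∏ E ∈ dashedArcs M b, qang q (rightIndex M b E.1)) *
        ∏ C ∈ labelled M b 1, qang q (rightIndex M b C)) := by
  have h : ∀ n, ∏ i ∈ Finset.Icc 1 n, qang q (i + M - 1) = qangProd M q n := fun n => by
    induction n with
    | zero => simp [qangProd]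
    | succ n ih =>
      rw [Finset.prod_Icc_succ_top (by omega), ih, qangProd_succ, Nat.add_right_comm,
        Nat.add_sub_cancel]
  rw [f12, setV_sdiff_setU, n2_eq, h]

/-- The component `Ψ_D` is given by hook lengths. -/
theorem psi_eq (hq0 : q ≠ 0) (hq : ∀ n : ℕ, 0 < n → q ^ n ≠ 1) (hM : 1 ≤ M)
    (b : Fin N → Bool) : psi M b q = lG M q (List.ofFn b) := by
  have h0 : psi M b q = (∏ A ∈ arcs b, (qint q (size A))⁻¹) *
      (f6 M b q * f7 M b q * f8 M b q * f10 M b q) * f9 M b q * f11 M b q * f12 M b q := by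
    rw [psi]
    ring
  have h1 : (if EvenFull M (downArrows b).card then qint q (n5 M b) else 1) =
      if EvenFull M (downArrows b).card then
        qint q (2 * ((upArrows b).card + (arcs b).card) + (downArrows b).card + M -
          (lups (List.ofFn b)).getLastD 0) else 1 := by
    split_ifs with h
    · rw [n5_eq hM h.1]
    · rfl
  rw [h0, f6_mul_f7_mul_f8_mul_f10 hq0 hq hM, f9_eq hM, f11_eq hq0 hq, f12_eq, h1, lG, hval,
    lacc_ofFn, ldn_ofFn, lna_ofFn, length_lups, length_upsList]
  simp only [zero_add, add_zero, ← qint_mul_qang hq0 hq, Finset.prod_mul_distrib,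
    Finset.prod_inv_distrib, div_eq_mul_inv, mul_inv]
  ring

end Psi

end TypeBI

namespace TypeBI

/-! ### The Kazhdan–Lusztig basis and the vector `Ψ` by recursion -/

section Recursion

variable {K : Type*} [Field K] {q : K} {M : ℕ}

theorem klVec_true {n : ℕ} (b : Fin n → Bool) (e : Bool) (ε : Fin n → Bool) :
    klVec M (bcons true b) q (bcons e ε) = stdVec K true e * klVec M b q ε := by
  rw [klVec_eq, klVec_eq, ofFn_cons, ofFn_cons, wordVec]

theorem klVec_false (hM : 1 ≤ M) {n : ℕ} (c : Fin n → Bool) (e : Bool) (ε : Fin n → Bool) :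
    klVec M (bcons false c) q (bcons e ε) = stdVec K false e * klVec M c q ε - stdVec K true e *
      ∑ b : Fin n → Bool, theta M q 0 (List.ofFn c) (List.ofFn b) * klVec M b q ε := by
  simp only [klVec_eq, ofFn_cons]
  exact wordVec_false M q hM e c ε

theorem Psi_apply {n : ℕ} (ε : Fin n → Bool) :
    Psi q M n ε = ∑ b : Fin n → Bool, psi M b q * klVec M b q ε := by
  simp [Psi, Finset.sum_apply]

theorem Psi_zero (hq0 : q ≠ 0) (hq : ∀ n : ℕ, 0 < n → q ^ n ≠ 1) (hM : 1 ≤ M)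
    (ε : Fin 0 → Bool) : Psi q M 0 ε = 1 := by
  have h : ¬ M ≤ 0 := by omega
  rw [Psi_apply, Fintype.sum_unique, psi_eq hq0 hq hM, klVec_eq]
  simp [lG, hval, lups, ldn, lna, lf9, lacc, enumCount, pairCount, qfact, qangProd, EvenFull, h,
    wordVec, downVec]

/-- The `θ`-terms that `D_{-c}` contributes to the `v₁`-component cancel against the transfer sum in
the recursion for the components at `+ b`, so both components are multiples of the shorter vector.
-/
theorem Psi_cons (hq0 : q ≠ 0) (hq : ∀ n : ℕ, 0 < n → q ^ n ≠ 1) (hM : 1 ≤ M) {n : ℕ} (e : Bool)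
    (ε : Fin n → Bool) : Psi q M (n + 1) (bcons e ε) =
      (q ^ (M + n) * stdVec K true e + stdVec K false e) * Psi q M n ε := by
  have h : ∑ c : Fin n → Bool, lG M q (List.ofFn c) *
      ∑ b : Fin n → Bool, theta M q 0 (List.ofFn c) (List.ofFn b) * klVec M b q ε =
      ∑ b : Fin n → Bool, thetaSum M q 0 (List.ofFn b) (lG M q) * klVec M b q ε := by
    simp only [Finset.mul_sum, ← sum_theta, Finset.sum_mul]
    rw [Finset.sum_comm]
    exact Finset.sum_congr rfl fun b _ => Finset.sum_congr rfl fun c _ => by ring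
  have h1 : ∑ c : Fin n → Bool, lG M q (false :: List.ofFn c) * klVec M (bcons false c) q (bcons e ε) =
      stdVec K false e * ∑ c : Fin n → Bool, lG M q (List.ofFn c) * klVec M c q ε -
        stdVec K true e * ∑ c : Fin n → Bool, thetaSum M q 0 (List.ofFn c) (lG M q) *
          klVec M c q ε := by
    rw [← h, Finset.mul_sum, Finset.mul_sum, ← Finset.sum_sub_distrib]
    refine Finset.sum_congr rfl fun c _ => ?_
    rw [klVec_false hM, lG_false M hq0 hq hM]
    ring
  have h2 : ∑ c : Fin n → Bool, lG M q (true :: List.ofFn c) * klVec M (bcons true c) q (bcons e ε) =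
      stdVec K true e * (q ^ (M + n) * ∑ c : Fin n → Bool, lG M q (List.ofFn c) * klVec M c q ε) +
        stdVec K true e * ∑ c : Fin n → Bool, thetaSum M q 0 (List.ofFn c) (lG M q) *
          klVec M c q ε := by
    rw [Finset.mul_sum, Finset.mul_sum, Finset.mul_sum, ← Finset.sum_add_distrib]
    refine Finset.sum_congr rfl fun c _ => ?_
    rw [klVec_true, lG_true M hq0 hq hM, List.length_ofFn]
    ring
  rw [Psi_apply, Psi_apply, sum_cons]
  simp only [psi_eq hq0 hq hM, ofFn_cons]
  rw [h1, h2]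
  ring

/-- The linear map `w ↦ v_e ⊗ w`. -/
def tensorLeft (K : Type*) [Field K] (e : Bool) (n : ℕ) :
    ((Fin n → Bool) → K) →ₗ[K] ((Fin (n + 1) → Bool) → K) where
  toFun w ε := stdVec K e (ε 0) * w (Fin.tail ε)
  map_add' v w := by
    ext ε
    simp [mul_add]
  map_smul' a w := by
    ext ε
    simp [mul_left_comm]

theorem tensorLeft_apply (e a : Bool) {n : ℕ} (w : (Fin n → Bool) → K) (ε : Fin n → Bool) :
    tensorLeft K e n w (bcons a ε) = stdVec K e a * w ε := by
  simp [tensorLeft]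

theorem ext_bcons {A : Type*} {n : ℕ} {v w : (Fin (n + 1) → Bool) → A}
    (h : ∀ e ε, v (bcons e ε) = w (bcons e ε)) : v = w := by
  ext ε
  obtain ⟨e, ε, rfl⟩ := exists_bcons ε
  exact h e ε

/-- The vectors for `+ b` give all of `v₁ ⊗ V`. Modulo these, the vector for `- c` is `v₋₁ ⊗ D_c`,
and such tensors give the rest. -/
theorem span_klVec (hM : 1 ≤ M) (n : ℕ) :
    Submodule.span K (Set.range fun b : Fin n → Bool => klVec M b q) = ⊤ := by
  induction n with
  | zero =>
    rw [eq_top_iff]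
    intro v _
    have h : v = v default • klVec M default q := by
      ext ε
      have h1 : klVec M (default : Fin 0 → Bool) q ε = 1 := by
        rw [klVec_eq]
        simp [wordVec, downVec]
      rw [Pi.smul_apply, h1, smul_eq_mul, mul_one, Subsingleton.elim ε default]
    rw [h]
    exact Submodule.smul_mem _ _ (Submodule.subset_span ⟨_, rfl⟩)
  | succ n ih =>
    set S := Submodule.span K (Set.range fun b : Fin (n + 1) → Bool => klVec M b q) with hS
    have hmem : ∀ b, klVec M b q ∈ S := fun b => Submodule.subset_span ⟨b, rfl⟩
    have ht : ∀ w, tensorLeft K true n w ∈ S := fun w => by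
      have hw : w ∈ Submodule.span K (Set.range fun b : Fin n → Bool => klVec M b q) := by
        rw [ih]; trivial
      induction hw using Submodule.span_induction with
      | mem w hw =>
        obtain ⟨b, rfl⟩ := hw
        convert hmem (bcons true b) using 1
        refine ext_bcons fun e ε => ?_
        rw [tensorLeft_apply, klVec_true]
      | zero => rw [map_zero]; exact S.zero_mem
      | add v w _ _ h1 h2 => rw [map_add]; exact S.add_mem h1 h2
      | smul a w _ h => rw [map_smul]; exact S.smul_mem a h
    have hf : ∀ w, tensorLeft K false n w ∈ S := fun w => by
      have hw : w ∈ Submodule.span K (Set.range fun b : Fin n → Bool => klVec M b q) := by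
        rw [ih]; trivial
      induction hw using Submodule.span_induction with
      | mem w hw =>
        obtain ⟨c, rfl⟩ := hw
        have h : tensorLeft K false n (klVec M c q) = klVec M (bcons false c) q +
            tensorLeft K true n (∑ b : Fin n → Bool,
              theta M q 0 (List.ofFn c) (List.ofFn b) • klVec M b q) := by
          refine ext_bcons fun e ε => ?_
          rw [Pi.add_apply, tensorLeft_apply, tensorLeft_apply, klVec_false hM, Finset.sum_apply]
          simp only [Pi.smul_apply, smul_eq_mul]
          ring
        change tensorLeft K false n (klVec M c q) ∈ S
        rw [h]
        exact S.add_mem (hmem _) (ht _)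
      | zero => rw [map_zero]; exact S.zero_mem
      | add v w _ _ h1 h2 => rw [map_add]; exact S.add_mem h1 h2
      | smul a w _ h => rw [map_smul]; exact S.smul_mem a h
    rw [eq_top_iff]
    intro v _
    have h : v = tensorLeft K true n (fun ε => v (bcons true ε)) +
        tensorLeft K false n (fun ε => v (bcons false ε)) := by
      refine ext_bcons fun e ε => ?_
      rw [Pi.add_apply, tensorLeft_apply, tensorLeft_apply]
      cases e <;> simp [stdVec]
    rw [h]
    exact S.add_mem (ht _) (hf _)

theorem linearIndependent_klVec (hM : 1 ≤ M) (n : ℕ) :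
    LinearIndependent K (fun b : Fin n → Bool => klVec M b q) :=
  linearIndependent_of_top_le_span_of_card_eq_finrank (span_klVec hM n).ge (by simp)

end Recursion

/-! ### The eigenspace -/

section Spectrum

open Matrix

variable {K : Type*} [Field K] {q : K}

/-- The block form of `X`. Since `c = q⁻¹`, the operator `c K E` sends `v₋₁` to `v₁`, so both
off-diagonal blocks are the identity. -/
theorem opX_mulVec (Q : K) {n : ℕ} (hq0 : q ≠ 0) (v : (Fin (n + 1) → Bool) → K)
    (ε : Fin n → Bool) :
    (opX q Q (n + 1) *ᵥ v) (bcons true ε) =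
        q * (opX q Q n *ᵥ fun δ => v (bcons true δ)) ε + v (bcons false ε) ∧
      (opX q Q (n + 1) *ᵥ v) (bcons false ε) =
        q⁻¹ * (opX q Q n *ᵥ fun δ => v (bcons false δ)) ε + v (bcons true ε) := by
  have h1 : ∀ e, (opX q Q (n + 1) *ᵥ v) (bcons e ε) =
      ∑ a : Bool, (opK q e a * (opX q Q n *ᵥ fun δ => v (bcons a δ)) ε +
        (q⁻¹ * (opK q * opE K) e a + opF K e a) * v (bcons a ε)) := fun e => by
    have h2 : ∀ a : Bool, ∑ δ : Fin n → Bool, opX q Q (n + 1) (bcons e ε) (bcons a δ) *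
        v (bcons a δ) = opK q e a * (opX q Q n *ᵥ fun δ => v (bcons a δ)) ε +
        (q⁻¹ * (opK q * opE K) e a + opF K e a) * v (bcons a ε) := fun a => by
      simp only [opX, tensorOp, Matrix.add_apply, Fin.cons_zero, Fin.tail_cons, add_mul,
        Finset.sum_add_distrib, Matrix.smul_apply, smul_eq_mul, Matrix.one_apply, mul_ite, mul_one,
        mul_zero, ite_mul, zero_mul, Finset.sum_ite_eq, Finset.mem_univ, if_true, Matrix.mulVec,
        dotProduct, Finset.mul_sum, mul_assoc, add_assoc]
    rw [Matrix.mulVec, dotProduct, sum_cons, Fintype.sum_bool]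
    exact congrArg₂ (· + ·) (h2 true) (h2 false)
  constructor
  · rw [h1, Fintype.sum_bool]
    simp [opK, opE, opF, Matrix.mul_apply, hq0]
  · rw [h1, Fintype.sum_bool]
    simp [opK, opE, opF, Matrix.mul_apply, add_comm]

theorem opX_zero_mulVec (Q : K) (v : (Fin 0 → Bool) → K) :
    opX q Q 0 *ᵥ v = paramS q Q • v := by
  rw [opX, Matrix.smul_mulVec, Matrix.one_mulVec]

theorem paramS_pow (hq0 : q ≠ 0) (hq : ∀ n : ℕ, 0 < n → q ^ n ≠ 1) (M : ℕ) :
    paramS q (q ^ M) = qint q M := by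
  rw [paramS, qint_eq hq0 hq]

theorem opX_isSymm (Q : K) (hq0 : q ≠ 0) (n : ℕ) : (opX q Q n).IsSymm := by
  induction n with
  | zero =>
    rw [opX]
    exact Matrix.isSymm_one.smul _
  | succ n ih =>
    ext ε δ
    obtain ⟨e, ε, rfl⟩ := exists_bcons ε
    obtain ⟨a, δ, rfl⟩ := exists_bcons δ
    have h := ih.apply ε δ
    cases e <;> cases a <;>
      simp [opX, tensorOp, opK, opE, opF, Matrix.mul_apply, h, hq0, Matrix.one_apply, eq_comm]

theorem qint_succ (hq0 : q ≠ 0) (hq : ∀ n : ℕ, 0 < n → q ^ n ≠ 1) (n : ℕ) :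
    qint q (n + 1) = q * qint q n + (q ^ n)⁻¹ := by
  rw [qint_add hq0 hq, qint_one, pow_one, mul_one]

theorem qint_succ' (hq0 : q ≠ 0) (hq : ∀ n : ℕ, 0 < n → q ^ n ≠ 1) (n : ℕ) :
    qint q (n + 1) = q⁻¹ * qint q n + q ^ n := by
  rw [add_comm n, qint_add hq0 hq, qint_one, pow_one, mul_one, add_comm]

/-- Equality of `[m]` and `[m+e]` would force `(q^e - 1) (q^{2m+e} + 1) = 0`, and either factor
makes `q` a root of unity. -/
theorem qint_ne_qint (hq0 : q ≠ 0) (hq : ∀ n : ℕ, 0 < n → q ^ n ≠ 1) {m n : ℕ} (h : m < n) :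
    qint q m ≠ qint q n := by
  intro he
  rw [qint_eq hq0 hq, qint_eq hq0 hq, div_left_inj' (sub_inv_ne_zero hq0 hq)] at he
  obtain ⟨d, rfl⟩ := Nat.exists_eq_add_of_lt h
  have hm := pow_ne_zero m hq0
  have hd := pow_ne_zero (d + 1) hq0
  have h1 : q ^ (d + 1) ≠ 1 := hq _ (Nat.succ_pos d)
  have h2 : q ^ m * q ^ m * q ^ (d + 1) ≠ -1 := fun h2 => by
    refine hq (2 * (m + m + (d + 1))) (by omega) ?_
    rw [pow_mul', pow_add, pow_add, h2]
    ring
  rw [add_assoc, pow_add] at he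
  field_simp at he
  have h3 : (q ^ (d + 1) - 1) * (q ^ m * q ^ m * q ^ (d + 1) + 1) = 0 := by
    linear_combination -he
  rcases mul_eq_zero.1 h3 with h3 | h3
  · exact h1 (sub_eq_zero.1 h3)
  · exact h2 (eq_neg_of_add_eq_zero_left h3)

/-- The first component of an eigenvector is killed by a quadratic polynomial in `X`. -/
theorem quadratic_of_eigen (Q : K) (hq0 : q ≠ 0) (hq : ∀ n : ℕ, 0 < n → q ^ n ≠ 1) {n a : ℕ}
    {v : (Fin (n + 1) → Bool) → K} (h : opX q Q (n + 1) *ᵥ v = qint q (a + 1) • v) :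
    (fun δ => v (bcons false δ)) = qint q (a + 1) • (fun δ => v (bcons true δ)) -
        q • (opX q Q n *ᵥ fun δ => v (bcons true δ)) ∧
      opX q Q n *ᵥ (opX q Q n *ᵥ (fun δ => v (bcons true δ)) -
          qint q a • fun δ => v (bcons true δ)) =
        qint q (a + 2) • (opX q Q n *ᵥ (fun δ => v (bcons true δ)) -
          qint q a • fun δ => v (bcons true δ)) := by
  have h1 : (fun δ => v (bcons false δ)) = qint q (a + 1) • (fun δ => v (bcons true δ)) -
        q • (opX q Q n *ᵥ fun δ => v (bcons true δ)) := by
    ext ε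
    have h2 := congrFun h (bcons true ε)
    rw [(opX_mulVec Q hq0 v ε).1] at h2
    simp only [Pi.smul_apply, Pi.sub_apply, smul_eq_mul] at h2 ⊢
    linear_combination h2
  refine ⟨h1, ?_⟩
  ext ε
  have h2 := congrFun h (bcons false ε)
  have h3 := congrFun h1 ε
  rw [(opX_mulVec Q hq0 v ε).2, h1] at h2
  simp only [Matrix.mulVec_sub, Matrix.mulVec_smul, Pi.smul_apply, Pi.sub_apply,
    smul_eq_mul] at h2 h3 ⊢
  rw [h3] at h2
  have e1 := qint_succ hq0 hq a
  have e2 := qint_succ' hq0 hq a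
  have e3 := qint_succ hq0 hq (a + 1)
  have hp := pow_ne_zero a hq0
  set x := qint q a
  set y := qint q (a + 1)
  set z := qint q (a + 2)
  -- `f1` and `f2` supply the sum and the product of the two roots `[a]` and `[a+2]` of the
  -- quadratic polynomial.
  have f1 : q⁻¹ * y + q * y = x + z := by
    have : q⁻¹ * y = x + q⁻¹ * (q ^ a)⁻¹ := by rw [e1]; field_simp
    rw [this, e3, pow_succ]
    field_simp
    ring
  have f2 : x * z = y * y - 1 := by
    have g1 : z = q * y + (q ^ a)⁻¹ * q⁻¹ := by rw [e3, pow_succ, mul_inv]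
    have g2 : x = q⁻¹ * (y - (q ^ a)⁻¹) := by rw [e1]; field_simp; ring
    have g3 : y = q⁻¹ * x + q ^ a := e2
    rw [g1]
    rw [g2] at g3 ⊢
    field_simp at g3 ⊢
    linear_combination -g3
  have hqi : q⁻¹ * q = 1 := inv_mul_cancel₀ hq0
  linear_combination (-1) * h2 + (opX q Q n *ᵥ fun δ => v (bcons true δ)) ε * f1 +
    v (bcons true ε) * f2 +
    (opX q Q n *ᵥ opX q Q n *ᵥ fun δ => v (bcons true δ)) ε * (-hqi)

/-- Both roots `[a-1]` and `[a+1]` of the quadratic equation are again out of range for one factor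
less, so `X` minus either is injective there, and the induction hypothesis is used twice. -/
theorem eq_zero_of_eigen (hq0 : q ≠ 0) (hq : ∀ n : ℕ, 0 < n → q ^ n ≠ 1) (M : ℕ) {n a : ℕ}
    (ha : n + M < a) {v : (Fin n → Bool) → K} (h : opX q (q ^ M) n *ᵥ v = qint q a • v) :
    v = 0 := by
  induction n generalizing a with
  | zero =>
    rw [opX_zero_mulVec, paramS_pow hq0 hq, ← sub_eq_zero, ← sub_smul] at h
    exact (smul_eq_zero.1 h).resolve_left (sub_ne_zero.2 (qint_ne_qint hq0 hq (by omega)))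
  | succ n ih =>
    obtain ⟨a, rfl⟩ : ∃ a', a = a' + 1 := ⟨a - 1, by omega⟩
    obtain ⟨h1, h2⟩ := quadratic_of_eigen _ hq0 hq h
    have h3 := ih (by omega) (ih (a := a + 2) (by omega) h2 |> sub_eq_zero.1)
    rw [h3] at h1
    refine ext_bcons fun e ε => ?_
    cases e with
    | true => exact congrFun h3 ε
    | false => simpa using congrFun h1 ε

variable {M : ℕ}

theorem opX_mulVec_Psi (hq0 : q ≠ 0) (hq : ∀ n : ℕ, 0 < n → q ^ n ≠ 1) (hM : 1 ≤ M) (n : ℕ) :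
    opX q (q ^ M) n *ᵥ Psi q M n = qint q (n + M) • Psi q M n := by
  induction n with
  | zero => rw [opX_zero_mulVec, paramS_pow hq0 hq, Nat.zero_add]
  | succ n ih =>
    have h1 : (fun δ => Psi q M (n + 1) (bcons true δ)) = q ^ (M + n) • Psi q M n := by
      ext δ
      rw [Psi_cons hq0 hq hM]
      simp [stdVec]
    have h2 : (fun δ => Psi q M (n + 1) (bcons false δ)) = Psi q M n := by
      ext δ
      rw [Psi_cons hq0 hq hM]
      simp [stdVec]
    refine ext_bcons fun e ε => ?_
    have h3 := congrFun h1 ε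
    have h4 := congrFun h2 ε
    have hp := pow_ne_zero (n + M) hq0
    rw [Nat.add_right_comm]
    cases e with
    | true =>
      rw [(opX_mulVec _ hq0 _ ε).1, h1, Matrix.mulVec_smul, ih, Pi.smul_apply _ _ (bcons true ε),
        h3, h4, qint_succ hq0 hq (n + M), add_comm M n]
      simp only [Pi.smul_apply, smul_eq_mul]
      field_simp
    | false =>
      rw [(opX_mulVec _ hq0 _ ε).2, h2, ih, Pi.smul_apply _ _ (bcons false ε),
        h3, h4, qint_succ' hq0 hq (n + M), add_comm M n]
      simp only [Pi.smul_apply, smul_eq_mul]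
      ring

/-- Of the two roots, `[n+M]` and `[n+M+2]`, the larger is out of range. Hence the `v₁`-component is
an eigenvector of the largest type for `n` factors, a multiple of `Ψ` by induction, and it
determines the other component. -/
theorem exists_smul_Psi (hq0 : q ≠ 0) (hq : ∀ n : ℕ, 0 < n → q ^ n ≠ 1) (hM : 1 ≤ M) {n : ℕ}
    {v : (Fin n → Bool) → K} (h : opX q (q ^ M) n *ᵥ v = qint q (n + M) • v) :
    ∃ c : K, v = c • Psi q M n := by
  induction n with
  | zero =>
    refine ⟨v default, ?_⟩
    ext ε
    rw [Pi.smul_apply, Psi_zero hq0 hq hM, smul_eq_mul, mul_one, Subsingleton.elim ε default]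
  | succ n ih =>
    rw [Nat.add_right_comm] at h
    obtain ⟨h1, h2⟩ := quadratic_of_eigen _ hq0 hq h
    have h3 := sub_eq_zero.1 (eq_zero_of_eigen hq0 hq M (by omega) h2)
    obtain ⟨c, hc⟩ := ih h3
    have hp := pow_ne_zero (n + M) hq0
    refine ⟨c * (q ^ (n + M))⁻¹, ext_bcons fun e ε => ?_⟩
    rw [Pi.smul_apply, Psi_cons hq0 hq hM, add_comm M n]
    have h4 := congrFun hc ε
    simp only [Pi.smul_apply, smul_eq_mul] at h4 ⊢
    cases e with
    | true =>
      rw [h4]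
      simp only [stdVec, if_true, Bool.true_eq_false, if_false]
      field_simp
      ring
    | false =>
      have h5 := congrFun h1 ε
      rw [h3, qint_succ hq0 hq] at h5
      simp only [Pi.smul_apply, Pi.sub_apply, smul_eq_mul] at h5
      rw [h5, h4]
      simp only [stdVec, if_true, Bool.false_eq_true, if_false]
      ring

/-- Each tensor factor `q^{M+n} v₁ + v₋₁` has dot product `q^{2(M+n)} + 1` with itself. -/
theorem Psi_dotProduct_ne_zero (hq0 : q ≠ 0) (hq : ∀ n : ℕ, 0 < n → q ^ n ≠ 1) (hM : 1 ≤ M)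
    (n : ℕ) : Psi q M n ⬝ᵥ Psi q M n ≠ 0 := by
  induction n with
  | zero => simp [dotProduct, Psi_zero hq0 hq hM]
  | succ n ih =>
    have h : Psi q M (n + 1) ⬝ᵥ Psi q M (n + 1) =
        q ^ (M + n) * qang q (M + n) * (Psi q M n ⬝ᵥ Psi q M n) := by
      have hp := pow_ne_zero (M + n) hq0
      rw [dotProduct, sum_cons, dotProduct, qang, mul_add, mul_inv_cancel₀ hp, add_mul,
        Finset.mul_sum, Finset.mul_sum]
      congr 1
      · refine Finset.sum_congr rfl fun ε _ => ?_
        rw [Psi_cons hq0 hq hM]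
        simp only [stdVec, if_true, Bool.true_eq_false, if_false]
        ring
      · refine Finset.sum_congr rfl fun ε _ => ?_
        rw [Psi_cons hq0 hq hM]
        simp only [stdVec, if_true, Bool.false_eq_true, if_false]
        ring
    rw [h]
    exact mul_ne_zero (mul_ne_zero (pow_ne_zero _ hq0) (qang_ne_zero hq0 hq (by omega))) ih

theorem Psi_ne_zero (hq0 : q ≠ 0) (hq : ∀ n : ℕ, 0 < n → q ^ n ≠ 1) (hM : 1 ≤ M) (n : ℕ) :
    Psi q M n ≠ 0 := fun h =>
  Psi_dotProduct_ne_zero hq0 hq hM n (by rw [h, dotProduct_zero])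

theorem eigenspace_eq_span (hq0 : q ≠ 0) (hq : ∀ n : ℕ, 0 < n → q ^ n ≠ 1) (hM : 1 ≤ M) (n : ℕ) :
    Module.End.eigenspace (Matrix.toLin' (opX q (q ^ M) n)) (qint q (n + M)) =
      Submodule.span K {Psi q M n} := by
  ext v
  rw [Module.End.mem_eigenspace_iff, Matrix.toLin'_apply, Submodule.mem_span_singleton]
  constructor
  · intro h
    obtain ⟨c, hc⟩ := exists_smul_Psi hq0 hq hM h
    exact ⟨c, hc.symm⟩
  · rintro ⟨c, rfl⟩
    rw [Matrix.mulVec_smul, opX_mulVec_Psi hq0 hq hM, smul_comm]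

/-- A Jordan block would give `(X - μ) v = c Ψ` with `c ≠ 0`. By symmetry of `X` the left side is
orthogonal to `Ψ`, but `Ψ` is not orthogonal to itself. -/
theorem maxGenEigenspace_eq_eigenspace (hq0 : q ≠ 0) (hq : ∀ n : ℕ, 0 < n → q ^ n ≠ 1)
    (hM : 1 ≤ M) (n : ℕ) :
    Module.End.maxGenEigenspace (Matrix.toLin' (opX q (q ^ M) n)) (qint q (n + M)) =
      Module.End.eigenspace (Matrix.toLin' (opX q (q ^ M) n)) (qint q (n + M)) := by
  set f := Matrix.toLin' (opX q (q ^ M) n) with hf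
  set μ := qint q (n + M) with hμ
  set g := f - algebraMap K (Module.End K ((Fin n → Bool) → K)) μ with hg
  have hgv : ∀ v, g v = opX q (q ^ M) n *ᵥ v - μ • v := fun v => by
    rw [hg, LinearMap.sub_apply, hf, Matrix.toLin'_apply, Module.algebraMap_end_apply]
  have key : ∀ v, g (g v) = 0 → g v = 0 := fun v h => by
    have h1 : opX q (q ^ M) n *ᵥ g v = μ • g v := by
      rw [hgv] at h
      exact sub_eq_zero.1 h
    obtain ⟨c, hc⟩ := exists_smul_Psi hq0 hq hM h1
    have h2 : Psi q M n ⬝ᵥ g v = 0 := by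
      rw [hgv, dotProduct_sub, dotProduct_mulVec, ← Matrix.mulVec_transpose,
        (opX_isSymm (q ^ M) hq0 n).eq, opX_mulVec_Psi hq0 hq hM, ← hμ, smul_dotProduct,
        dotProduct_smul, sub_self]
    rw [hc, dotProduct_smul, smul_eq_mul] at h2
    rw [hc, (mul_eq_zero.1 h2).resolve_right (Psi_dotProduct_ne_zero hq0 hq hM n), zero_smul]
  refine le_antisymm (fun v hv => ?_) (fun v hv => ?_)
  · obtain ⟨k, hk⟩ := (Module.End.mem_maxGenEigenspace _ _ _).1 hv
    -- Since `g² v = 0` implies `g v = 0` for every vector, any power of `g` that kills `v` can be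
    -- lowered to the first.
    have hind : ∀ k, (g ^ (k + 1)) v = 0 → g v = 0 := fun k => by
      induction k with
      | zero => simp
      | succ k ih =>
        intro h
        refine ih ?_
        rw [pow_succ', pow_succ', Module.End.mul_apply, Module.End.mul_apply] at h
        rw [pow_succ', Module.End.mul_apply]
        exact key _ h
    have hk' : (g ^ (k + 1)) v = 0 := by
      rw [pow_succ', Module.End.mul_apply]
      exact (congrArg g hk).trans (map_zero g)
    have := hind k hk'
    rw [hgv] at this
    rw [Module.End.mem_eigenspace_iff, hf, Matrix.toLin'_apply]
    exact sub_eq_zero.1 this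
  · refine (Module.End.mem_maxGenEigenspace _ _ _).2 ⟨1, ?_⟩
    rw [Module.End.mem_eigenspace_iff] at hv
    simp [hv]

end Spectrum

end TypeBI

theorem mainTheorem2 {K : Type*} [Field K] (q : K) (hq0 : q ≠ 0)
    (hq : ∀ n : ℕ, 0 < n → q ^ n ≠ 1) (M N : ℕ) (hM : 1 ≤ M) :
    (LinearIndependent K (fun b : Fin N → Bool => TypeBI.klVec M b q) ∧
      Submodule.span K (Set.range fun b : Fin N → Bool => TypeBI.klVec M b q) = ⊤) ∧
    Module.End.HasEigenvector (Matrix.toLin' (TypeBI.opX q (q ^ M) N))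
      (TypeBI.qint q (N + M)) (TypeBI.Psi q M N) ∧
    Module.finrank K (Module.End.eigenspace (Matrix.toLin' (TypeBI.opX q (q ^ M) N))
      (TypeBI.qint q (N + M))) = 1 ∧
    (TypeBI.opX q (q ^ M) N).charpoly.rootMultiplicity (TypeBI.qint q (N + M)) = 1 := by
  have hne := TypeBI.Psi_ne_zero hq0 hq hM N
  have hfin : Module.finrank K (Module.End.eigenspace (Matrix.toLin' (TypeBI.opX q (q ^ M) N))
      (TypeBI.qint q (N + M))) = 1 := by
    rw [TypeBI.eigenspace_eq_span hq0 hq hM, finrank_span_singleton hne]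
  refine ⟨⟨TypeBI.linearIndependent_klVec hM N, TypeBI.span_klVec hM N⟩, ⟨?_, hne⟩, hfin, ?_⟩
  · change _ ∈ Module.End.eigenspace _ _
    rw [TypeBI.eigenspace_eq_span hq0 hq hM]
    exact Submodule.mem_span_singleton_self _
  · rw [← Matrix.charpoly_toLin', ← LinearMap.finrank_maxGenEigenspace_eq,
      TypeBI.maxGenEigenspace_eq_eigenspace hq0 hq hM, hfin]
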